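/- Let $X$ be the affine curve over $\mathbb Q$ with coordinate ring $R=\mathbb Q[x^{\pm1},y^{\pm1},\delta^{-1}]/(xy+(1-x^2y)(1-y))$, where $\delta=(1-x^2y^2)/(xy)$, so that $\delta^2=x^2-2x-1-2x^{-1}+x^{-2}$; it is an open part of an elliptic curve with good reduction outside $\{2,3,5\}$. Put $$\omega=\frac1\delta\frac{dx}{x},\qquad \omega'=\frac{1}{\delta^{7}}\,(x^3-x^2-2x+5-2x^{-1}-x^{-2}+x^{-3})\,\frac{dx}{x}.$$ Let $f_X(e^\hbar)=e^{V(x)/\hbar}\,\delta^{-1/2}\,\varphi(\hbar)$, with $\varphi(\hbar)\in 1+\hbar R[[\hbar]]$, be the series obtained at the critical point $q^k=y$ by formal Gaussian integration, with $q=e^\hbar$ and $x=q^n$, from the sum $$h_n(q)=\sum_{k\in\mathbb Z}(-1)^{k+n}\frac{q^{k(k+1)/2+nk+n(2n+1)/2}}{(q;q)_k\,(q;q)_{k+2n}} .$$ Explicitly, write $\mathrm{Li}_{-m}(z)=(z\frac{d}{dz})^m\frac{z}{1-z}$ for $m\ge0$, and let $B_r(1)$ be the values at $1$ of the Bernoulli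 polynomials. Then $$\varphi(s^2)=e^{s^2/12}\Big\langle \exp\Big(\frac{sv}{2}+\sum_{\substack{r,j\ge0\\2r+j\ge3}}\frac{B_r(1)}{r!\,j!}\big(\mathrm{Li}_{2-r-j}(y)+\mathrm{Li}_{2-r-j}(x^2y)\big)\,s^{2r-2+j}v^j\Big)\Big\rangle,$$ where $\langle\cdot\rangle$ replaces $v^{2n}$ by $(2n-1)!!\,\delta^{-n}$ and $v^{2n+1}$ by $0$. Let $$g(q)=f_X(q)\,f_X(q^{-1})\,\frac{dx}{x}=\frac1\delta\,\varphi(\hbar)\,\varphi(-\hbar)\,\frac{dx}{x},\qquad \hbar=\log(1+(q-1)),$$ regarded as a power series in $q-1$ whose coefficients are 1-forms on $X$. **Proposition.** For every $k\ge0$ there are unique $a_k,b_k\in\mathbb Q$ such that the coefficient of $(q-1)^k$ in $g(q)$ equals $a_k\omega+b_k\omega'$ modulo exact forms $dh$, $h\in R$. Moreover, there is an integer $M>0$ such that for all $k\ge1$ and all primes $p\ne2,3,5$ the $p$-adic valuations of $a_k$ and of $b_k$ are at least $-\log_pM-\log_pk$ (with the valuation of $0$ read as $+\infty$). -/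

import Mathlib

noncomputable section

namespace FigureEight

open Polynomial

/-! ### The curve -/

/-- The ideal of the plane curve `x y + (1 - x² y)(1 - y) = 0`. -/
def curveIdeal : Ideal (MvPolynomial (Fin 2) ℚ) :=
  Ideal.span {MvPolynomial.X 0 * MvPolynomial.X 1
    + (1 - MvPolynomial.X 0 ^ 2 * MvPolynomial.X 1) * (1 - MvPolynomial.X 1)}

/-- `ℚ[x, y] / (x y + (1 - x² y)(1 - y))`. -/
abbrev PlaneRing : Type := MvPolynomial (Fin 2) ℚ ⧸ curveIdeal

/-- The function `x` on the plane curve. -/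
def x₀ : PlaneRing := Ideal.Quotient.mk curveIdeal (MvPolynomial.X 0)

/-- The function `y` on the plane curve. -/
def y₀ : PlaneRing := Ideal.Quotient.mk curveIdeal (MvPolynomial.X 1)

/-- The coordinate ring `ℚ[x^{±1}, y^{±1}, 1/δ] / (x y + (1 - x² y)(1 - y))` of the affine
curve `X` (base changed to `ℚ`), where `δ = (1 - x² y²)/(x y)`; see `delta_sq`. -/
abbrev CoordRing : Type := Localization.Away (x₀ * y₀ * (1 - x₀ ^ 2 * y₀ ^ 2))

/-- The coordinate `x` on `X`. -/
def x : CoordRing := algebraMap PlaneRing CoordRing x₀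

/-- The coordinate `y` on `X`. -/
def y : CoordRing := algebraMap PlaneRing CoordRing y₀

/-- The inverse of an element of the coordinate ring; it is only applied to units below. -/
abbrev inv (a : CoordRing) : CoordRing := Ring.inverse a

/-- The function `δ` on `X`, a square root of `x² - 2x - 1 - 2x⁻¹ + x⁻²` (`delta_sq`). -/
def δ : CoordRing := (1 - x ^ 2 * y ^ 2) * inv (x * y)

theorem curve_eq : x * y + (1 - x ^ 2 * y) * (1 - y) = 0 := by
  have h : x₀ * y₀ + (1 - x₀ ^ 2 * y₀) * (1 - y₀) = 0 :=
    Ideal.Quotient.eq_zero_iff_mem.mpr (Ideal.subset_span (Set.mem_singleton _))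
  have := congrArg (algebraMap PlaneRing CoordRing) h
  simpa [x, y] using this

theorem isUnit_prod : IsUnit (x * y * (1 - x ^ 2 * y ^ 2)) := by
  have := IsLocalization.Away.algebraMap_isUnit (S := CoordRing)
    (x₀ * y₀ * (1 - x₀ ^ 2 * y₀ ^ 2))
  simpa [x, y] using this

theorem isUnit_x : IsUnit x :=
  isUnit_of_mul_isUnit_left (isUnit_of_mul_isUnit_left isUnit_prod)

theorem isUnit_y : IsUnit y :=
  isUnit_of_mul_isUnit_right (isUnit_of_mul_isUnit_left isUnit_prod)

theorem isUnit_xy : IsUnit (x * y) := isUnit_x.mul isUnit_y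

theorem isUnit_one_sub_mul : IsUnit ((1 - x ^ 2 * y) * (1 - y)) := by
  have : (1 - x ^ 2 * y) * (1 - y) = -(x * y) := by linear_combination curve_eq
  rw [this]
  exact isUnit_xy.neg

theorem isUnit_one_sub_y : IsUnit (1 - y) := isUnit_of_mul_isUnit_right isUnit_one_sub_mul

theorem isUnit_one_sub_xxy : IsUnit (1 - x ^ 2 * y) :=
  isUnit_of_mul_isUnit_left isUnit_one_sub_mul

theorem isUnit_δ : IsUnit δ :=
  (isUnit_of_mul_isUnit_right isUnit_prod).mul isUnit_xy.ringInverse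

theorem delta_sq : δ ^ 2 = x ^ 2 - 2 * x - 1 - 2 * inv x + inv x ^ 2 := by
  have hx : x * inv x = 1 := Ring.mul_inverse_cancel _ isUnit_x
  have hs : x * y * inv (x * y) = 1 := Ring.mul_inverse_cancel _ isUnit_xy
  have hδ : δ = inv (x * y) - x * y := by
    unfold δ
    linear_combination (-(x * y)) * hs
  have hc : x * y + inv (x * y) = x + inv x - 1 := by
    have h : x * (x * y) * (x * y + inv (x * y)) = x * (x * y) * (x + inv x - 1) := by
      linear_combination x * curve_eq + x * hs - (x * y) * hx
    exact (isUnit_x.mul isUnit_xy).mul_left_cancel h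
  rw [hδ]
  linear_combination (x * y + inv (x * y) + x + inv x - 1) * hc - 4 * hs + 2 * hx

/-! ### Formal Gaussian integration -/

/-- The polynomial `P_m` with `Li_{-m}(z) = P_m(z / (1 - z))`: the recursion expresses that
`Li_{-m-1} = z d/dz Li_{-m}`, as `z d/dz` acts on `t = z / (1 - z)` by `t ↦ t + t²`. -/
def negPolylogPoly : ℕ → ℚ[X]
  | 0 => X
  | m + 1 => (X + X ^ 2) * derivative (negPolylogPoly m)

/-- The polylogarithm `Li_{-m}(z)` of nonpositive order, a rational function of `z`, at a function
`z` with `1 - z` invertible. -/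
def negPolylog (m : ℕ) (z : CoordRing) : CoordRing :=
  aeval (z * inv (1 - z)) (negPolylogPoly m)

/-- With `q = e^ħ`, `x = q^n`, `q^k = e^u`, and up to the constant `(q;q)_∞⁻²`, the summand of
`h_n(q) = ∑ₖ (-1)^(k+n) q^(k(k+1)/2 + n k + n(2n+1)/2) / ((q;q)_k (q;q)_{k+2n})`
is the exponential of a linear function of `u` divided by `ħ`, plus a function of `x`, plus
`u²/(2ħ) + u/2 + ∑_{r ≥ 0} B_r(1)/r! ħ^(r-1) (Li_{2-r}(e^u) + Li_{2-r}(x² e^u))`,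
by the expansion of `log (q z; q)_∞` as `ħ → 0`. By the equation of the curve, `e^u = y` is a
critical point of the terms of order `ħ⁻¹`. Put `u = log y + s v` with `s² = ħ`; then
`gaussExponent` is the sum of the terms of positive degree in `s` of the expansion at this point,
as a power series in `s` over the polynomials in `v`: the term `ħ^(r-1) (s v)^j / j!` has degree
`m = 2r - 2 + j` in `s`. -/
def gaussExponent : PowerSeries CoordRing[X] :=
  PowerSeries.mk fun m =>
    if m = 0 then 0 else
      (∑ r ∈ Finset.range (m / 2 + 2),
        C (algebraMap ℚ CoordRing
            (bernoulli' r / (r.factorial * (m + 2 - 2 * r).factorial : ℚ))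
          * (negPolylog (m - r) y + negPolylog (m - r) (x ^ 2 * y))) * X ^ (m + 2 - 2 * r))
      + if m = 1 then C (algebraMap ℚ CoordRing (1 / 2)) * X else 0

theorem hasSubst_gaussExponent : PowerSeries.HasSubst gaussExponent :=
  PowerSeries.HasSubst.of_constantCoeff_zero' (by
    rw [← PowerSeries.coeff_zero_eq_constantCoeff_apply]
    rw [gaussExponent, PowerSeries.coeff_mk, if_pos rfl])

/-- The terms of degree `0` in `s` and degree `2` in `v` are `-δ v²/2`. -/
theorem hessian_eq : 1 + negPolylog 0 y + negPolylog 0 (x ^ 2 * y) = -δ := by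
  have h1 : (1 - y) * inv (1 - y) = 1 := Ring.mul_inverse_cancel _ isUnit_one_sub_y
  have h2 : (1 - x ^ 2 * y) * inv (1 - x ^ 2 * y) = 1 :=
    Ring.mul_inverse_cancel _ isUnit_one_sub_xxy
  have hs : x * y * inv (x * y) = 1 := Ring.mul_inverse_cancel _ isUnit_xy
  have hc := curve_eq
  simp only [negPolylog, negPolylogPoly, aeval_X, δ]
  generalize inv (1 - y) = a at *
  generalize inv (1 - x ^ 2 * y) = b at *
  generalize inv (x * y) = c at *
  apply isUnit_one_sub_mul.mul_left_cancel
  linear_combination (1 - x ^ 2 * y) * y * h1 + (1 - y) * (x ^ 2 * y) * h2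
    - (1 - x ^ 2 * y ^ 2) * hs + (1 - x ^ 2 * y ^ 2) * c * hc

/-- The normalised Gaussian integral `∫ p(v) e^(-δ v²/2) dv / ∫ e^(-δ v²/2) dv` of a polynomial,
that is `v^(2n) ↦ (2n-1)!! δ^(-n)` and `v^(2n+1) ↦ 0`. -/
def gaussAverage (p : CoordRing[X]) : CoordRing :=
  p.sum fun j c => if Even j then c * (Nat.doubleFactorial (j - 1) : CoordRing) * inv δ ^ (j / 2)
    else 0

/-- The formal Gaussian integral of `exp gaussExponent`, a power series in `ħ = s²`
(the terms of odd degree in `s` are odd in `v`, so that their average vanishes). -/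
def gaussIntegral : PowerSeries CoordRing :=
  PowerSeries.mk fun k =>
    gaussAverage (PowerSeries.coeff (2 * k) ((PowerSeries.exp CoordRing[X]).subst gaussExponent))

/-- The series `φ(ħ) = 1 + O(ħ)` in `f_X(e^ħ) = e^(V(x)/ħ) δ^(-1/2) φ(ħ)`, the asymptotic series of
`h_n(e^ħ)` at `x = e^(n ħ)` given by formal Gaussian integration. The factor `e^(ħ/12)` is
the contribution of `(q;q)_∞⁻²`. -/
def fSeries : PowerSeries CoordRing :=
  PowerSeries.rescale (algebraMap ℚ CoordRing (1 / 12)) (PowerSeries.exp CoordRing) * gaussIntegral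

/-- `f_X(q) f_X(q⁻¹)` as a power series in `ħ = log q`; the factors `e^(V(x)/ħ)` and
`e^(-V(x)/ħ)` cancel. -/
def fSymHbar : PowerSeries CoordRing :=
  PowerSeries.C (inv δ) * (fSeries * PowerSeries.rescale (-1) fSeries)

/-- `f_X(q) f_X(q⁻¹)` as a power series in `q - 1`, by `ħ = log (1 + (q - 1))`. -/
def fSym : PowerSeries CoordRing := fSymHbar.subst (PowerSeries.log CoordRing)

/-! ### Differential forms and de Rham cohomology -/

/-- The algebraic 1-forms on the affine curve `X`. -/
abbrev Forms : Type := Ω[CoordRing⁄ℚ]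

/-- The form `dx / x`. -/
def dlogx : Forms := inv x • KaehlerDifferential.D ℚ CoordRing x

/-- The coefficient of `(q - 1)^k` in `g_X(q) = f_X(q) f_X(q⁻¹) dx / x`. -/
def gCoeff (k : ℕ) : Forms := PowerSeries.coeff k fSym • dlogx

/-- `ω = δ⁻¹ dx / x`. -/
def ω : Forms := inv δ • dlogx

/-- `ω' = δ⁻⁷ (x³ - x² - 2x + 5 - 2x⁻¹ - x⁻² + x⁻³) dx / x`. -/
def ω' : Forms :=
  (inv δ ^ 7 * (x ^ 3 - x ^ 2 - 2 * x + 5 - 2 * inv x - inv x ^ 2 + inv x ^ 3)) • dlogx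

/-- The exact forms. -/
def exactForms : Submodule ℚ Forms :=
  LinearMap.range (KaehlerDifferential.D ℚ CoordRing : CoordRing →ₗ[ℚ] Forms)

/-- Algebraic de Rham cohomology of the affine curve with rational coefficients: every 1-form is
closed, so this is the quotient by the exact forms. The cohomology of the complete curve, of rank
two, is the subspace of the classes of forms without residues. -/
abbrev H1dR : Type := Forms ⧸ exactForms

/-- The class of a form. -/
def cls (η : Forms) : H1dR := exactForms.mkQ η

/-- The coefficient of `(q - 1)^k` in `g_X(q)` has the class `a [ω] + b [ω']`. -/
def IsExpansion (k : ℕ) (a b : ℚ) : Prop := cls (gCoeff k) = a • cls ω + b • cls ω'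

end FigureEight

end

/-! Write t = x y, ξ = x + x⁻¹ = t + t⁻¹ + 1, δ = t⁻¹ - t and Q = q - 1. The proof has two halves:
an integrality statement for the coefficients of g, and a residue pairing on de Rham cohomology
whose denominators grow only linearly in k.

Integrality. Add a linear term κ s v to the exponent of the Gaussian integral (`gaussInt`).
Translating v by s multiplies the integrand by elementary factors, so translation invariance of the
Gaussian gives a three-term recurrence in κ (`gaussF_recurrence`). The discrete Wronskian of this
solution and of the one obtained by ħ ↦ -ħ, κ ↦ -κ equals δ (`wronsk_eq`): it does not depend on κ,
and a differential equation along the family (λ y, λ x² y) carries its value from λ = 0, where the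
integrals are explicit. After ħ = log (1 + Q) the powers of q are integral in Q, and the ratio of
consecutive solutions obeys a Riccati recurrence that contracts t-adically, so its coefficients lie
in ℤ⟦t⟧. Together with the Wronskian this puts the expansions of the coefficients of `fSym` into t
ℤ⟦t⟧ (`curveF_prod_integral`). On the other hand δ^(4n+1) times coefficient n is a Laurent
polynomial in t, invariant under t ↦ t⁻¹ (`curveProd_inv`). Hence it is a polynomial in ξ with
integer coefficients and degree at most 4n (`exists_coeff_fSym_eq`).

Cohomology. Coefficient k of g is therefore f(ξ) δ^(-4k) ω with f integral of degree at most 4k.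
Subtracting differentials of functions p(ξ) δ^(1-2L) (x - x⁻¹) lowers the power of δ^(-1) to two;
what remains is spanned by δ^(-2) ω and ξ δ^(-2) ω, equivalently by ω and ω'
(`exists_fracCls_eq_cls`). For uniqueness and for the bound, pair with n(ξ) δ^(-2) ω for n = 1 and n
= ξ: multiply by a formal primitive of this form at each zero of `polD` and add up the residues on
the ξ-line (`lam`). Integration by parts and the residue theorem show that the pairing kills exact
forms of the relevant shape (`lam_eq_zero_of_fracCls`), and the two functionals determine a_k and
b_k (`coefficients_eq`). For p ≠ 2, 3, 5 the only denominators in the pairing are the numbers 2i - 1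
with i ≤ 2k, which come from integrating s^(i - 3/2). So its p-adic norm is at most 4k + 1, and
inverting a 2 by 2 matrix costs a further factor of at most 184. -/

noncomputable section

namespace FigureEight

set_option linter.unusedSectionVars false

/-! ### Exponentials of power series -/

section ExpSeries

variable {S T : Type*} [CommRing S] [Algebra ℚ S] [CommRing T] [Algebra ℚ T]

/-- The exponential of a power series without constant term. -/
def expSeries (g : PowerSeries S) : PowerSeries S := (PowerSeries.exp S).subst g

/-- Uniqueness for a linear differential equation: (n + 1) times coefficient n + 1 of y is a
combination of earlier ones, and n + 1 is a unit in a ℚ-algebra. Most identities between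
exponentials below are proved by comparing such equations instead of expanding the substitution. -/
theorem eq_zero_of_derivative_eq_mul {y h : PowerSeries S}
    (hd : PowerSeries.derivative S y = h * y) (h0 : PowerSeries.constantCoeff y = 0) : y = 0 := by
  ext n
  rw [map_zero]
  induction n using Nat.strong_induction_on with
  | _ n ih =>
    cases n with
    | zero => simpa using h0
    | succ n =>
      have h1 := congrArg (PowerSeries.coeff n) hd
      rw [PowerSeries.coeff_derivative, PowerSeries.coeff_mul, Finset.sum_eq_zero] at h1
      · have hu : IsUnit ((n : S) + 1) := by
          have := (IsUnit.mk0 ((n : ℚ) + 1) (by positivity)).map (algebraMap ℚ S)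
          simpa using this
        exact (hu.mul_left_eq_zero).1 h1
      · rintro ⟨i, j⟩ hij
        have hij' : i + j = n := Finset.HasAntidiagonal.mem_antidiagonal.1 hij
        have hj : PowerSeries.coeff j y = 0 := ih j (by omega)
        simp only [hj, mul_zero]

theorem eq_of_derivative_eq_mul {y z h : PowerSeries S}
    (hy : PowerSeries.derivative S y = h * y) (hz : PowerSeries.derivative S z = h * z)
    (h0 : PowerSeries.constantCoeff y = PowerSeries.constantCoeff z) : y = z := by
  rw [← sub_eq_zero]
  refine eq_zero_of_derivative_eq_mul (h := h) ?_ ?_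
  · rw [map_sub, hy, hz, mul_sub]
  · rw [map_sub, h0, sub_self]

theorem derivative_mul' (f g : PowerSeries S) :
    PowerSeries.derivative S (f * g)
      = PowerSeries.derivative S f * g + f * PowerSeries.derivative S g := by
  rw [Derivation.leibniz, smul_eq_mul, smul_eq_mul, add_comm, mul_comm g]

theorem derivative_expSeries {g : PowerSeries S} (hg : PowerSeries.constantCoeff g = 0) :
    PowerSeries.derivative S (expSeries g) = PowerSeries.derivative S g * expSeries g := by
  rw [expSeries, PowerSeries.derivative_subst (PowerSeries.HasSubst.of_constantCoeff_zero' hg),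
    PowerSeries.derivative_exp, mul_comm]

theorem constantCoeff_expSeries {g : PowerSeries S} (hg : PowerSeries.constantCoeff g = 0) :
    PowerSeries.constantCoeff (expSeries g) = 1 := by
  have hs := PowerSeries.HasSubst.of_constantCoeff_zero' hg
  have h1 : expSeries g = 1 + (PowerSeries.exp S - 1).subst g := by
    have : PowerSeries.exp S = 1 + (PowerSeries.exp S - 1) := by ring
    rw [expSeries]
    conv_lhs => rw [this]
    rw [PowerSeries.subst_add hs, ← PowerSeries.coe_substAlgHom hs, map_one]
  have h2 := PowerSeries.constantCoeff_subst_eq_zero (a := g) hg (PowerSeries.exp S - 1) (by simp)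
  rw [h1, map_add, map_one]
  erw [h2]
  rw [add_zero]

theorem eq_expSeries {g y : PowerSeries S} (hg : PowerSeries.constantCoeff g = 0)
    (hd : PowerSeries.derivative S y = PowerSeries.derivative S g * y)
    (h0 : PowerSeries.constantCoeff y = 1) : y = expSeries g :=
  eq_of_derivative_eq_mul hd (derivative_expSeries hg) (by rw [h0, constantCoeff_expSeries hg])

theorem expSeries_add {g h : PowerSeries S} (hg : PowerSeries.constantCoeff g = 0)
    (hh : PowerSeries.constantCoeff h = 0) : expSeries (g + h) = expSeries g * expSeries h := by
  symm
  apply eq_expSeries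
  · rw [map_add, hg, hh, add_zero]
  · rw [Derivation.leibniz, derivative_expSeries hg, derivative_expSeries hh, map_add]
    simp only [smul_eq_mul]
    ring
  · rw [map_mul, constantCoeff_expSeries hg, constantCoeff_expSeries hh, one_mul]

theorem expSeries_zero : expSeries (0 : PowerSeries S) = 1 :=
  (eq_expSeries (by simp) (by simp) (by simp)).symm

theorem expSeries_mul_neg {g : PowerSeries S} (hg : PowerSeries.constantCoeff g = 0) :
    expSeries g * expSeries (-g) = 1 := by
  rw [← expSeries_add hg (by rw [map_neg, hg, neg_zero]), add_neg_cancel, expSeries_zero]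

theorem derivative_map (f : S →+* T) (g : PowerSeries S) :
    PowerSeries.derivative T (PowerSeries.map f g) = PowerSeries.map f (PowerSeries.derivative S g) := by
  ext n
  simp [PowerSeries.coeff_derivative]

theorem constantCoeff_map' (f : S →+* T) (g : PowerSeries S) :
    PowerSeries.constantCoeff (PowerSeries.map f g) = f (PowerSeries.constantCoeff g) := by
  rw [← PowerSeries.coeff_zero_eq_constantCoeff_apply, PowerSeries.coeff_map,
    PowerSeries.coeff_zero_eq_constantCoeff_apply]

theorem map_expSeries (f : S →+* T) {g : PowerSeries S} (hg : PowerSeries.constantCoeff g = 0) :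
    PowerSeries.map f (expSeries g) = expSeries (PowerSeries.map f g) := by
  apply eq_expSeries
  · rw [constantCoeff_map', hg, map_zero]
  · rw [derivative_map, derivative_expSeries hg, map_mul, derivative_map]
  · rw [constantCoeff_map', constantCoeff_expSeries hg, map_one]

theorem derivative_rescale (a : S) (g : PowerSeries S) :
    PowerSeries.derivative S (PowerSeries.rescale a g)
      = PowerSeries.C a * PowerSeries.rescale a (PowerSeries.derivative S g) := by
  ext n
  simp [PowerSeries.coeff_derivative, PowerSeries.coeff_rescale, pow_succ]
  ring

theorem rescale_expSeries (a : S) {g : PowerSeries S} (hg : PowerSeries.constantCoeff g = 0) :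
    PowerSeries.rescale a (expSeries g) = expSeries (PowerSeries.rescale a g) := by
  have hc (f : PowerSeries S) : PowerSeries.constantCoeff (PowerSeries.rescale a f)
      = PowerSeries.constantCoeff f := by
    rw [← PowerSeries.coeff_zero_eq_constantCoeff_apply, PowerSeries.coeff_rescale]; simp
  apply eq_expSeries
  · rw [hc, hg]
  · rw [derivative_rescale, derivative_expSeries hg, map_mul, derivative_rescale, mul_assoc]
  · rw [hc, constantCoeff_expSeries hg]

/-- The coefficientwise application of an additive map. -/
def coeffwise (Δ : S → T) (f : PowerSeries S) : PowerSeries T :=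
  PowerSeries.mk fun n => Δ (PowerSeries.coeff n f)

@[simp] theorem coeff_coeffwise (Δ : S → T) (f : PowerSeries S) (n : ℕ) :
    PowerSeries.coeff n (coeffwise Δ f) = Δ (PowerSeries.coeff n f) :=
  PowerSeries.coeff_mk _ _

theorem derivation_mul (Δ : Derivation ℚ S S) (f g : PowerSeries S) :
    coeffwise Δ (f * g) = coeffwise Δ f * g + f * coeffwise Δ g := by
  ext n
  simp only [coeff_coeffwise, PowerSeries.coeff_mul, map_add, map_sum, Derivation.leibniz,
    smul_eq_mul, Finset.sum_add_distrib]
  rw [add_comm]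
  congr 1
  exact Finset.sum_congr rfl fun _ _ => mul_comm _ _

theorem derivative_derivation (Δ : Derivation ℚ S S) (f : PowerSeries S) :
    PowerSeries.derivative S (coeffwise Δ f) = coeffwise Δ (PowerSeries.derivative S f) := by
  ext n
  rw [PowerSeries.coeff_derivative, coeff_coeffwise, coeff_coeffwise, PowerSeries.coeff_derivative,
    Derivation.leibniz]
  have : Δ ((n : S) + 1) = 0 := by
    rw [map_add, Derivation.map_one_eq_zero, Derivation.map_natCast, add_zero]
  rw [this, smul_zero, zero_add, smul_eq_mul, mul_comm]

/-- A derivation of the coefficients commutes with differentiation in the variable, so the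
difference of the two sides solves z' = g' z with zero constant term. -/
theorem derivation_expSeries (Δ : Derivation ℚ S S) {g : PowerSeries S}
    (hg : PowerSeries.constantCoeff g = 0) :
    coeffwise Δ (expSeries g) = coeffwise Δ g * expSeries g := by
  rw [← sub_eq_zero]
  refine eq_zero_of_derivative_eq_mul (h := PowerSeries.derivative S g) ?_ ?_
  · rw [map_sub, derivative_derivation, derivative_expSeries hg, Derivation.leibniz,
      derivative_expSeries hg, derivation_mul, derivative_derivation]
    simp only [smul_eq_mul]
    ring
  · rw [map_sub, map_mul, ← PowerSeries.coeff_zero_eq_constantCoeff_apply, coeff_coeffwise,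
      PowerSeries.coeff_zero_eq_constantCoeff_apply, constantCoeff_expSeries hg,
      ← PowerSeries.coeff_zero_eq_constantCoeff_apply (coeffwise Δ g), coeff_coeffwise,
      PowerSeries.coeff_zero_eq_constantCoeff_apply, hg]
    simp

theorem expSeries_subst {g w : PowerSeries S} (hg : PowerSeries.constantCoeff g = 0)
    (hw : PowerSeries.constantCoeff w = 0) :
    (expSeries g).subst w = expSeries (g.subst w) := by
  rw [expSeries, expSeries, PowerSeries.subst_comp_subst_apply
    (PowerSeries.HasSubst.of_constantCoeff_zero' hg)
    (PowerSeries.HasSubst.of_constantCoeff_zero' hw)]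

end ExpSeries

end FigureEight

end

noncomputable section

namespace FigureEight

set_option linter.unusedSectionVars false

open Polynomial

/-! ### Gaussian averages and the translation of the integration variable -/

section GaussAvg

variable {A B : Type*} [CommRing A] [Algebra ℚ A] [CommRing B] [Algebra ℚ B]

/-- The moments of the normalised Gaussian of variance `d`. -/
def gaussMoment (d : A) (j : ℕ) : A :=
  if Even j then (Nat.doubleFactorial (j - 1) : A) * d ^ (j / 2) else 0

/-- The Gaussian average of variance `d` of a polynomial. -/
def gaussAvg (d : A) : A[X] →ₗ[A] A :=
  Polynomial.lsum fun j => LinearMap.mulRight A (gaussMoment d j)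

theorem gaussAvg_apply (d : A) (p : A[X]) :
    gaussAvg d p = p.sum fun j c => c * gaussMoment d j := rfl

theorem gaussAvg_monomial (d : A) (n : ℕ) (a : A) :
    gaussAvg d (monomial n a) = a * gaussMoment d n := by
  rw [gaussAvg_apply, Polynomial.sum_monomial_index]
  rw [zero_mul]

theorem gaussAvg_C_mul (d a : A) (p : A[X]) : gaussAvg d (C a * p) = a * gaussAvg d p := by
  rw [← Polynomial.smul_eq_C_mul, map_smul, smul_eq_mul]

theorem gaussMoment_succ (d : A) (n : ℕ) :
    gaussMoment d (n + 1) = d * (n * gaussMoment d (n - 1)) := by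
  rcases n with _ | n
  · simp [gaussMoment]
  · unfold gaussMoment
    by_cases h : Even n
    · have h2 : Even (n + 1 + 1) := by simpa [Nat.even_add_one] using h
      have h3 : (n + 1 + 1) / 2 = n / 2 + 1 := by omega
      have h4 : (Nat.doubleFactorial (n + 1 + 1 - 1) : A)
          = ((n + 1 : ℕ) : A) * (Nat.doubleFactorial (n - 1) : A) := by
        rw [← Nat.cast_mul]
        congr 1
        rcases n with _ | n
        · rfl
        · exact Nat.doubleFactorial_add_two n
      rw [if_pos h2, h4, Nat.add_sub_cancel, if_pos h, h3, pow_succ]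
      ring
    · have h2 : ¬ Even (n + 1 + 1) := by simpa [Nat.even_add_one] using h
      rw [if_neg h2, Nat.add_sub_cancel, if_neg h, mul_zero, mul_zero]

/-- Integration by parts against the Gaussian weight of variance d; on monomials it is the recursion
of the moments. -/
theorem mul_gaussAvg_derivative (d : A) (p : A[X]) :
    d * gaussAvg d (derivative p) = gaussAvg d (X * p) := by
  induction p using Polynomial.induction_on' with
  | add p q hp hq => rw [map_add, map_add, mul_add, hp, hq, mul_add, map_add]
  | monomial n a =>
    rw [derivative_monomial, X_mul_monomial, gaussAvg_monomial, gaussAvg_monomial,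
      gaussMoment_succ]
    ring

theorem map_gaussMoment (f : A →+* B) (d : A) (j : ℕ) :
    f (gaussMoment d j) = gaussMoment (f d) j := by
  unfold gaussMoment
  split_ifs <;> simp

theorem map_gaussAvg (f : A →+* B) (d : A) (p : A[X]) :
    f (gaussAvg d p) = gaussAvg (f d) (p.map f) := by
  induction p using Polynomial.induction_on' with
  | add p q hp hq => rw [map_add, map_add, hp, hq, Polynomial.map_add, map_add]
  | monomial n a =>
    rw [Polynomial.map_monomial, gaussAvg_monomial, gaussAvg_monomial, map_mul, map_gaussMoment]

/-- The coefficientwise Gaussian average of a power series over the polynomials. -/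
def avgSeries (d : A) (f : PowerSeries A[X]) : PowerSeries A := coeffwise (gaussAvg d) f

@[simp] theorem coeff_avgSeries (d : A) (f : PowerSeries A[X]) (n : ℕ) :
    PowerSeries.coeff n (avgSeries d f) = gaussAvg d (PowerSeries.coeff n f) := by
  simp [avgSeries]

theorem avgSeries_add (d : A) (f g : PowerSeries A[X]) :
    avgSeries d (f + g) = avgSeries d f + avgSeries d g := by
  ext n; simp

theorem avgSeries_sub (d : A) (f g : PowerSeries A[X]) :
    avgSeries d (f - g) = avgSeries d f - avgSeries d g := by
  ext n; simp

theorem avgSeries_map_C_mul (d : A) (a : PowerSeries A) (f : PowerSeries A[X]) :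
    avgSeries d (PowerSeries.map (C : A →+* A[X]) a * f) = a * avgSeries d f := by
  ext n
  simp only [coeff_avgSeries, PowerSeries.coeff_mul, PowerSeries.coeff_map, map_sum,
    gaussAvg_C_mul]

theorem avgSeries_C_mul (d a : A) (f : PowerSeries A[X]) :
    avgSeries d (PowerSeries.C (C a) * f) = PowerSeries.C a * avgSeries d f := by
  rw [← avgSeries_map_C_mul, PowerSeries.map_C]

theorem derivative_avgSeries (d : A) (f : PowerSeries A[X]) :
    PowerSeries.derivative A (avgSeries d f)
      = avgSeries d (PowerSeries.derivative A[X] f) := by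
  ext n
  rw [PowerSeries.coeff_derivative, coeff_avgSeries, coeff_avgSeries, PowerSeries.coeff_derivative]
  have : ((n : A[X]) + 1) = C ((n : A) + 1) := by simp
  rw [this, mul_comm _ (C _), gaussAvg_C_mul, mul_comm]

/-- The derivation `d/dv` of the polynomials in `v`. -/
def derivV : Derivation ℚ A[X] A[X] := (Polynomial.derivative' (R := A)).restrictScalars ℚ

theorem derivV_apply (p : A[X]) : derivV p = derivative p := rfl

theorem mul_avgSeries_derivV (d : A) (f : PowerSeries A[X]) :
    PowerSeries.C d * avgSeries d (coeffwise derivV f)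
      = avgSeries d (PowerSeries.C X * f) := by
  ext n
  rw [PowerSeries.coeff_C_mul, coeff_avgSeries, coeff_avgSeries, PowerSeries.coeff_C_mul,
    coeff_coeffwise, derivV_apply, mul_gaussAvg_derivative]

/-- The translation `v ↦ v + s` of a power series in `s` over the polynomials in `v`. -/
def shiftSeries (f : PowerSeries A[X]) : PowerSeries A[X] :=
  PowerSeries.mk fun n => ∑ ab ∈ Finset.HasAntidiagonal.antidiagonal n,
    hasseDeriv ab.1 (PowerSeries.coeff ab.2 f)

theorem coeff_shiftSeries (f : PowerSeries A[X]) (n : ℕ) :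
    PowerSeries.coeff n (shiftSeries f) = ∑ ab ∈ Finset.HasAntidiagonal.antidiagonal n,
      hasseDeriv ab.1 (PowerSeries.coeff ab.2 f) := PowerSeries.coeff_mk _ _

theorem shiftSeries_add (f g : PowerSeries A[X]) :
    shiftSeries (f + g) = shiftSeries f + shiftSeries g := by
  ext1 n
  simp [coeff_shiftSeries, Finset.sum_add_distrib]

theorem shiftSeries_sub (f g : PowerSeries A[X]) :
    shiftSeries (f - g) = shiftSeries f - shiftSeries g := by
  ext1 n
  simp [coeff_shiftSeries, Finset.sum_sub_distrib]

theorem shiftSeries_mul (f g : PowerSeries A[X]) :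
    shiftSeries (f * g) = shiftSeries f * shiftSeries g := by
  ext1 n
  simp only [coeff_shiftSeries, PowerSeries.coeff_mul, map_sum, hasseDeriv_mul,
    Finset.sum_mul_sum, ← Finset.sum_product']
  rw [Finset.sum_sigma', Finset.sum_sigma']
  refine Finset.sum_nbij'
    (fun z => ⟨(z.2.2.1 + z.2.1.1, z.2.2.2 + z.2.1.2), ((z.2.2.1, z.2.1.1), (z.2.2.2, z.2.1.2))⟩)
    (fun z => ⟨(z.2.1.1 + z.2.2.1, z.2.1.2 + z.2.2.2), ((z.2.1.2, z.2.2.2), (z.2.1.1, z.2.2.1))⟩)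
    ?_ ?_ ?_ ?_ ?_
  all_goals
    rintro ⟨⟨a, b⟩, ⟨c, e⟩, ⟨i, j⟩⟩ h
    simp only [Finset.mem_sigma, Finset.mem_product, Finset.HasAntidiagonal.mem_antidiagonal] at h ⊢
  · exact ⟨by omega, trivial, trivial⟩
  · exact ⟨by omega, trivial, trivial⟩
  · obtain ⟨h1, h2, h3⟩ := h
    subst h2 h3
    rfl
  · obtain ⟨h1, h2, h3⟩ := h
    subst h2 h3
    rfl

theorem coeff_zero_shiftSeries (f : PowerSeries A[X]) :
    PowerSeries.coeff 0 (shiftSeries f) = PowerSeries.coeff 0 f := by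
  simp [coeff_shiftSeries]

theorem shiftSeries_map_C (a : PowerSeries A) :
    shiftSeries (PowerSeries.map (C : A →+* A[X]) a) = PowerSeries.map (C : A →+* A[X]) a := by
  ext1 n
  rw [coeff_shiftSeries, Finset.sum_eq_single (0, n)]
  · simp
  · rintro ⟨a, b⟩ hab hne
    have hab' : a + b = n := Finset.HasAntidiagonal.mem_antidiagonal.1 hab
    have : 0 < a := by
      rcases Nat.eq_zero_or_pos a with h | h
      · subst h; simp at hab'; subst hab'; simp at hne
      · exact h
    rw [PowerSeries.coeff_map, hasseDeriv_C _ _ this]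
  · intro h
    exact absurd (Finset.HasAntidiagonal.mem_antidiagonal.2 (by simp)) h

theorem shiftSeries_C_X :
    shiftSeries (PowerSeries.C (X : A[X])) = PowerSeries.C X + PowerSeries.X := by
  ext1 n
  rw [coeff_shiftSeries, Finset.sum_eq_single (n, 0)]
  · rcases n with _ | _ | n
    · simp
    · simp
    · rw [hasseDeriv_apply]
      simp [PowerSeries.coeff_X, PowerSeries.coeff_C, Nat.choose_eq_zero_of_lt]
  · rintro ⟨a, b⟩ hab hne
    have hab' : a + b = n := Finset.HasAntidiagonal.mem_antidiagonal.1 hab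
    have : b ≠ 0 := by
      rintro rfl
      simp at hab'; subst hab'; simp at hne
    simp [PowerSeries.coeff_C, this]
  · intro h
    exact absurd (Finset.HasAntidiagonal.mem_antidiagonal.2 (by simp)) h

theorem derivative_shiftSeries (f : PowerSeries A[X]) :
    PowerSeries.derivative A[X] (shiftSeries f)
      = shiftSeries (PowerSeries.derivative A[X] f) + shiftSeries (coeffwise derivV f) := by
  ext1 n
  rw [PowerSeries.coeff_derivative, map_add, coeff_shiftSeries, coeff_shiftSeries,
    coeff_shiftSeries]
  have key : ∀ ab ∈ Finset.HasAntidiagonal.antidiagonal (n + 1),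
      hasseDeriv ab.1 (PowerSeries.coeff ab.2 f) * ((n : A[X]) + 1)
        = (ab.2 : A[X]) * hasseDeriv ab.1 (PowerSeries.coeff ab.2 f)
          + (ab.1 : A[X]) * hasseDeriv ab.1 (PowerSeries.coeff ab.2 f) := by
    rintro ⟨a, b⟩ hab
    have hab' : a + b = n + 1 := Finset.HasAntidiagonal.mem_antidiagonal.1 hab
    have : (n : A[X]) + 1 = a + b := by rw [← Nat.cast_add, hab']; simp
    simp only [this]
    ring
  rw [Finset.sum_mul, Finset.sum_congr rfl key, Finset.sum_add_distrib]
  congr 1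
  · rw [Finset.Nat.sum_antidiagonal_succ']
    simp only [Nat.cast_zero, zero_mul, zero_add]
    refine Finset.sum_congr rfl fun ab _ => ?_
    rw [PowerSeries.coeff_derivative]
    have h2 : ((ab.2 : A[X]) + 1) = C ((ab.2 : A) + 1) := by simp
    rw [h2, mul_comm _ (C _), ← Polynomial.smul_eq_C_mul, map_smul, Polynomial.smul_eq_C_mul]
    simp
  · rw [Finset.Nat.sum_antidiagonal_succ]
    simp only [Nat.cast_zero, zero_mul, zero_add]
    refine Finset.sum_congr rfl fun ab _ => ?_
    rw [coeff_coeffwise, derivV_apply]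
    ext i
    have h1 : ((ab.1 + 1 : ℕ) : A[X]) = C ((ab.1 + 1 : ℕ) : A) := by simp
    rw [h1, coeff_C_mul, hasseDeriv_coeff, hasseDeriv_coeff, coeff_derivative]
    have h3 : ((ab.1 + 1 : ℕ) : A) * ((i + (ab.1 + 1)).choose (ab.1 + 1) : A)
        = ((i + ab.1).choose ab.1 : A) * ((i + ab.1 : ℕ) + 1) := by
      have := Nat.add_one_mul_choose_eq (i + ab.1) ab.1
      have h4 := congrArg (Nat.cast : ℕ → A) this
      push_cast at h4 ⊢
      rw [← add_assoc]
      linear_combination -h4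
    rw [← mul_assoc, h3, add_assoc]
    ring

theorem derivV_shiftSeries (f : PowerSeries A[X]) :
    coeffwise derivV (shiftSeries f) = shiftSeries (coeffwise derivV f) := by
  ext1 n
  rw [coeff_coeffwise, coeff_shiftSeries, coeff_shiftSeries, map_sum]
  refine Finset.sum_congr rfl fun ab _ => ?_
  rw [coeff_coeffwise, derivV_apply, derivV_apply, ← hasseDeriv_one, ← LinearMap.comp_apply,
    ← LinearMap.comp_apply, hasseDeriv_comp, hasseDeriv_comp, add_comm 1]
  simp [Nat.choose_one_right]

theorem shiftSeries_expSeries {g : PowerSeries A[X]} (hg : PowerSeries.constantCoeff g = 0) :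
    shiftSeries (expSeries g) = expSeries (shiftSeries g) := by
  have h0 (f : PowerSeries A[X]) : PowerSeries.constantCoeff (shiftSeries f)
      = PowerSeries.constantCoeff f := by
    rw [← PowerSeries.coeff_zero_eq_constantCoeff_apply, coeff_zero_shiftSeries,
      PowerSeries.coeff_zero_eq_constantCoeff_apply]
  apply eq_expSeries
  · rw [h0, hg]
  · rw [derivative_shiftSeries, derivative_expSeries hg, derivation_expSeries _ hg,
      shiftSeries_mul, shiftSeries_mul, ← add_mul, derivative_shiftSeries]
  · rw [h0, constantCoeff_expSeries hg]

/-- The element `1/2`. -/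
def half (A : Type*) [CommRing A] [Algebra ℚ A] : A := algebraMap ℚ A (1 / 2)

/-- The exponent of the translated Gaussian. -/
def gaussShift (δ : A) : PowerSeries A[X] :=
  PowerSeries.C (C δ) * (PowerSeries.C X * PowerSeries.X
    + PowerSeries.C (C (half A)) * PowerSeries.X ^ 2)

theorem constantCoeff_gaussShift (δ : A) : PowerSeries.constantCoeff (gaussShift δ) = 0 := by
  simp [gaussShift]

theorem half_add_half : half A + half A = 1 := by
  rw [half, ← map_add]; norm_num

theorem derivative_gaussShift (δ : A) : PowerSeries.derivative A[X] (gaussShift δ)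
    = PowerSeries.C (C δ) * (PowerSeries.C X + PowerSeries.X) := by
  have h : (PowerSeries.C (C (half A)) : PowerSeries A[X])
      + PowerSeries.C (C (half A)) = 1 := by
    rw [← map_add, ← map_add, half_add_half, map_one, map_one]
  simp only [gaussShift, Derivation.leibniz, map_add, PowerSeries.derivative_C,
    PowerSeries.derivative_X, smul_eq_mul, Derivation.leibniz_pow, nsmul_eq_mul]
  push_cast
  linear_combination PowerSeries.C (C δ) * PowerSeries.X * h

theorem derivV_gaussShift (δ : A) : coeffwise derivV (gaussShift δ)
    = PowerSeries.C (C δ) * PowerSeries.X := by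
  ext1 n
  rw [coeff_coeffwise, derivV_apply, gaussShift, PowerSeries.coeff_C_mul, PowerSeries.coeff_C_mul,
    map_add, PowerSeries.coeff_C_mul, PowerSeries.coeff_C_mul, PowerSeries.coeff_X,
    PowerSeries.coeff_X_pow]
  split_ifs <;> simp

/-- Translation invariance of the Gaussian integral: replacing v by v + s changes the weight exp(-δ
v²/2) by the factor exp(-δ (s v + s²/2)). Formally, the s-derivative of the left side for f is the
left side for ∂f/∂s, and the constant terms agree. -/
theorem avgSeries_shiftSeries {d δ : A} (hd : d * δ = 1) (f : PowerSeries A[X]) :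
    avgSeries d (shiftSeries f * expSeries (-gaussShift δ)) = avgSeries d f := by
  have hc : PowerSeries.constantCoeff (-gaussShift δ) = 0 := by
    rw [map_neg, constantCoeff_gaussShift, neg_zero]
  have hderiv (f : PowerSeries A[X]) :
      PowerSeries.derivative A (avgSeries d (shiftSeries f * expSeries (-gaussShift δ)))
        = avgSeries d (shiftSeries (PowerSeries.derivative A[X] f)
          * expSeries (-gaussShift δ)) := by
    have hn : coeffwise derivV (-gaussShift δ) = -(coeffwise derivV (gaussShift δ)) := by
      ext1 n; simp
    -- The s-derivative of the translated integrand contains, besides the translate of ∂f/∂s,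
    -- exactly a total v-derivative minus δ v times the integrand, and this has average zero.
    have hparts := mul_avgSeries_derivV d (shiftSeries f * expSeries (-gaussShift δ))
    rw [derivation_mul, derivV_shiftSeries, derivation_expSeries _ hc, hn, derivV_gaussShift]
      at hparts
    have hparts' := congrArg (fun z => PowerSeries.C δ * z) hparts
    beta_reduce at hparts'
    rw [← mul_assoc, ← map_mul, mul_comm δ d, hd, map_one, one_mul, ← avgSeries_C_mul] at hparts'
    rw [derivative_avgSeries, derivative_mul', derivative_expSeries hc, map_neg,
      derivative_gaussShift, derivative_shiftSeries, ← sub_eq_zero, ← avgSeries_sub]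
    rw [← sub_eq_zero, ← avgSeries_sub] at hparts'
    rw [← hparts']
    refine congrArg (avgSeries d) ?_
    ring
  ext n
  -- Coefficient n + 1 for f is reached from coefficient n for ∂f/∂s, so f has to vary.
  induction n generalizing f with
  | zero =>
    rw [coeff_avgSeries, coeff_avgSeries]
    congr 1
    rw [PowerSeries.coeff_zero_eq_constantCoeff_apply, map_mul, constantCoeff_expSeries hc,
      mul_one, ← PowerSeries.coeff_zero_eq_constantCoeff_apply, coeff_zero_shiftSeries,
      PowerSeries.coeff_zero_eq_constantCoeff_apply]
  | succ n ih =>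
    have h1 := congrArg (PowerSeries.coeff n) (hderiv f)
    rw [ih, PowerSeries.coeff_derivative, ← derivative_avgSeries, PowerSeries.coeff_derivative]
      at h1
    have hu : IsUnit ((n : A) + 1) := by
      have := (IsUnit.mk0 ((n : ℚ) + 1) (by positivity)).map (algebraMap ℚ A)
      simpa using this
    exact hu.mul_right_cancel h1

end GaussAvg

end FigureEight

end

noncomputable section

namespace FigureEight

set_option linter.unusedSectionVars false

open Polynomial

/-! ### The exponent of the Gaussian integral -/

section GaussExponent

variable {A B : Type*} [CommRing A] [Algebra ℚ A] [CommRing B] [Algebra ℚ B]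

/-- The exponent `gaussExponent` for arbitrary values `ℓ m` of the functions
`Li_{-m}(y) + Li_{-m}(x² y)`. -/
def gaussExp (ℓ : ℕ → A) : PowerSeries A[X] :=
  PowerSeries.mk fun m =>
    if m = 0 then 0 else
      (∑ r ∈ Finset.range (m / 2 + 2),
        C (algebraMap ℚ A (bernoulli' r / (r.factorial * (m + 2 - 2 * r).factorial : ℚ))
          * ℓ (m - r)) * X ^ (m + 2 - 2 * r))
      + if m = 1 then C (algebraMap ℚ A (1 / 2)) * X else 0

theorem constantCoeff_gaussExp (ℓ : ℕ → A) : PowerSeries.constantCoeff (gaussExp ℓ) = 0 := by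
  rw [← PowerSeries.coeff_zero_eq_constantCoeff_apply, gaussExp, PowerSeries.coeff_mk, if_pos rfl]

theorem coeff_coeff_gaussExp (ℓ : ℕ → A) {m : ℕ} (hm : m ≠ 0) (j : ℕ) :
    (PowerSeries.coeff m (gaussExp ℓ)).coeff j =
      (if Even (m + j) ∧ j ≤ m + 2 then
        algebraMap ℚ A (bernoulli' ((m + 2 - j) / 2)
          / (((m + 2 - j) / 2).factorial * j.factorial : ℚ)) * ℓ (m - (m + 2 - j) / 2) else 0)
      + if m = 1 ∧ j = 1 then half A else 0 := by
  rw [gaussExp, PowerSeries.coeff_mk, if_neg hm, coeff_add, finsetSum_coeff]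
  congr 1
  · simp only [coeff_C_mul_X_pow]
    split_ifs with h
    · obtain ⟨⟨k, hk⟩, hj⟩ := h
      have hr : (m + 2 - j) / 2 = k + 1 - j := by omega
      rw [Finset.sum_eq_single ((m + 2 - j) / 2)]
      · rw [if_pos (by omega)]
        have : m + 2 - 2 * ((m + 2 - j) / 2) = j := by omega
        rw [this]
      · intro r hr' hne
        rw [Finset.mem_range] at hr'
        rw [if_neg (by omega)]
      · intro hr'
        rw [Finset.mem_range] at hr'
        omega
    · refine Finset.sum_eq_zero fun r hr => ?_
      rw [Finset.mem_range] at hr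
      rw [if_neg]
      rintro rfl
      exact h ⟨⟨m + 1 - r, by omega⟩, by omega⟩
  · by_cases h1 : m = 1
    · by_cases h2 : j = 1
      · rw [if_pos h1, if_pos ⟨h1, h2⟩, h2, coeff_C_mul, coeff_X_one, mul_one, half]
      · rw [if_pos h1, if_neg (by tauto), coeff_C_mul, coeff_X, if_neg (by omega), mul_zero]
    · rw [if_neg h1, if_neg (by tauto), coeff_zero]

/-- The translation of `s v` by `s²`. -/
def shiftVar (A : Type*) [CommRing A] : PowerSeries A[X] :=
  PowerSeries.C X * PowerSeries.X + PowerSeries.X ^ 2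

theorem constantCoeff_shiftVar : PowerSeries.constantCoeff (shiftVar A) = 0 := by
  simp [shiftVar]

/-- The series `∑_{n ≥ 1} ℓ (n - 1) w^n / n!`. -/
def polylogExp (ℓ : ℕ → A) : PowerSeries A :=
  PowerSeries.mk fun n => if n = 0 then 0 else algebraMap ℚ A (1 / n.factorial) * ℓ (n - 1)

theorem constantCoeff_polylogExp (ℓ : ℕ → A) : PowerSeries.constantCoeff (polylogExp ℓ) = 0 := by
  rw [← PowerSeries.coeff_zero_eq_constantCoeff_apply, polylogExp, PowerSeries.coeff_mk, if_pos rfl]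

theorem coeff_shiftVar_pow (d n : ℕ) : PowerSeries.coeff n (shiftVar A ^ d)
    = if d ≤ n then X ^ (d - (n - d)) * (d.choose (n - d) : A[X]) else 0 := by
  have h : shiftVar A ^ d = (((Polynomial.X + C X) ^ d : A[X][X]) : PowerSeries A[X])
      * PowerSeries.X ^ d := by
    rw [shiftVar, Polynomial.coe_pow, ← mul_pow, Polynomial.coe_add, Polynomial.coe_X,
      Polynomial.coe_C]
    congr 1
    ring
  rw [h, PowerSeries.coeff_mul_X_pow', Polynomial.coeff_coe]
  split_ifs with hd
  · rw [coeff_X_add_C_pow]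
  · rfl

/-- Here `shiftVar` ^ d is s^d (v + s)^d, so the monomial s^n v^i arises only for d = (n + i) / 2.
-/
theorem coeff_coeff_polylogExp_subst (ℓ : ℕ → A) (n i : ℕ) :
    (PowerSeries.coeff n ((PowerSeries.map C (polylogExp ℓ)).subst (shiftVar A))).coeff i
      = if Even (n + i) ∧ i ≤ n ∧ n ≠ 0 then
          algebraMap ℚ A (1 / ((n + i) / 2).factorial) * ℓ ((n + i) / 2 - 1)
            * (((n + i) / 2).choose (n - (n + i) / 2) : A) else 0 := by
  have hs := PowerSeries.HasSubst.of_constantCoeff_zero' (constantCoeff_shiftVar (A := A))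
  rw [PowerSeries.coeff_subst' hs, finsum_eq_sum_of_support_subset (s := Finset.range (n + 1))]
  · rw [finsetSum_coeff]
    have key : ∀ d ∈ Finset.range (n + 1),
        (PowerSeries.coeff d (PowerSeries.map C (polylogExp ℓ)) •
          PowerSeries.coeff n (shiftVar A ^ d)).coeff i
        = if i = d - (n - d) then (if d = 0 then 0 else
            algebraMap ℚ A (1 / d.factorial) * ℓ (d - 1)) * (d.choose (n - d) : A) else 0 := by
      intro d hd
      rw [Finset.mem_range] at hd
      rw [coeff_shiftVar_pow, if_pos (by omega), PowerSeries.coeff_map, polylogExp,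
        PowerSeries.coeff_mk, smul_eq_mul, coeff_C_mul, ← C_eq_natCast, coeff_mul_C, coeff_X_pow]
      split_ifs <;> ring
    rw [Finset.sum_congr rfl key]
    split_ifs with h
    · obtain ⟨⟨k, hk⟩, h1, h2⟩ := h
      rw [Finset.sum_eq_single ((n + i) / 2)]
      · rw [if_pos (by omega), if_neg (by omega)]
      · intro d hd hne
        rw [Finset.mem_range] at hd
        by_cases h3 : i = d - (n - d)
        · have : d.choose (n - d) = 0 := Nat.choose_eq_zero_of_lt (by omega)
          rw [if_pos h3, this]
          simp
        · rw [if_neg h3]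
      · intro hd
        rw [Finset.mem_range] at hd
        omega
    · refine Finset.sum_eq_zero fun d hd => ?_
      rw [Finset.mem_range] at hd
      split_ifs with h3 h4
      · simp
      · have h5 : d.choose (n - d) = 0 := by
          apply Nat.choose_eq_zero_of_lt
          by_contra h6
          exact h ⟨⟨d, by omega⟩, by omega, by omega⟩
        rw [h5]; simp
      · rfl
  · intro d hd
    rw [Function.mem_support] at hd
    rw [Finset.coe_range, Set.mem_Iio]
    by_contra h
    apply hd
    rw [coeff_shiftVar_pow, if_neg (by omega), smul_zero]

theorem coeff_coeff_shiftSeries (f : PowerSeries A[X]) (n i : ℕ) :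
    (PowerSeries.coeff n (shiftSeries f)).coeff i = ∑ a ∈ Finset.range (n + 1),
      ((i + a).choose a : A) * (PowerSeries.coeff (n - a) f).coeff (i + a) := by
  rw [coeff_shiftSeries, Finset.Nat.sum_antidiagonal_eq_sum_range_succ_mk, finsetSum_coeff]
  simp only [hasseDeriv_coeff]

/-- After the reflection k = M - (a + 1) this is the identity ∑_{k < M} C(M, k) B_k(1) = M divided
by i! M!. It collapses the Taylor expansion of the translated exponent. -/
theorem sum_choose_bernoulli_div (i M : ℕ) :
    ∑ a ∈ Finset.range M, ((i + (a + 1)).choose (a + 1) : ℚ)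
      * (bernoulli' (M - (a + 1)) / ((M - (a + 1)).factorial * (i + (a + 1)).factorial : ℚ))
      = M / (i.factorial * M.factorial) := by
  have h1 : (∑ k ∈ Finset.range M, (M.choose k : ℚ) * bernoulli' k) = M := sum_bernoulli' M
  rw [← h1, ← Finset.sum_range_reflect, Finset.sum_div]
  refine Finset.sum_congr rfl fun a ha => ?_
  rw [Finset.mem_range] at ha
  have h2 : M - 1 - a + 1 = M - a := by omega
  have h3 : M - (M - a) = a := by omega
  rw [h2, h3, Nat.cast_choose ℚ (by omega : M - a ≤ i + (M - a)),
    Nat.cast_choose ℚ (by omega : a ≤ M)]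
  have h4 : i + (M - a) - (M - a) = i := by omega
  rw [h4]
  have f1 := Nat.factorial_ne_zero (i + (M - a))
  have f2 := Nat.factorial_ne_zero M
  have f3 := Nat.factorial_ne_zero i
  have f4 := Nat.factorial_ne_zero (M - a)
  have f5 := Nat.factorial_ne_zero a
  field_simp

/-- With u = s v, the translation is u ↦ u + ħ, that is e^u ↦ q e^u. The q-Pochhammer terms then
change by the elementary logarithms collected in `polylogExp`, and u²/(2ħ) + u/2 changes by u + ħ =
`shiftVar`. The term `gaussShift` compensates for the quadratic part -δ v²/2, which is left out of
the exponent because it is the Gaussian weight. -/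
theorem shiftSeries_gaussExp (ℓ : ℕ → A) :
    shiftSeries (gaussExp ℓ) = gaussExp ℓ
      + (PowerSeries.map C (polylogExp ℓ)).subst (shiftVar A) + shiftVar A
      + gaussShift (-1 - ℓ 0) := by
  have hh := half_add_half (A := A)
  ext n i
  have hlin : (PowerSeries.coeff n (shiftVar A + gaussShift (-1 - ℓ 0))).coeff i
      = (if n = 1 ∧ i = 1 then -ℓ 0 else 0)
        + (if n = 2 ∧ i = 0 then half A - half A * ℓ 0 else 0) := by
    simp only [shiftVar, gaussShift, map_add, PowerSeries.coeff_C_mul, coeff_add, coeff_C_mul,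
      PowerSeries.coeff_X, PowerSeries.coeff_X_pow]
    by_cases h1 : n = 1
    · subst h1
      by_cases h2 : i = 1
      · subst h2; simp; ring
      · have : (1 : ℕ) ≠ i := fun h => h2 h.symm
        simp [h2, coeff_X, this]
    · by_cases h2 : n = 2
      · subst h2
        by_cases h3 : i = 0
        · subst h3
          simp
          linear_combination -hh
        · simp [h3, coeff_one]
      · simp [h1, h2]
  rw [add_assoc, map_add, map_add, coeff_add, coeff_add, hlin, coeff_coeff_shiftSeries,
    coeff_coeff_polylogExp_subst, Finset.sum_range_succ']
  simp only [add_zero, Nat.choose_zero_right, Nat.cast_one, one_mul, Nat.sub_zero]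
  rw [add_comm _ ((PowerSeries.coeff n (gaussExp ℓ)).coeff i), add_assoc]
  congr 1
  -- Only for n + i ≤ 2 would the omitted terms of degree 0 in s contribute to the sum; these
  -- coefficients are compared by hand, and all others follow from the Bernoulli identity.
  by_cases hsmall : n + i ≤ 2
  · have hb : bernoulli' 1 = 1 / 2 := bernoulli'_one
    obtain rfl | ⟨rfl, rfl⟩ | ⟨rfl, rfl⟩ | ⟨rfl, rfl⟩ : n = 0 ∨ n = 1 ∧ i = 0 ∨ n = 1 ∧ i = 1
        ∨ n = 2 ∧ i = 0 := by omega
    · simp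
    · simp [constantCoeff_gaussExp]
    · simp [constantCoeff_gaussExp]
    · rw [Finset.sum_range_succ, Finset.sum_range_one, coeff_coeff_gaussExp _ (by norm_num)]
      simp [constantCoeff_gaussExp, hb]
      have h2 : algebraMap ℚ A 2⁻¹ = half A := by rw [half, one_div]
      rw [h2]
      linear_combination ℓ 0 * hh
  · rw [if_neg (by omega : ¬ (n = 1 ∧ i = 1)), if_neg (by omega : ¬ (n = 2 ∧ i = 0)), add_zero,
      add_zero]
    have key : ∀ a ∈ Finset.range n,
        ((i + (a + 1)).choose (a + 1) : A)
          * (PowerSeries.coeff (n - (a + 1)) (gaussExp ℓ)).coeff (i + (a + 1))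
        = if Even (n + i) ∧ a < (n + 2 - i) / 2 then
          algebraMap ℚ A (((i + (a + 1)).choose (a + 1) : ℚ)
            * (bernoulli' ((n + 2 - i) / 2 - (a + 1))
              / (((n + 2 - i) / 2 - (a + 1)).factorial * (i + (a + 1)).factorial : ℚ)))
            * ℓ (n - (n + 2 - i) / 2) else 0 := by
      intro a ha
      rw [Finset.mem_range] at ha
      by_cases h0 : n - (a + 1) = 0
      · rw [h0, PowerSeries.coeff_zero_eq_constantCoeff_apply, constantCoeff_gaussExp, coeff_zero,
          mul_zero, if_neg]
        rintro ⟨⟨k, hk⟩, h⟩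
        omega
      · rw [coeff_coeff_gaussExp _ h0, if_neg (by omega : ¬ (n - (a + 1) = 1 ∧ i + (a + 1) = 1)),
          add_zero]
        by_cases h1 : Even (n + i) ∧ a < (n + 2 - i) / 2
        · have h2 : Even (n - (a + 1) + (i + (a + 1))) ∧ i + (a + 1) ≤ n - (a + 1) + 2 := by
            obtain ⟨h1, h2⟩ := h1
            have : n - (a + 1) + (i + (a + 1)) = n + i := by omega
            rw [this]
            exact ⟨h1, by omega⟩
          have h3 : (n - (a + 1) + 2 - (i + (a + 1))) / 2 = (n + 2 - i) / 2 - (a + 1) := by omega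
          have h4 : n - (a + 1) - ((n + 2 - i) / 2 - (a + 1)) = n - (n + 2 - i) / 2 := by omega
          rw [if_pos h1, if_pos h2, h3, h4, map_mul, map_natCast]
          ring
        · have h2 : ¬ (Even (n - (a + 1) + (i + (a + 1))) ∧ i + (a + 1) ≤ n - (a + 1) + 2) := by
            have : n - (a + 1) + (i + (a + 1)) = n + i := by omega
            rw [this]
            rintro ⟨⟨k, hk⟩, h⟩
            exact h1 ⟨⟨k, hk⟩, by omega⟩
          rw [if_neg h1, if_neg h2, mul_zero]
    rw [Finset.sum_congr rfl key]
    by_cases he : Even (n + i)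
    · obtain ⟨k, hk⟩ := he
      have he : Even (n + i) := ⟨k, hk⟩
      simp only [he, true_and]
      rw [← Finset.sum_filter]
      have hf : (Finset.range n).filter (fun a => a < (n + 2 - i) / 2)
          = Finset.range ((n + 2 - i) / 2) := by
        ext a
        simp only [Finset.mem_filter, Finset.mem_range]
        omega
      rw [hf, ← Finset.sum_mul, ← map_sum, sum_choose_bernoulli_div]
      by_cases hi : i ≤ n
      · rw [if_pos ⟨hi, by omega⟩]
        obtain ⟨M, hM⟩ : ∃ M, (n + 2 - i) / 2 = M + 1 := ⟨(n + 2 - i) / 2 - 1, by omega⟩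
        have h1 : (n + i) / 2 - 1 = n - (M + 1) := by omega
        have h2 : n - (n + i) / 2 = M := by omega
        have h3 : (n + i) / 2 = i + M := by omega
        rw [hM, h1, h2, h3, mul_right_comm, ← map_natCast (algebraMap ℚ A), ← map_mul,
          Nat.cast_choose ℚ (by omega : M ≤ i + M)]
        congr 2
        have h4 : i + M - M = i := by omega
        rw [h4, Nat.factorial_succ]
        have f1 := Nat.factorial_ne_zero (i + M)
        have f2 := Nat.factorial_ne_zero M
        have f3 := Nat.factorial_ne_zero i
        push_cast
        field_simp
      · rw [if_neg (by tauto)]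
        have : (n + 2 - i) / 2 = 0 := by omega
        rw [this]
        simp
    · simp [he]

end GaussExponent

end FigureEight

end

noncomputable section

namespace FigureEight

set_option linter.unusedSectionVars false

open Polynomial

/-! ### The three-term recurrence -/

section Recurrence

variable {A B : Type*} [CommRing A] [Algebra ℚ A] [CommRing B] [Algebra ℚ B]

/-- The generating series `∑ P_n T^n / n!` of the polynomials `negPolylogPoly`. -/
def negPolylogGen : PowerSeries ℚ[X] :=
  PowerSeries.mk fun n => C (1 / n.factorial : ℚ) * negPolylogPoly n

theorem derivative_negPolylogGen : PowerSeries.derivative ℚ[X] negPolylogGen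
    = coeffwise (fun p => (X + X ^ 2) * derivative p) negPolylogGen := by
  ext1 n
  rw [PowerSeries.coeff_derivative, coeff_coeffwise, negPolylogGen, PowerSeries.coeff_mk,
    PowerSeries.coeff_mk, negPolylogPoly, derivative_C_mul]
  have h : (C (1 / (n + 1).factorial : ℚ) : ℚ[X]) * ((n : ℚ[X]) + 1)
      = C (1 / n.factorial : ℚ) := by
    have h1 : ((n : ℚ[X]) + 1) = C ((n : ℚ) + 1) := by simp
    rw [h1, ← C_mul, Nat.factorial_succ]
    congr 1
    have := Nat.factorial_ne_zero n
    push_cast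
    field_simp
  linear_combination ((X + X ^ 2) * derivative (negPolylogPoly n)) * h

/-- The derivation `(T + T²) d/dT`. -/
def polylogDerivation : Derivation ℚ ℚ[X] ℚ[X] := (X + X ^ 2 : ℚ[X]) • Polynomial.derivative'

theorem polylogDerivation_apply (p : ℚ[X]) :
    polylogDerivation p = (X + X ^ 2) * derivative p := rfl

/-- This is ∑ Li_{-n}(z) T^n / n! = z e^T / (1 - z e^T) in the coordinate X = z / (1 - z). The
difference Y of the two sides satisfies dY/dT = (X + X²) ∂Y/∂X - X Y and vanishes at T = 0. -/
theorem negPolylogGen_mul : (1 + PowerSeries.C X - PowerSeries.C X * PowerSeries.exp ℚ[X])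
    * negPolylogGen = PowerSeries.C X * PowerSeries.exp ℚ[X] := by
  obtain ⟨Y, hY⟩ : ∃ Y, Y = (1 + PowerSeries.C X - PowerSeries.C X * PowerSeries.exp ℚ[X])
    * negPolylogGen - PowerSeries.C X * PowerSeries.exp ℚ[X] := ⟨_, rfl⟩
  have hC (p : ℚ[X]) : coeffwise polylogDerivation (PowerSeries.C p)
      = PowerSeries.C (polylogDerivation p) := by
    ext1 n
    rw [coeff_coeffwise, PowerSeries.coeff_C, PowerSeries.coeff_C]
    split_ifs <;> simp
  have hexp : coeffwise polylogDerivation (PowerSeries.exp ℚ[X]) = 0 := by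
    ext1 n
    simp [PowerSeries.coeff_exp, 
      -map_div₀, -one_div]
  have hadd (f g : PowerSeries ℚ[X]) : coeffwise polylogDerivation (f + g)
      = coeffwise polylogDerivation f + coeffwise polylogDerivation g := by
    ext1 n; simp
  have hsub (f g : PowerSeries ℚ[X]) : coeffwise polylogDerivation (f - g)
      = coeffwise polylogDerivation f - coeffwise polylogDerivation g := by
    ext1 n; simp
  have hone : coeffwise polylogDerivation (1 : PowerSeries ℚ[X]) = 0 := by
    have := hC 1
    simpa using this
  have hgen : coeffwise polylogDerivation negPolylogGen
      = PowerSeries.derivative ℚ[X] negPolylogGen := by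
    rw [derivative_negPolylogGen]; rfl
  have hX : polylogDerivation X = X + X ^ 2 := by simp [polylogDerivation_apply]
  have hde : PowerSeries.derivative ℚ[X] Y
      = coeffwise polylogDerivation Y - PowerSeries.C X * Y := by
    rw [hY, hsub, derivation_mul, derivation_mul, hsub, hadd, hone, hC, derivation_mul, hC, hexp,
      hgen, hX, map_sub, derivative_mul', derivative_mul', map_sub, derivative_mul', map_add]
    simp only [PowerSeries.derivative_exp, PowerSeries.derivative_C, PowerSeries.derivative_one,
      map_add, map_pow]
    ring
  have hY0 : Y = 0 := by
    ext1 n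
    rw [map_zero]
    induction n with
    | zero =>
      rw [PowerSeries.coeff_zero_eq_constantCoeff_apply, hY]
      simp [negPolylogGen, negPolylogPoly]
    | succ n ih =>
      have h1 := congrArg (PowerSeries.coeff n) hde
      rw [PowerSeries.coeff_derivative, map_sub, coeff_coeffwise, PowerSeries.coeff_C_mul, ih,
        map_zero, mul_zero, sub_zero] at h1
      refine (mul_eq_zero.1 h1).resolve_right ?_
      exact_mod_cast Nat.succ_ne_zero n
  exact sub_eq_zero.1 (hY.symm.trans hY0)

/-- The values at `p = z / (1 - z)` of the polylogarithms `Li_{-m}(z)`. -/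
def polylogVal (p : A) (m : ℕ) : A := aeval p (negPolylogPoly m)

theorem map_polylogVal (f : A →+* B) (p : A) (m : ℕ) :
    f (polylogVal p m) = polylogVal (f p) m := by
  unfold polylogVal
  have : f = (f.toRatAlgHom : A →+* B) := rfl
  rw [this]
  exact (Polynomial.aeval_algHom_apply f.toRatAlgHom p _).symm

/-- For p = y / (1 - y) the right side is (1 - y e^w) / (1 - y), the exponential of Li_1(y) - Li_1(y
e^w). This makes the change of the exponent under translation rational in e^w. -/
theorem expSeries_neg_polylogExp (p : A) : expSeries (-polylogExp (polylogVal p))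
    = 1 + PowerSeries.C p - PowerSeries.C p * PowerSeries.exp A := by
  have hc : PowerSeries.constantCoeff (-polylogExp (polylogVal p)) = 0 := by
    rw [map_neg, constantCoeff_polylogExp, neg_zero]
  symm
  apply eq_expSeries hc
  · have h1 : PowerSeries.derivative A (polylogExp (polylogVal p))
        = PowerSeries.map (aeval p : ℚ[X] →ₐ[ℚ] A).toRingHom negPolylogGen := by
      ext n
      rw [PowerSeries.coeff_derivative, polylogExp, PowerSeries.coeff_mk, PowerSeries.coeff_map,
        negPolylogGen, PowerSeries.coeff_mk, if_neg (Nat.succ_ne_zero n), Nat.add_sub_cancel]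
      simp only [AlgHom.toRingHom_eq_coe, RingHom.coe_coe, map_mul, aeval_C]
      have h2 : algebraMap ℚ A (1 / (n + 1).factorial) * ((n : A) + 1)
          = algebraMap ℚ A (1 / n.factorial) := by
        have h3 : (n : A) + 1 = algebraMap ℚ A ((n : ℚ) + 1) := by simp
        rw [h3, ← map_mul, Nat.factorial_succ]
        congr 1
        have := Nat.factorial_ne_zero n
        push_cast
        field_simp
      rw [polylogVal]
      linear_combination (aeval p (negPolylogPoly n)) * h2
    have h4 := congrArg (PowerSeries.map (aeval p : ℚ[X] →ₐ[ℚ] A).toRingHom) negPolylogGen_mul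
    rw [map_mul, map_mul, map_sub, map_add, map_mul, ← h1, PowerSeries.map_exp, PowerSeries.map_C,
      map_one] at h4
    simp only [AlgHom.toRingHom_eq_coe, RingHom.coe_coe, aeval_X] at h4
    rw [map_neg, map_sub, map_add, derivative_mul']
    simp only [PowerSeries.derivative_exp, PowerSeries.derivative_C, PowerSeries.derivative_one]
    linear_combination h4
  · simp

theorem polylogExp_add (ℓ ℓ' : ℕ → A) :
    polylogExp (fun m => ℓ m + ℓ' m) = polylogExp ℓ + polylogExp ℓ' := by
  ext n
  simp only [polylogExp, PowerSeries.coeff_mk, map_add]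
  split_ifs <;> ring

/-- The values of `Li_{-m}(y₁) + Li_{-m}(y₂)`, in terms of `pᵢ = yᵢ / (1 - yᵢ)`. -/
def polylogPair (p q : A) (m : ℕ) : A := polylogVal p m + polylogVal q m

theorem polylogPair_zero (p q : A) : polylogPair p q 0 = p + q := by
  simp [polylogPair, polylogVal, negPolylogPoly]

/-- The exponent of the Gaussian integral with the additional linear term `κ s v`. -/
def gaussExpLin (ℓ : ℕ → A) (κ : A) : PowerSeries A[X] :=
  gaussExp ℓ + PowerSeries.C (C κ) * (PowerSeries.C X * PowerSeries.X)

theorem constantCoeff_gaussExpLin (ℓ : ℕ → A) (κ : A) :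
    PowerSeries.constantCoeff (gaussExpLin ℓ κ) = 0 := by
  simp [gaussExpLin, constantCoeff_gaussExp]

theorem shiftSeries_C_C (a : A) : shiftSeries (PowerSeries.C (C a)) = PowerSeries.C (C a) := by
  have := shiftSeries_map_C (PowerSeries.C a)
  rwa [PowerSeries.map_C] at this

theorem shiftSeries_X : shiftSeries (PowerSeries.X : PowerSeries A[X]) = PowerSeries.X := by
  have := shiftSeries_map_C (PowerSeries.X : PowerSeries A)
  rwa [PowerSeries.map_X] at this

theorem shiftSeries_gaussExpLin (ℓ : ℕ → A) (κ : A) :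
    shiftSeries (gaussExpLin ℓ κ) = gaussExpLin ℓ κ
      + (PowerSeries.map C (polylogExp ℓ)).subst (shiftVar A) + shiftVar A
      + gaussShift (-1 - ℓ 0) + PowerSeries.C (C κ) * PowerSeries.X ^ 2 := by
  rw [gaussExpLin, shiftSeries_add, shiftSeries_gaussExp, shiftSeries_mul, shiftSeries_mul,
    shiftSeries_C_C, shiftSeries_X, shiftSeries_C_X]
  ring

/-- The Gaussian average of `exp (gaussExpLin ℓ κ)`, as a power series in `s`. -/
def gaussInt (ℓ : ℕ → A) (d κ : A) : PowerSeries A :=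
  avgSeries d (expSeries (gaussExpLin ℓ κ))

/-- The letters stand for the integrands E at κ - 1, κ, κ + 1, the factors h = e^(κ ħ) at the same
places, L = e^Λ and w = e^(s v + s²). -/
theorem recurrence_algebra {R : Type*} [CommRing R] (E₀ E E₁ h₀ h h₁ L w p q : R)
    (hL : L * ((1 + p - p * w) * (1 + q - q * w)) = 1) (e₀ : E * h = E₀ * h₀ * w)
    (e₁ : E₁ * h₁ = E * h * w) :
    (1 + p) * (1 + q) * (E₀ * (L * (w * h₀))) - (p + q + 2 * p * q) * (E * (L * (w * h)))
      + p * q * (E₁ * (L * (w * h₁))) = h * E := by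
  linear_combination (h * E) * hL - (1 + p) * (1 + q) * L * e₀ + p * q * L * w * e₁

/-- Put W = e^(s v + s²). Translation multiplies the integrand, relative to the Gaussian weight, by
W e^(κ ħ) / ((1 + p - p W)(1 + q - q W)), and passing from κ to κ + 1 multiplies the translated
integrand by W. Expanding the denominator in powers of W gives the three coefficients, and their
combination restores the untranslated integrand. -/
theorem gaussInt_recurrence_aux {d p q : A} (hd : d * (-1 - p - q) = 1) (κ : A) :
    PowerSeries.C ((1 + p) * (1 + q)) * gaussInt (polylogPair p q) d (κ - 1)
      - PowerSeries.C (p + q + 2 * p * q) * gaussInt (polylogPair p q) d κ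
      + PowerSeries.C (p * q) * gaussInt (polylogPair p q) d (κ + 1)
      = expSeries (PowerSeries.C κ * PowerSeries.X ^ 2) * gaussInt (polylogPair p q) d κ := by
  set ℓ := polylogPair p q with hℓ
  have hδ : -1 - ℓ 0 = -1 - p - q := by rw [hℓ, polylogPair_zero]; ring
  have hw0 := constantCoeff_shiftVar (A := A)
  have hws := PowerSeries.HasSubst.of_constantCoeff_zero' hw0
  obtain ⟨w, hw⟩ : ∃ w, w = shiftVar A := ⟨_, rfl⟩
  rw [← hw] at hw0 hws
  obtain ⟨Λ, hΛ⟩ : ∃ Λ : PowerSeries A[X], Λ = (PowerSeries.map C (polylogExp ℓ)).subst w := ⟨_, rfl⟩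
  have hmapc (ℓ : ℕ → A) : PowerSeries.constantCoeff
      (PowerSeries.map (C : A →+* A[X]) (polylogExp ℓ)) = 0 := by
    rw [constantCoeff_map', constantCoeff_polylogExp, map_zero]
  have hsubc {f : PowerSeries A[X]} (hf : PowerSeries.constantCoeff f = 0) :
      PowerSeries.constantCoeff (f.subst w) = 0 :=
    PowerSeries.constantCoeff_subst_eq_zero hw0 f hf
  have hΛ0 : PowerSeries.constantCoeff Λ = 0 := by rw [hΛ]; exact hsubc (hmapc ℓ)
  have hsq (a : A) : PowerSeries.constantCoeff
      (PowerSeries.C (C a) * PowerSeries.X ^ 2 : PowerSeries A[X]) = 0 := by simp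
  have hg (κ : A) := constantCoeff_gaussExpLin ℓ κ
  -- the exponential of `-Λ`
  have hone (p : A) : expSeries (-(PowerSeries.map C (polylogExp (polylogVal p))).subst w)
      = 1 + PowerSeries.C (C p) - PowerSeries.C (C p) * expSeries w := by
    have h1 := congrArg (PowerSeries.map (C : A →+* A[X])) (expSeries_neg_polylogExp p)
    rw [map_expSeries _ (by rw [map_neg, constantCoeff_polylogExp, neg_zero]), map_neg, map_sub,
      map_add, map_mul, map_one, PowerSeries.map_C, PowerSeries.map_exp] at h1
    have h2 := congrArg (PowerSeries.subst w) h1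
    rw [expSeries_subst (by rw [map_neg, hmapc, neg_zero]) hw0] at h2
    rw [← PowerSeries.coe_substAlgHom hws] at h2 ⊢
    rw [map_neg] at h2
    rw [h2, map_sub, map_add, map_mul, map_one, PowerSeries.coe_substAlgHom hws, expSeries]
    simp only [PowerSeries.subst_C]
    rfl
  have hneg : expSeries (-Λ)
      = (1 + PowerSeries.C (C p) - PowerSeries.C (C p) * expSeries w)
        * (1 + PowerSeries.C (C q) - PowerSeries.C (C q) * expSeries w) := by
    rw [← hone p, ← hone q, ← expSeries_add (by rw [map_neg, hsubc (hmapc _), neg_zero])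
      (by rw [map_neg, hsubc (hmapc _), neg_zero])]
    refine congrArg expSeries ?_
    have : (ℓ : ℕ → A) = fun m => polylogVal p m + polylogVal q m := rfl
    rw [hΛ, this, polylogExp_add, map_add, PowerSeries.subst_add hws]
    ring
  have hΛΛ := expSeries_mul_neg hΛ0
  have hshift (κ : A) : shiftSeries (expSeries (gaussExpLin ℓ κ)) * expSeries (-gaussShift (-1 - p - q))
      = expSeries (gaussExpLin ℓ κ) * expSeries Λ * expSeries w
        * expSeries (PowerSeries.C (C κ) * PowerSeries.X ^ 2) := by
    rw [shiftSeries_expSeries (hg κ), shiftSeries_gaussExpLin, hδ, ← hw, ← hΛ]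
    have h0 := constantCoeff_gaussShift (-1 - p - q)
    rw [expSeries_add (by simp [hg, hΛ0, hw0, h0]) (hsq κ),
      expSeries_add (by simp [hg, hΛ0, hw0]) h0, expSeries_add (by simp [hg, hΛ0]) hw0,
      expSeries_add (hg κ) hΛ0]
    linear_combination (expSeries (gaussExpLin ℓ κ) * expSeries Λ * expSeries w
        * expSeries (PowerSeries.C (C κ) * PowerSeries.X ^ 2)) * expSeries_mul_neg h0
  have hstep (κ : A) : expSeries (gaussExpLin ℓ (κ + 1))
      * expSeries (PowerSeries.C (C (κ + 1)) * PowerSeries.X ^ 2)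
      = expSeries (gaussExpLin ℓ κ) * expSeries (PowerSeries.C (C κ) * PowerSeries.X ^ 2)
        * expSeries w := by
    rw [← expSeries_add (hg _) (hsq _), ← expSeries_add (hg _) (hsq _),
      ← expSeries_add (by rw [map_add, hg, hsq, add_zero]) hw0]
    refine congrArg expSeries ?_
    rw [hw, shiftVar, gaussExpLin, gaussExpLin, map_add, map_add, map_one, map_one]
    ring
  have hstep' := hstep (κ - 1)
  rw [sub_add_cancel] at hstep'
  have hR : expSeries (PowerSeries.C κ * PowerSeries.X ^ 2) * gaussInt ℓ d κ
      = avgSeries d (expSeries (PowerSeries.C (C κ) * PowerSeries.X ^ 2)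
        * expSeries (gaussExpLin ℓ κ)) := by
    rw [gaussInt, ← avgSeries_map_C_mul, map_expSeries _ (by simp)]
    simp
  rw [hR]
  simp only [gaussInt, ← avgSeries_C_mul]
  -- Only the left side is translated; after that the two integrands coincide.
  rw [← avgSeries_sub, ← avgSeries_add, ← avgSeries_shiftSeries hd]
  refine congrArg (avgSeries d) ?_
  rw [hneg] at hΛΛ
  have ha : PowerSeries.C (C ((1 + p) * (1 + q)))
      = (1 + PowerSeries.C (C p)) * (1 + PowerSeries.C (C q)) := by
    simp only [map_add, map_mul, map_one]
  have hb : PowerSeries.C (C (p + q + 2 * p * q)) = PowerSeries.C (C p) + PowerSeries.C (C q)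
      + 2 * PowerSeries.C (C p) * PowerSeries.C (C q) := by
    simp only [map_add, map_mul, map_ofNat]
  have hc : PowerSeries.C (C (p * q)) = PowerSeries.C (C p) * PowerSeries.C (C q) := by
    simp only [map_mul]
  rw [← recurrence_algebra _ _ _ _ _ _ _ _ _ _ hΛΛ hstep' (hstep κ), ← ha, ← hb, ← hc,
    shiftSeries_add, shiftSeries_sub, shiftSeries_mul, shiftSeries_mul, shiftSeries_mul,
    shiftSeries_C_C, shiftSeries_C_C, shiftSeries_C_C, add_mul, sub_mul]
  simp only [mul_assoc, hshift]

end Recurrence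

end FigureEight

end

noncomputable section

namespace FigureEight

set_option linter.unusedSectionVars false

open Polynomial

/-! ### Even parts and differential equations -/

section EvenPart

variable {A B : Type*} [CommRing A] [Algebra ℚ A] [CommRing B] [Algebra ℚ B]

/-- The series `g` with `g(s²)` the even part of `f(s)`. -/
def evenPart (f : PowerSeries A) : PowerSeries A :=
  PowerSeries.mk fun N => PowerSeries.coeff (2 * N) f

theorem coeff_evenPart (f : PowerSeries A) (N : ℕ) :
    PowerSeries.coeff N (evenPart f) = PowerSeries.coeff (2 * N) f := PowerSeries.coeff_mk _ _

theorem evenPart_add (f g : PowerSeries A) : evenPart (f + g) = evenPart f + evenPart g := by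
  ext; simp [coeff_evenPart]

theorem evenPart_sub (f g : PowerSeries A) : evenPart (f - g) = evenPart f - evenPart g := by
  ext; simp [coeff_evenPart]

theorem evenPart_C_mul (a : A) (f : PowerSeries A) :
    evenPart (PowerSeries.C a * f) = PowerSeries.C a * evenPart f := by
  ext; simp [coeff_evenPart]

theorem evenPart_X_sq_mul (f : PowerSeries A) :
    evenPart (PowerSeries.X ^ 2 * f) = PowerSeries.X * evenPart f := by
  ext N
  rcases N with _ | N
  · simp [coeff_evenPart, pow_two, mul_assoc]
  · rw [coeff_evenPart, PowerSeries.coeff_succ_X_mul, coeff_evenPart,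
      show 2 * (N + 1) = 2 * N + 2 by ring, PowerSeries.coeff_X_pow_mul]

theorem evenPart_mul {f : PowerSeries A} (hf : ∀ n, ¬ Even n → PowerSeries.coeff n f = 0)
    (g : PowerSeries A) : evenPart (f * g) = evenPart f * evenPart g := by
  ext N
  rw [coeff_evenPart, PowerSeries.coeff_mul, PowerSeries.coeff_mul]
  symm
  refine Finset.sum_of_injOn (fun ab => (2 * ab.1, 2 * ab.2)) ?_ ?_ ?_ ?_
  · rintro ⟨a, b⟩ _ ⟨c, d⟩ _ h
    simp only [Prod.mk.injEq] at h ⊢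
    omega
  · rintro ⟨a, b⟩ h
    have := Finset.HasAntidiagonal.mem_antidiagonal.1 h
    refine Finset.HasAntidiagonal.mem_antidiagonal.2 ?_
    simp only at this ⊢
    omega
  · rintro ⟨a, b⟩ h hn
    have := Finset.HasAntidiagonal.mem_antidiagonal.1 h
    simp only at this
    by_cases ha : Even a
    · obtain ⟨c, rfl⟩ := ha
      refine absurd ⟨(c, N - c), ?_, ?_⟩ hn
      · refine Finset.HasAntidiagonal.mem_antidiagonal.2 ?_
        simp only
        omega
      · simp only [Prod.mk.injEq]
        omega
    · rw [hf _ ha, zero_mul]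
  · rintro ⟨a, b⟩ _
    simp [coeff_evenPart]

theorem evenPart_expSeries_mul (κ : A) (g : PowerSeries A) :
    evenPart (expSeries (PowerSeries.C κ * PowerSeries.X ^ 2) * g)
      = expSeries (PowerSeries.C κ * PowerSeries.X) * evenPart g := by
  have hc : PowerSeries.constantCoeff (PowerSeries.C κ * PowerSeries.X ^ 2 : PowerSeries A) = 0 := by
    simp
  obtain ⟨f, hf⟩ : ∃ f, f = expSeries (PowerSeries.C κ * PowerSeries.X ^ 2) := ⟨_, rfl⟩
  have hd : PowerSeries.derivative A f = PowerSeries.C (2 * κ) * (PowerSeries.X * f) := by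
    rw [hf, derivative_expSeries hc, derivative_mul', PowerSeries.derivative_C,
      PowerSeries.derivative_pow, PowerSeries.derivative_X, map_mul, map_ofNat]
    push_cast
    ring
  have hodd : ∀ n, PowerSeries.coeff (2 * n + 1) f = 0 := by
    intro n
    have hne (k : ℕ) {z : A} (h : z * ((k : A) + 1) = 0) : z = 0 := by
      have hu : IsUnit ((k : A) + 1) := by
        have : ((k : A) + 1) = algebraMap ℚ A ((k : ℚ) + 1) := by simp
        rw [this]
        exact (IsUnit.mk0 _ (by positivity)).map _
      exact (hu.mul_left_eq_zero).1 h
    induction n with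
    | zero =>
      have := congrArg (PowerSeries.coeff 0) hd
      rw [PowerSeries.coeff_derivative, PowerSeries.coeff_C_mul, PowerSeries.coeff_zero_X_mul,
        mul_zero] at this
      exact hne _ this
    | succ n ih =>
      have := congrArg (PowerSeries.coeff (2 * n + 2)) hd
      rw [PowerSeries.coeff_derivative, PowerSeries.coeff_C_mul, PowerSeries.coeff_succ_X_mul,
        ih, mul_zero] at this
      exact hne _ this
  rw [← hf, evenPart_mul fun n hn => by
    obtain ⟨k, rfl⟩ := Nat.not_even_iff_odd.1 hn
    exact hodd k]
  refine congrArg (· * evenPart g) ?_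
  refine eq_expSeries (by simp) ?_ ?_
  · ext n
    have := congrArg (PowerSeries.coeff (2 * n + 1)) hd
    rw [PowerSeries.coeff_derivative, PowerSeries.coeff_C_mul, PowerSeries.coeff_succ_X_mul] at this
    rw [PowerSeries.coeff_derivative, coeff_evenPart, derivative_mul', PowerSeries.derivative_C,
      PowerSeries.derivative_X, zero_mul, zero_add, mul_one, PowerSeries.coeff_C_mul,
      coeff_evenPart]
    rw [show 2 * (n + 1) = 2 * n + 1 + 1 by ring]
    have h2 : half A * 2 = 1 := by rw [mul_two, half_add_half]
    push_cast at this
    linear_combination half A * this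
      + (κ * PowerSeries.coeff (2 * n) f
        - PowerSeries.coeff (2 * n + 1 + 1) f * ((n : A) + 1)) * h2
  · rw [← PowerSeries.coeff_zero_eq_constantCoeff_apply, coeff_evenPart, mul_zero,
      PowerSeries.coeff_zero_eq_constantCoeff_apply, hf, constantCoeff_expSeries hc]

theorem map_evenPart (f : A →+* B) (g : PowerSeries A) :
    PowerSeries.map f (evenPart g) = evenPart (PowerSeries.map f g) := by
  ext; simp [coeff_evenPart]

theorem map_gaussExpLin (f : A →+* B) (ℓ : ℕ → A) (κ : A) :
    PowerSeries.map (mapRingHom f) (gaussExpLin ℓ κ) = gaussExpLin (fun m => f (ℓ m)) (f κ) := by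
  have hq (r : ℚ) : f (algebraMap ℚ A r) = algebraMap ℚ B r := by simp
  rw [gaussExpLin, gaussExpLin, map_add, map_mul, map_mul, PowerSeries.map_C, PowerSeries.map_C,
    PowerSeries.map_X, coe_mapRingHom, map_C, map_X]
  refine congrArg (· + _) ?_
  ext1 m
  rw [PowerSeries.coeff_map, gaussExp, gaussExp, PowerSeries.coeff_mk, PowerSeries.coeff_mk]
  split_ifs with h1 h2 <;>
  simp only [coe_mapRingHom, Polynomial.map_zero, Polynomial.map_sum,
    Polynomial.map_mul, Polynomial.map_pow, map_X, map_C, map_mul, map_add, hq]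

theorem map_gaussInt (f : A →+* B) (ℓ : ℕ → A) (d κ : A) :
    PowerSeries.map f (gaussInt ℓ d κ) = gaussInt (fun m => f (ℓ m)) (f d) (f κ) := by
  rw [gaussInt, gaussInt, ← map_gaussExpLin, ← map_expSeries _ (constantCoeff_gaussExpLin ℓ κ)]
  ext n
  rw [PowerSeries.coeff_map, coeff_avgSeries, coeff_avgSeries, map_gaussAvg, PowerSeries.coeff_map]
  rfl

/-- The Gaussian average of `exp (gaussExpLin ℓ κ)`, as a power series in `ħ = s²`, where
`ℓ m = Li_{-m}(y₁) + Li_{-m}(y₂)`, `p = y₁ / (1 - y₁)`, `q = y₂ / (1 - y₂)`. -/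
def gaussF (p q d κ : A) : PowerSeries A := evenPart (gaussInt (polylogPair p q) d κ)

theorem map_gaussF (f : A →+* B) (p q d κ : A) :
    PowerSeries.map f (gaussF p q d κ) = gaussF (f p) (f q) (f d) (f κ) := by
  rw [gaussF, gaussF, map_evenPart, map_gaussInt]
  have : (fun m => f (polylogPair p q m)) = polylogPair (f p) (f q) := by
    ext m
    simp [polylogPair, map_polylogVal]
  rw [this]

theorem gaussF_recurrence {d p q : A} (hd : d * (-1 - p - q) = 1) (κ : A) :
    PowerSeries.C ((1 + p) * (1 + q)) * gaussF p q d (κ - 1)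
      - PowerSeries.C (p + q + 2 * p * q) * gaussF p q d κ
      + PowerSeries.C (p * q) * gaussF p q d (κ + 1)
      = expSeries (PowerSeries.C κ * PowerSeries.X) * gaussF p q d κ := by
  have := congrArg evenPart (gaussInt_recurrence_aux hd κ)
  rwa [evenPart_expSeries_mul, evenPart_add, evenPart_sub, evenPart_C_mul, evenPart_C_mul,
    evenPart_C_mul] at this

/-- The coefficientwise extension of a derivation to polynomials. -/
def coeffDerivation (D : Derivation ℚ A A) : Derivation ℚ A[X] A[X] :=
  PolynomialModule.equivPolynomialSelf.compDer D.mapCoeffs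

theorem coeff_coeffDerivation (D : Derivation ℚ A A) (p : A[X]) (i : ℕ) :
    (coeffDerivation D p).coeff i = D (p.coeff i) := rfl

theorem coeffDerivation_monomial (D : Derivation ℚ A A) (n : ℕ) (a : A) :
    coeffDerivation D (monomial n a) = monomial n (D a) := by
  ext i
  rw [coeff_coeffDerivation, coeff_monomial, coeff_monomial]
  split_ifs <;> simp

/-- Differentiating the normalised weight exp(-δ v²/2) with respect to δ brings down -(v² - d)/2. -/
theorem derivation_gaussMoment (D : Derivation ℚ A A) {d δ : A} (hd : d * δ = 1) (n : ℕ) :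
    D (gaussMoment d n) = - half A * D δ * (gaussMoment d (n + 2) - d * gaussMoment d n) := by
  have h2 : half A * 2 = 1 := by rw [mul_two, half_add_half]
  have hDd : D d = - d ^ 2 * D δ := by
    have h1 := congrArg D hd
    rw [Derivation.leibniz, Derivation.map_one_eq_zero, smul_eq_mul, smul_eq_mul] at h1
    linear_combination d * h1 - D d * hd
  induction n using Nat.twoStepInduction with
  | zero =>
    have : gaussMoment d 0 = 1 := by simp [gaussMoment]
    rw [gaussMoment_succ, this]
    simp
  | one =>
    have : gaussMoment d 1 = 0 := by simp [gaussMoment]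
    rw [gaussMoment_succ d 2, this]
    simp
  | more n ih _ =>
    have h1 (k : ℕ) : gaussMoment d (k + 2) = d * ((k + 1) * gaussMoment d k) := by
      rw [gaussMoment_succ]; push_cast; simp
    have h3 (k : ℕ) : D ((k : A) + 1) = 0 := by simp
    rw [h1 (n + 2), h1 n, Derivation.leibniz, Derivation.leibniz, h3, ih, hDd, h1 n]
    simp only [smul_eq_mul]
    push_cast
    linear_combination (d ^ 2 * D δ * ((n + 1) * gaussMoment d n)) * h2

theorem derivation_gaussAvg (D : Derivation ℚ A A) {d δ : A} (hd : d * δ = 1) (p : A[X]) :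
    D (gaussAvg d p) = gaussAvg d (coeffDerivation D p)
      - half A * D δ * (gaussAvg d (X ^ 2 * p) - d * gaussAvg d p) := by
  induction p using Polynomial.induction_on' with
  | add p q hp hq => rw [map_add, map_add, map_add, map_add, hp, hq, mul_add, map_add]; ring
  | monomial n a =>
    rw [X_pow_mul_monomial, coeffDerivation_monomial, gaussAvg_monomial, gaussAvg_monomial,
      gaussAvg_monomial, Derivation.leibniz, derivation_gaussMoment D hd, smul_eq_mul, smul_eq_mul]
    ring

theorem derivation_avgSeries (D : Derivation ℚ A A) {d δ : A} (hd : d * δ = 1)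
    (f : PowerSeries A[X]) :
    coeffwise D (avgSeries d f) = avgSeries d (coeffwise (coeffDerivation D) f)
      - PowerSeries.C (half A * D δ) * (avgSeries d (PowerSeries.C (X ^ 2) * f)
        - PowerSeries.C d * avgSeries d f) := by
  ext n
  rw [coeff_coeffwise, coeff_avgSeries, derivation_gaussAvg D hd, map_sub, coeff_avgSeries,
    coeff_coeffwise, PowerSeries.coeff_C_mul, map_sub, coeff_avgSeries, PowerSeries.coeff_C_mul,
    PowerSeries.coeff_C_mul, coeff_avgSeries]

/-- The Gaussian average of `v s exp (gaussExpLin ℓ κ)`. -/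
def gaussInt' (ℓ : ℕ → A) (d κ : A) : PowerSeries A :=
  avgSeries d (PowerSeries.C X * PowerSeries.X * expSeries (gaussExpLin ℓ κ))

theorem coeff_coeff_gaussExpLin (ℓ : ℕ → A) (κ : A) (m j : ℕ) :
    (PowerSeries.coeff m (gaussExpLin ℓ κ)).coeff j
      = (PowerSeries.coeff m (gaussExp ℓ)).coeff j + if m = 1 ∧ j = 1 then κ else 0 := by
  rw [gaussExpLin, map_add, coeff_add, ← mul_assoc, ← map_mul]
  refine congrArg (_ + ·) ?_
  rcases m with _ | _ | m
  · simp
  · rw [PowerSeries.coeff_succ_mul_X, PowerSeries.coeff_C, if_pos rfl, coeff_C_mul, coeff_X]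
    rcases eq_or_ne j 1 with rfl | hj
    · simp
    · rw [if_neg (Ne.symm hj), if_neg (by tauto), mul_zero]
  · rw [PowerSeries.coeff_succ_mul_X, PowerSeries.coeff_C, if_neg (by omega), if_neg (by omega),
      coeff_zero]

theorem coeffDerivation_gaussExpLin_of_const (D : Derivation ℚ A A) (ℓ : ℕ → A) (κ : A)
    (hℓ : ∀ m, D (ℓ m) = 0) : coeffwise (coeffDerivation D) (gaussExpLin ℓ κ)
      = PowerSeries.C (C (D κ)) * (PowerSeries.C X * PowerSeries.X) := by
  ext n i
  have h := coeff_coeff_gaussExpLin (0 : ℕ → A) (D κ) n i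
  have h0 : gaussExp (0 : ℕ → A) = gaussExpLin 0 0 := by simp [gaussExpLin]
  rw [coeff_coeffwise, coeff_coeffDerivation, coeff_coeff_gaussExpLin, map_add]
  rw [gaussExpLin, map_add, coeff_add, add_right_inj] at h
  rw [h]
  have h1 : D ((PowerSeries.coeff n (gaussExp ℓ)).coeff i) = 0 := by
    rcases eq_or_ne n 0 with rfl | hn
    · rw [PowerSeries.coeff_zero_eq_constantCoeff_apply, constantCoeff_gaussExp, coeff_zero,
        map_zero]
    · rw [coeff_coeff_gaussExp ℓ hn, map_add]
      have hhalf : D (half A) = 0 := D.map_algebraMap _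
      split_ifs <;> simp [hhalf, hℓ]
  rw [h1, zero_add]
  split_ifs <;> simp

/-- The full exponent depends on log y and v mainly through log y + s v, so ∂/∂v is s times the
derivation raising the index of ℓ. The two extra terms account for the omitted quadratic part and
for the linear terms, which do not come from polylogarithms. -/
theorem derivV_gaussExpLin (D : Derivation ℚ A A) (ℓ : ℕ → A) (κ : A)
    (hℓ : ∀ m, D (ℓ m) = ℓ (m + 1)) (hκ : D κ = 0) : coeffwise derivV (gaussExpLin ℓ κ)
      = PowerSeries.X * (coeffwise (coeffDerivation D) (gaussExpLin ℓ κ)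
        + PowerSeries.C (C (half A * ℓ 1)) * PowerSeries.C (X ^ 2)
        + PowerSeries.C (C (half A * (ℓ 0 + 1) + κ))) := by
  have hhalf : D (half A) = 0 := D.map_algebraMap _
  have hDc (r : ℚ) (a : A) : D (algebraMap ℚ A r * a) = algebraMap ℚ A r * D a := by
    rw [Derivation.leibniz, D.map_algebraMap, smul_zero, add_zero, smul_eq_mul]
  ext n i
  rw [coeff_coeffwise, derivV_apply, coeff_derivative, coeff_coeff_gaussExpLin]
  rcases n with _ | _ | n
  · simp [constantCoeff_gaussExp]
  · rw [PowerSeries.coeff_succ_X_mul, coeff_coeff_gaussExp ℓ (by norm_num)]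
    simp only [map_add, coeff_add, coeff_coeffwise, coeff_coeffDerivation,
      PowerSeries.coeff_zero_eq_constantCoeff_apply, constantCoeff_gaussExpLin,
      coeff_zero, ← map_mul, PowerSeries.constantCoeff_C]
    rw [coeff_C_mul, coeff_X_pow, coeff_C]
    have h3 : ¬ Even 3 := by decide
    have h4 : Even 4 := by decide
    rcases i with _ | _ | _ | i
    · simp [bernoulli'_one]
      rw [half]
      simp
      ring
    · simp [h3]
    · simp [half, Nat.factorial, h4]
      have h6 : (algebraMap ℚ A) 6⁻¹ * 3 = algebraMap ℚ A 2⁻¹ := by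
        rw [← map_ofNat (algebraMap ℚ A) 3, ← map_mul]
        norm_num
      linear_combination ℓ 1 * h6
    · simp
  · rw [PowerSeries.coeff_succ_X_mul, coeff_coeff_gaussExp ℓ (by omega)]
    simp only [map_add, coeff_add, coeff_coeffwise, coeff_coeffDerivation,
      coeff_coeff_gaussExpLin, ← map_mul, PowerSeries.coeff_C, if_neg (Nat.succ_ne_zero n)]
    rw [coeff_coeff_gaussExp ℓ (by omega), map_add]
    rw [show n + 1 + 1 + 2 - (i + 1) = n + 1 + 2 - i by omega]
    have hif (a : A) : D (if n + 1 = 1 ∧ i = 1 then a else 0)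
      = if n + 1 = 1 ∧ i = 1 then D a else 0 := by split_ifs <;> simp
    rw [hif, hif, hκ, hhalf]
    simp only [if_neg (show ¬ (n + 1 + 1 = 1 ∧ i + 1 = 1) by omega), ite_self, add_zero,
      coeff_zero]
    by_cases h : Even (n + 1 + i) ∧ i ≤ n + 1 + 2
    · have hev : Even (n + 1 + 1 + (i + 1)) := by
        rw [show n + 1 + 1 + (i + 1) = n + 1 + i + 2 by ring]
        exact h.1.add even_two
      rw [if_pos h, if_pos ⟨hev, by omega⟩, hDc, hℓ]
      obtain ⟨⟨k, hk⟩, hi⟩ := h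
      rw [show n + 1 - (n + 1 + 2 - i) / 2 + 1 = n + 1 + 1 - (n + 1 + 2 - i) / 2 by omega]
      rw [Nat.factorial_succ]
      have : ((i : A) + 1) = algebraMap ℚ A ((i : ℚ) + 1) := by simp
      rw [this, mul_right_comm, ← map_mul]
      refine congrArg (algebraMap ℚ A · * _) ?_
      have h1 := Nat.factorial_ne_zero i
      have h2 := Nat.factorial_ne_zero ((n + 1 + 2 - i) / 2)
      push_cast
      field_simp
    · rw [if_neg h, if_neg, zero_mul, map_zero]
      rintro ⟨⟨k, hk⟩, hi⟩
      exact h ⟨⟨k - 1, by omega⟩, by omega⟩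

theorem gaussInt_derivation_of_const (D : Derivation ℚ A A) {ℓ : ℕ → A} {d δ : A} (κ : A)
    (hd : d * δ = 1) (hℓ : ∀ m, D (ℓ m) = 0) (hδ : D δ = 0) :
    coeffwise D (gaussInt ℓ d κ) = PowerSeries.C (D κ) * gaussInt' ℓ d κ := by
  rw [gaussInt, derivation_avgSeries D hd, hδ, mul_zero, map_zero, zero_mul, sub_zero,
    derivation_expSeries _ (constantCoeff_gaussExpLin ℓ κ),
    coeffDerivation_gaussExpLin_of_const D ℓ κ hℓ, mul_assoc, avgSeries_C_mul, gaussInt']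

/-- Moving the base point log y is traded for ∂/∂v and integrated by parts. The result involves only
`gaussInt` and `gaussInt'`, and by `gaussInt_derivation_of_const` the latter is the derivative in κ.
-/
theorem gaussInt_derivation (D : Derivation ℚ A A) {ℓ : ℕ → A} {d κ : A}
    (hd : d * (-1 - ℓ 0) = 1) (hℓ : ∀ m, D (ℓ m) = ℓ (m + 1)) (hκ : D κ = 0) :
    PowerSeries.X ^ 2 * coeffwise D (gaussInt ℓ d κ)
      = PowerSeries.X ^ 2 * (PowerSeries.C (half A * (-1 - ℓ 0) - κ - half A * d * ℓ 1)
        * gaussInt ℓ d κ) + PowerSeries.C (-1 - ℓ 0) * gaussInt' ℓ d κ := by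
  obtain ⟨E, hE⟩ : ∃ E, E = expSeries (gaussExpLin ℓ κ) := ⟨_, rfl⟩
  have hXm (f : PowerSeries A[X]) :
      avgSeries d (PowerSeries.X * f) = PowerSeries.X * avgSeries d f := by
    rw [← avgSeries_map_C_mul, PowerSeries.map_X]
  have h1 := derivation_avgSeries D hd E
  have h2 := mul_avgSeries_derivV d E
  have h0 := constantCoeff_gaussExpLin ℓ κ
  have h3 : coeffwise derivV E = PowerSeries.X * (coeffwise (coeffDerivation D) E
        + PowerSeries.C (C (half A * ℓ 1)) * (PowerSeries.C (X ^ 2) * E)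
        + PowerSeries.C (C (half A * (ℓ 0 + 1) + κ)) * E) := by
    rw [hE, derivation_expSeries _ h0, derivation_expSeries _ h0, derivV_gaussExpLin D ℓ κ hℓ hκ]
    ring
  rw [h3, hXm, avgSeries_add, avgSeries_add, avgSeries_C_mul, avgSeries_C_mul] at h2
  have h4 : D (-1 - ℓ 0) = - ℓ 1 := by simp [hℓ]
  have hδ : PowerSeries.C d * PowerSeries.C (-1 - ℓ 0) = (1 : PowerSeries A) := by
    rw [← map_mul, hd, map_one]
  have h5 : gaussInt' ℓ d κ = PowerSeries.X * avgSeries d (PowerSeries.C X * E) := by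
    rw [gaussInt', ← hE, ← hXm]
    refine congrArg (avgSeries d) ?_
    ring
  rw [h5, ← h2, gaussInt, ← hE, h1, h4]
  simp only [map_add, map_mul, map_sub, map_one, map_neg] at hδ ⊢
  linear_combination (-(PowerSeries.X ^ 2 * (avgSeries d (coeffwise (coeffDerivation D) E)
    + PowerSeries.C (half A) * PowerSeries.C (ℓ 1) * avgSeries d (PowerSeries.C (X ^ 2) * E)
    + (PowerSeries.C (half A) * (PowerSeries.C (ℓ 0) + 1) + PowerSeries.C κ)
      * avgSeries d E))) * hδ

end EvenPart

end FigureEight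

end

noncomputable section

namespace FigureEight

set_option linter.unusedSectionVars false

open Polynomial

/-! ### The Wronskian -/

section Wronskian

variable {A B : Type*} [CommRing A] [Algebra ℚ A] [CommRing B] [Algebra ℚ B]

theorem derivation_polylogVal (D : Derivation ℚ A A) {p : A} (hp : D p = p + p ^ 2) (m : ℕ) :
    D (polylogVal p m) = polylogVal p (m + 1) := by
  rw [polylogVal, polylogVal, negPolylogPoly, Polynomial.aeval_def, Polynomial.aeval_def,
    ← Polynomial.aeval_def, ← Polynomial.aeval_def, map_mul, Derivation.map_aeval, hp]
  simp [mul_comm]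

/-- The derivative with respect to `κ` of `gaussF p q d κ`. -/
def gaussF' (p q d κ : A) : PowerSeries A := evenPart (gaussInt' (polylogPair p q) d κ)

theorem coeffwise_evenPart (D : Derivation ℚ A A) (f : PowerSeries A) :
    coeffwise D (evenPart f) = evenPart (coeffwise D f) := by
  ext; simp [coeff_evenPart, coeff_coeffwise]

theorem gaussF_derivation (D : Derivation ℚ A A) {p q d κ : A} (hp : D p = p + p ^ 2)
    (hq : D q = q + q ^ 2) (hd : d * (-1 - p - q) = 1) (hκ : D κ = 0) :
    PowerSeries.X * coeffwise D (gaussF p q d κ)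
      = PowerSeries.X * (PowerSeries.C (half A * (-1 - p - q) - κ + half A * d * D (-1 - p - q))
        * gaussF p q d κ) + PowerSeries.C (-1 - p - q) * gaussF' p q d κ := by
  have hℓ (m : ℕ) : D (polylogPair p q m) = polylogPair p q (m + 1) := by
    rw [polylogPair, map_add, derivation_polylogVal D hp, derivation_polylogVal D hq, polylogPair]
  have h0 : -1 - polylogPair p q 0 = -1 - p - q := by rw [polylogPair_zero]; ring
  have h1 : polylogPair p q 1 = - D (-1 - p - q) := by
    rw [← h0, map_sub, hℓ]; simp
  have h := congrArg evenPart (gaussInt_derivation D (by rwa [h0]) hℓ hκ)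
  rw [evenPart_X_sq_mul, evenPart_add, evenPart_X_sq_mul, evenPart_C_mul, evenPart_C_mul,
    ← coeffwise_evenPart, h0, h1] at h
  rw [gaussF, gaussF', h]
  refine congrArg (fun c => PowerSeries.X * (PowerSeries.C c * _) + _) ?_
  ring

theorem gaussF_derivation_of_const (D : Derivation ℚ A A) {p q d : A} (κ : A) (hp : D p = 0)
    (hq : D q = 0) (hd : d * (-1 - p - q) = 1) :
    coeffwise D (gaussF p q d κ) = PowerSeries.C (D κ) * gaussF' p q d κ := by
  have hℓ (m : ℕ) : D (polylogPair p q m) = 0 := by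
    rw [polylogPair, map_add, polylogVal, polylogVal, Derivation.map_aeval, Derivation.map_aeval,
      hp, hq, smul_zero, smul_zero, add_zero]
  rw [gaussF, coeffwise_evenPart, gaussInt_derivation_of_const D κ hd hℓ (by simp [hp, hq]),
    evenPart_C_mul, gaussF']

theorem coeffwise_rescale (D : Derivation ℚ A A) (f : PowerSeries A) :
    coeffwise D (PowerSeries.rescale (-1) f) = PowerSeries.rescale (-1) (coeffwise D f) := by
  ext n
  rw [coeff_coeffwise, PowerSeries.coeff_rescale, PowerSeries.coeff_rescale, coeff_coeffwise]
  rcases neg_one_pow_eq_or A n with h | h <;> simp [h]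

theorem coeffwise_C_mul (D : Derivation ℚ A A) (a : A) (f : PowerSeries A) :
    coeffwise D (PowerSeries.C a * f)
      = PowerSeries.C (D a) * f + PowerSeries.C a * coeffwise D f := by
  ext n
  simp only [coeff_coeffwise, PowerSeries.coeff_C_mul, map_add, Derivation.leibniz, smul_eq_mul]
  ring

theorem coeffwise_sub (D : Derivation ℚ A A) (f g : PowerSeries A) :
    coeffwise D (f - g) = coeffwise D f - coeffwise D g := by
  ext; simp

theorem rescale_C (a c : A) : PowerSeries.rescale a (PowerSeries.C c) = PowerSeries.C c := by
  ext n
  rw [PowerSeries.coeff_rescale, PowerSeries.coeff_C]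
  split_ifs with h <;> simp [h]

/-- The Wronskian of the two solutions `gaussF p q d k`, `rescale (-1) (gaussF p q d (-k))` of the
three-term recurrence. -/
def wronsk (p q d k : A) : PowerSeries A :=
  PowerSeries.C (p * q)
      * (gaussF p q d (k + 1) * PowerSeries.rescale (-1) (gaussF p q d (-k)))
    - PowerSeries.C ((1 + p) * (1 + q))
      * (gaussF p q d k * PowerSeries.rescale (-1) (gaussF p q d (-k - 1)))

theorem map_rescale_neg_one (f : A →+* B) (g : PowerSeries A) :
    PowerSeries.map f (PowerSeries.rescale (-1) g)
      = PowerSeries.rescale (-1) (PowerSeries.map f g) := by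
  ext n; simp [PowerSeries.coeff_rescale]

theorem map_wronsk (f : A →+* B) (p q d k : A) :
    PowerSeries.map f (wronsk p q d k) = wronsk (f p) (f q) (f d) (f k) := by
  simp only [wronsk, map_sub, map_mul, map_rescale_neg_one, map_gaussF, PowerSeries.map_C, map_add,
    map_neg, map_one]

/-- The series at k and the companion at -k with ħ ↦ -ħ satisfy recurrences with the same factor
e^(k ħ); cross-multiplying eliminates it. -/
theorem wronsk_shift {p q d : A} (hd : d * (-1 - p - q) = 1) (k : A) :
    wronsk p q d k = wronsk p q d (k - 1) := by
  have h1 := gaussF_recurrence hd k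
  have h2 := congrArg (PowerSeries.rescale (-1)) (gaussF_recurrence hd (-k))
  have h3 : PowerSeries.rescale (-1) (expSeries (PowerSeries.C (-k) * PowerSeries.X))
      = expSeries (PowerSeries.C k * PowerSeries.X) := by
    rw [rescale_expSeries _ (by simp), map_mul, rescale_C, PowerSeries.rescale_X]
    refine congrArg expSeries ?_
    simp
  have h4 : PowerSeries.rescale (-1) (expSeries (PowerSeries.C (-k) * PowerSeries.X)
      * gaussF p q d (-k)) = expSeries (PowerSeries.C k * PowerSeries.X)
        * PowerSeries.rescale (-1) (gaussF p q d (-k)) := by rw [map_mul, h3]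
  have h5 (a : A) (f : PowerSeries A) : PowerSeries.rescale (-1) (PowerSeries.C a * f)
      = PowerSeries.C a * PowerSeries.rescale (-1) f := by rw [map_mul, rescale_C]
  rw [h4, map_add, map_sub, h5, h5, h5] at h2
  rw [wronsk, wronsk, sub_add_cancel, show -(k - 1) = -k + 1 by ring, add_sub_cancel_right]
  linear_combination PowerSeries.rescale (-1) (gaussF p q d (-k)) * h1 - gaussF p q d k * h2

/-- In each product of two integrals the terms proportional to k cancel, because the companion is
taken at the opposite argument. The remaining constant cancels against the logarithmic derivative of
p q, respectively (1 + p)(1 + q), up to d D(δ), which is the same for both products. -/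
theorem wronsk_derivation (D E : Derivation ℚ A A) {p q d k : A} (hp : D p = p + p ^ 2)
    (hq : D q = q + q ^ 2) (hd : d * (-1 - p - q) = 1) (hk : D k = 0) (hp' : E p = 0)
    (hq' : E q = 0) (hk' : E k = 1) :
    PowerSeries.X * coeffwise D (wronsk p q d k)
      = PowerSeries.X * (PowerSeries.C (d * D (-1 - p - q)) * wronsk p q d k)
        + PowerSeries.C (-1 - p - q) * coeffwise E (wronsk p q d k) := by
  have e1 : D (p * q) = p * q * (2 + p + q) := by
    rw [Derivation.leibniz, hp, hq, smul_eq_mul, smul_eq_mul]; ring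
  have e2 : D ((1 + p) * (1 + q)) = (1 + p) * (1 + q) * (p + q) := by
    rw [Derivation.leibniz, map_add, map_add, Derivation.map_one_eq_zero, hp, hq, smul_eq_mul,
      smul_eq_mul]
    ring
  have e3 : E (p * q) = 0 := by simp [hp', hq']
  have e4 : E ((1 + p) * (1 + q)) = 0 := by simp [hp', hq']
  have hD (κ : A) (hκ : D κ = 0) := gaussF_derivation D hp hq hd hκ
  have hE (κ : A) := gaussF_derivation_of_const E κ hp' hq' hd
  have k1 : D (k + 1) = 0 := by simp [hk]
  have k2 : D (-k) = 0 := by simp [hk]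
  have k4 : D (-k - 1) = 0 := by simp [hk]
  have l1 : E (k + 1) = 1 := by simp [hk']
  have l2 : E (-k) = -1 := by simp [hk']
  have l4 : E (-k - 1) = -1 := by simp [hk']
  generalize D (-1 - p - q) = Δ at *
  have h5 (a : A) (f : PowerSeries A) : PowerSeries.rescale (-1) (PowerSeries.C a * f)
      = PowerSeries.C a * PowerSeries.rescale (-1) f := by rw [map_mul, rescale_C]
  have h6 (f : PowerSeries A) : PowerSeries.rescale (-1) (PowerSeries.X * f)
      = -(PowerSeries.X * PowerSeries.rescale (-1) f) := by
    rw [map_mul, PowerSeries.rescale_X]; simp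
  have hD' (κ : A) (hκ : D κ = 0) := congrArg (PowerSeries.rescale (-1)) (hD κ hκ)
  have hE' (κ : A) := congrArg (PowerSeries.rescale (-1)) (hE κ)
  simp only [h5, map_add (PowerSeries.rescale (-1 : A)), h6, ← coeffwise_rescale] at hD' hE'
  have a1 := hD (k + 1) k1
  have a2 := hD' (-k) k2
  have a3 := hD k hk
  have a4 := hD' (-k - 1) k4
  have b1 := hE (k + 1)
  have b2 := hE' (-k)
  have b3 := hE k
  have b4 := hE' (-k - 1)
  rw [l1] at b1
  rw [l2] at b2
  rw [hk'] at b3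
  rw [l4] at b4
  have h7 := congrArg (PowerSeries.C : A →+* PowerSeries A) (half_add_half (A := A))
  rw [wronsk, coeffwise_sub, coeffwise_sub, coeffwise_C_mul, coeffwise_C_mul, coeffwise_C_mul,
    coeffwise_C_mul, derivation_mul, derivation_mul, derivation_mul, derivation_mul, b1, b2, b3, b4,
    e1, e2, e3, e4]
  clear hD hE hD' hE' b1 b2 b3 b4 h5 h6
  generalize gaussF p q d (k + 1) = F1 at *
  generalize PowerSeries.rescale (-1) (gaussF p q d (-k)) = F2 at *
  generalize gaussF p q d k = F3 at *
  generalize PowerSeries.rescale (-1) (gaussF p q d (-k - 1)) = F4 at *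
  generalize coeffwise D F1 = G1 at *
  generalize coeffwise D F2 = G2 at *
  generalize coeffwise D F3 = G3 at *
  generalize coeffwise D F4 = G4 at *
  simp only [map_add, map_sub, map_neg, map_one, map_mul, map_zero, map_ofNat] at a1 a2 a3 a4 h7 ⊢
  linear_combination PowerSeries.C p * PowerSeries.C q * (F2 * a1 - F1 * a2)
    - (1 + PowerSeries.C p) * (1 + PowerSeries.C q) * (F4 * a3 - F3 * a4)
    + PowerSeries.X * (-1 - PowerSeries.C p - PowerSeries.C q + PowerSeries.C d * PowerSeries.C Δ)
      * (PowerSeries.C p * PowerSeries.C q * F1 * F2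
        - (1 + PowerSeries.C p) * (1 + PowerSeries.C q) * F3 * F4) * h7

end Wronskian

end FigureEight

end

noncomputable section

namespace FigureEight

set_option linter.unusedSectionVars false

open Polynomial

/-! ### Evaluation of the Wronskian -/

section WronskianValue

variable {A : Type*} [CommRing A] [Algebra ℚ A]

theorem polylogVal_zero_left (m : ℕ) : polylogVal (0 : A) m = 0 := by
  cases m with
  | zero => simp [polylogVal, negPolylogPoly]
  | succ m => simp [polylogVal, negPolylogPoly]

/-- At p = q = 0 all polylogarithms vanish and the exponent is (1/2 + κ) s v, so this is the moment
generating function of a Gaussian of variance d. -/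
theorem gaussF_zero_zero (d κ : A) :
    gaussF 0 0 d κ = expSeries (PowerSeries.C (half A * d * (half A + κ) ^ 2) * PowerSeries.X) := by
  have hℓ : polylogPair (0 : A) 0 = 0 := by
    ext m; simp [polylogPair, polylogVal_zero_left]
  have hg : gaussExpLin (0 : ℕ → A) κ
      = PowerSeries.C (C (half A + κ)) * (PowerSeries.C X * PowerSeries.X) := by
    ext n i
    rw [coeff_coeff_gaussExpLin, ← mul_assoc, ← map_mul]
    rcases n with _ | _ | n
    · simp [constantCoeff_gaussExp]
    · rw [coeff_coeff_gaussExp _ (by norm_num), PowerSeries.coeff_succ_mul_X, PowerSeries.coeff_C,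
        if_pos rfl, coeff_C_mul, coeff_X]
      by_cases hi : i = 1
      · simp [hi]
      · simp [hi, Ne.symm hi]
    · rw [coeff_coeff_gaussExp _ (by omega), PowerSeries.coeff_succ_mul_X, PowerSeries.coeff_C,
        if_neg (show ¬ n + 1 = 0 by omega), if_neg (show ¬ (n + 1 + 1 = 1 ∧ i = 1) by omega),
        if_neg (show ¬ (n + 1 + 1 = 1 ∧ i = 1) by omega)]
      simp
  have h0 := constantCoeff_gaussExpLin (0 : ℕ → A) κ
  have hX (f : PowerSeries A[X]) :
      avgSeries d (PowerSeries.X * f) = PowerSeries.X * avgSeries d f := by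
    rw [← avgSeries_map_C_mul, PowerSeries.map_X]
  have key : gaussInt (0 : ℕ → A) d κ
      = expSeries (PowerSeries.C (half A * d * (half A + κ) ^ 2) * PowerSeries.X ^ 2) := by
    rw [gaussInt]
    refine eq_expSeries (by simp) ?_ ?_
    · rw [derivative_avgSeries, derivative_expSeries h0]
      have h1 : PowerSeries.derivative A[X] (gaussExpLin (0 : ℕ → A) κ)
          = PowerSeries.C (C (half A + κ)) * PowerSeries.C X := by
        rw [hg, derivative_mul', derivative_mul']
        simp
      have h2 : coeffwise derivV (gaussExpLin (0 : ℕ → A) κ)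
          = PowerSeries.C (C (half A + κ)) * PowerSeries.X := by
        ext1 n
        rw [hg, coeff_coeffwise, derivV_apply, PowerSeries.coeff_C_mul, PowerSeries.coeff_C_mul,
          PowerSeries.coeff_C_mul, PowerSeries.coeff_X]
        split_ifs <;> simp
      have h3 := mul_avgSeries_derivV d (expSeries (gaussExpLin (0 : ℕ → A) κ))
      rw [derivation_expSeries _ h0, h2, mul_assoc, avgSeries_C_mul, hX] at h3
      rw [h1, mul_assoc, avgSeries_C_mul, ← h3, derivative_mul', PowerSeries.derivative_C,
        PowerSeries.derivative_pow, PowerSeries.derivative_X]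
      have h7 := congrArg (PowerSeries.C : A →+* PowerSeries A) (half_add_half (A := A))
      simp only [map_add, map_one, map_mul, map_pow] at h7 ⊢
      push_cast
      linear_combination (-(PowerSeries.X * PowerSeries.C d * (PowerSeries.C (half A)
        + PowerSeries.C κ) ^ 2 * avgSeries d (expSeries (gaussExpLin (0 : ℕ → A) κ)))) * h7
    · rw [← PowerSeries.coeff_zero_eq_constantCoeff_apply, coeff_avgSeries,
        PowerSeries.coeff_zero_eq_constantCoeff_apply, constantCoeff_expSeries h0, ← C_1,
        ← monomial_zero_left, gaussAvg_monomial]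
      simp [gaussMoment]
  rw [gaussF, hℓ, key]
  have h1 : evenPart (1 : PowerSeries A) = 1 := by
    ext n
    rw [coeff_evenPart, PowerSeries.coeff_one, PowerSeries.coeff_one]
    simp
  have := evenPart_expSeries_mul (half A * d * (half A + κ) ^ 2) 1
  rwa [mul_one, h1, mul_one] at this

/-- The arguments 0 and -1 give the same square (1/2 + κ)² = 1/4, so the exponentials for ħ and -ħ
cancel. -/
theorem wronsk_zero_zero : wronsk (0 : A) 0 (-1) 0 = -1 := by
  have hc (a : A) : PowerSeries.constantCoeff (PowerSeries.C a * PowerSeries.X) = 0 := by simp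
  have hh : half A + (-0 - 1) = - half A := by
    linear_combination half_add_half (A := A)
  have h1 (a : A) : PowerSeries.rescale (-1) (PowerSeries.C a * PowerSeries.X)
      = -(PowerSeries.C a * PowerSeries.X) := by
    rw [map_mul, rescale_C, PowerSeries.rescale_X]
    simp
  rw [wronsk, gaussF_zero_zero, gaussF_zero_zero, gaussF_zero_zero, gaussF_zero_zero,
    rescale_expSeries _ (hc _), rescale_expSeries _ (hc _), hh, h1, h1, add_zero (half A), neg_sq,
    expSeries_mul_neg (hc _)]
  simp

theorem eq_C_of_comp_X_sub_one {R : Type*} [CommRing R] [IsDomain R] [CharZero R] {w : R[X]}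
    (h : w.comp (X - 1) = w) : w = C (w.eval 0) := by
  have h1 (n : ℕ) : w.eval (-n : R) = w.eval 0 := by
    induction n with
    | zero => simp
    | succ n ih =>
      have := congrArg (Polynomial.eval (-n : R)) h
      rw [eval_comp] at this
      simp only [eval_sub, eval_X, eval_one] at this
      rw [← ih, ← this]
      congr 1
      push_cast
      ring
  refine Polynomial.eq_of_infinite_eval_eq _ _ ?_
  refine (Set.infinite_range_of_injective (f := fun n : ℕ => (-n : R)) ?_).mono ?_
  · intro a b hab
    simpa using hab
  · rintro _ ⟨n, rfl⟩
    simp [h1]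

variable {K : Type*} [Field K] [Algebra ℚ K]

/-- The derivation `λ d/dλ` of the power series ring. -/
def eulerDerivation (K : Type*) [Field K] [Algebra ℚ K] :
    Derivation ℚ (PowerSeries K) (PowerSeries K) :=
  PowerSeries.X (R := K) • (PowerSeries.derivative K).restrictScalars ℚ

theorem eulerDerivation_apply (f : PowerSeries K) :
    eulerDerivation K f = PowerSeries.X * PowerSeries.derivative K f := rfl

theorem eulerDerivation_geom {α : K} {p : PowerSeries K}
    (hp : p * (1 - PowerSeries.C α * PowerSeries.X) = PowerSeries.C α * PowerSeries.X) :
    eulerDerivation K p = p + p ^ 2 := by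
  have h1 := congrArg (PowerSeries.derivative K) hp
  rw [derivative_mul', derivative_mul', map_sub, derivative_mul', PowerSeries.derivative_C,
    PowerSeries.derivative_X, PowerSeries.derivative_one] at h1
  rw [eulerDerivation_apply]
  linear_combination (-(PowerSeries.X * PowerSeries.derivative K p) - 1 - p) * hp
    + PowerSeries.X * (1 + p) * h1

theorem eq_C_of_eulerDerivation {f : PowerSeries K} (h : eulerDerivation K f = 0) :
    f = PowerSeries.C (PowerSeries.constantCoeff f) := by
  have : CharZero K := algebraRat.charZero K
  ext n
  rcases n with _ | n
  · simp
  · have h1 := congrArg (PowerSeries.coeff (n + 1)) h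
    rw [eulerDerivation_apply, PowerSeries.coeff_succ_X_mul, PowerSeries.coeff_derivative,
      map_zero] at h1
    rw [PowerSeries.coeff_C, if_neg (Nat.succ_ne_zero n)]
    exact (mul_eq_zero.1 h1).resolve_right (by exact_mod_cast Nat.succ_ne_zero n)

/-- The ħ-coefficients of the Wronskian are polynomials in k invariant under k ↦ k - 1, hence
constant in k. The ∂/∂k term of `wronsk_derivation` then drops out, and the equation says that the
Wronskian divided by δ is killed by λ d/dλ. So this quotient equals its value at λ = 0. -/
theorem wronsk_powerSeries {α β : K} {p q d : PowerSeries K}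
    (hp : p * (1 - PowerSeries.C α * PowerSeries.X) = PowerSeries.C α * PowerSeries.X)
    (hq : q * (1 - PowerSeries.C β * PowerSeries.X) = PowerSeries.C β * PowerSeries.X)
    (hd : d * (-1 - p - q) = 1) : wronsk p q d 0 = PowerSeries.C (-1 - p - q) := by
  have : CharZero (PowerSeries K) := algebraRat.charZero _
  obtain ⟨W, hW⟩ : ∃ W, W = wronsk (C p) (C q) (C d) (X : (PowerSeries K)[X]) := ⟨_, rfl⟩
  have hd' : (C d : (PowerSeries K)[X]) * (-1 - C p - C q) = 1 := by
    rw [← C_1, ← C_neg, ← C_sub, ← C_sub, ← C_mul, hd]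
  have hW1 (n : ℕ) : PowerSeries.coeff n W = C ((PowerSeries.coeff n W).eval 0) := by
    refine eq_C_of_comp_X_sub_one ?_
    have h1 := congrArg (PowerSeries.coeff n) ((map_wronsk (compRingHom (X - 1))
      (C p) (C q) (C d) (X : (PowerSeries K)[X])).trans (by
        rw [coe_compRingHom_apply, coe_compRingHom_apply, coe_compRingHom_apply,
          coe_compRingHom_apply, C_comp, C_comp, C_comp, X_comp, ← wronsk_shift hd']))
    rwa [← hW, PowerSeries.coeff_map, coe_compRingHom_apply] at h1
  have hW0 : PowerSeries.map (evalRingHom 0) W = wronsk p q d 0 := by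
    rw [hW, map_wronsk]
    simp
  have hWC : W = PowerSeries.map C (wronsk p q d 0) := by
    ext1 n
    rw [hW1, ← hW0, PowerSeries.coeff_map, PowerSeries.coeff_map, coe_evalRingHom]
  have hp1 := eulerDerivation_geom hp
  have hq1 := eulerDerivation_geom hq
  have hDC (a : PowerSeries K) :
      coeffDerivation (eulerDerivation K) (C a) = C (eulerDerivation K a) := by
    rw [← monomial_zero_left, coeffDerivation_monomial, monomial_zero_left]
  have h1 := wronsk_derivation (coeffDerivation (eulerDerivation K)) derivV (p := C p) (q := C q)
    (d := C d) (k := X) (by rw [hDC, hp1, C_add, C_pow]) (by rw [hDC, hq1, C_add, C_pow]) hd'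
    (by rw [← monomial_one_one_eq_X, coeffDerivation_monomial]; simp) (by simp [derivV_apply])
    (by simp [derivV_apply]) (by simp [derivV_apply])
  have hE : coeffwise derivV W = 0 := by
    ext1 n
    rw [coeff_coeffwise, hW1, derivV_apply, derivative_C, map_zero]
  rw [← hW, hE, mul_zero, add_zero] at h1
  have h2 : coeffwise (eulerDerivation K) (wronsk p q d 0)
      = PowerSeries.C (d * eulerDerivation K (-1 - p - q)) * wronsk p q d 0 := by
    have h3 := PowerSeries.X_mul_cancel h1
    ext1 n
    have h4 := congrArg (fun f => (PowerSeries.coeff n f).eval 0) h3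
    simp only [hWC] at h4
    rw [coeff_coeffwise, PowerSeries.coeff_map, hDC, eval_C, PowerSeries.coeff_C_mul,
      PowerSeries.coeff_map, ← C_1, ← C_neg, ← C_sub, ← C_sub, hDC, ← C_mul, ← C_mul, eval_C] at h4
    rw [coeff_coeffwise, h4, PowerSeries.coeff_C_mul]
  have hdD : eulerDerivation K d = - d ^ 2 * eulerDerivation K (-1 - p - q) := by
    have h1 := congrArg (eulerDerivation K) hd
    rw [Derivation.leibniz, Derivation.map_one_eq_zero, smul_eq_mul, smul_eq_mul] at h1
    linear_combination d * h1 - eulerDerivation K d * hd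
  have h3 (n : ℕ) : eulerDerivation K (d * PowerSeries.coeff n (wronsk p q d 0)) = 0 := by
    have h4 := congrArg (PowerSeries.coeff n) h2
    rw [coeff_coeffwise, PowerSeries.coeff_C_mul] at h4
    rw [Derivation.leibniz, h4, hdD, smul_eq_mul, smul_eq_mul]
    ring
  have hp0 : PowerSeries.constantCoeff p = 0 := by
    have := congrArg PowerSeries.constantCoeff hp
    simpa using this
  have hq0 : PowerSeries.constantCoeff q = 0 := by
    have := congrArg PowerSeries.constantCoeff hq
    simpa using this
  have hd0 : PowerSeries.constantCoeff d = -1 := by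
    have := congrArg PowerSeries.constantCoeff hd
    simp [hp0, hq0] at this
    linear_combination -this
  have h5 : PowerSeries.map PowerSeries.constantCoeff (wronsk p q d 0) = -1 := by
    rw [map_wronsk, hp0, hq0, hd0, map_zero, wronsk_zero_zero]
  have h6 : PowerSeries.C d * wronsk p q d 0 = 1 := by
    ext1 n
    rw [PowerSeries.coeff_C_mul, eq_C_of_eulerDerivation (h3 n), map_mul, hd0]
    have := congrArg (PowerSeries.coeff n) h5
    rw [PowerSeries.coeff_map, map_neg] at this
    rw [this, PowerSeries.coeff_one, PowerSeries.coeff_one]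
    split_ifs <;> simp
  have h7 : PowerSeries.C (-1 - p - q) * PowerSeries.C d = 1 := by
    rw [← map_mul, mul_comm, hd, map_one]
  linear_combination PowerSeries.C (-1 - p - q) * h6 - wronsk p q d 0 * h7

/-- The given point is the member λ = 1 of the family y₁ = α λ, y₂ = β λ. The identity in K⟦λ⟧ is an
identity between elements of a localization of K[λ], which embeds into K⟦λ⟧ and can also be
specialised at λ = 1. -/
theorem wronsk_eq {p q d : K} (hp : 1 + p ≠ 0) (hq : 1 + q ≠ 0) (hd : d * (-1 - p - q) = 1) :
    wronsk p q d 0 = PowerSeries.C (-1 - p - q) := by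
  obtain ⟨α, hα⟩ : ∃ α, α = p / (1 + p) := ⟨_, rfl⟩
  obtain ⟨β, hβ⟩ : ∃ β, β = q / (1 + q) := ⟨_, rfl⟩
  -- The first two factors are the denominators of p and q along the family. The third is, up to
  -- sign, the numerator of δ = -(1 - α β λ²) / ((1 - α λ)(1 - β λ)).
  obtain ⟨u, hu⟩ : ∃ u : K[X], u = (1 - C α * X) * (1 - C β * X) * (1 - C (α * β) * X ^ 2) :=
    ⟨_, rfl⟩
  let L := Localization.Away u
  let ι : K[X] →+* L := algebraMap K[X] L
  have hιu : IsUnit (ι u) := IsLocalization.Away.algebraMap_isUnit u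
  have hφu : IsUnit (Polynomial.coeToPowerSeries.ringHom u) := by
    rw [PowerSeries.isUnit_iff_constantCoeff, hu]
    simp
  have hα1 : 1 - α = (1 + p)⁻¹ := by rw [hα]; field_simp; ring
  have hβ1 : 1 - β = (1 + q)⁻¹ := by rw [hβ]; field_simp; ring
  have hαβ : (1 - α * β) * ((1 + p) * (1 + q)) = 1 + p + q := by
    rw [hα, hβ]; field_simp; ring
  have hδ0 : 1 + p + q ≠ 0 := by
    intro h
    have : -1 - p - q = 0 := by linear_combination -h
    simp [this] at hd
  have hψu : IsUnit (evalRingHom (1 : K) u) := by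
    rw [hu, isUnit_iff_ne_zero]
    simp only [coe_evalRingHom, eval_mul, eval_sub, eval_one, eval_C, eval_X, eval_pow, mul_one,
      one_pow]
    refine mul_ne_zero (mul_ne_zero ?_ ?_) ?_
    · rw [hα1]; exact inv_ne_zero hp
    · rw [hβ1]; exact inv_ne_zero hq
    · intro h
      rw [h, zero_mul] at hαβ
      exact hδ0 hαβ.symm
  let φ : L →+* PowerSeries K := IsLocalization.Away.lift u hφu
  let ψ : L →+* K := IsLocalization.Away.lift u hψu
  have hφι (f : K[X]) : φ (ι f) = (f : PowerSeries K) := IsLocalization.Away.lift_eq u hφu f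
  have hψι (f : K[X]) : ψ (ι f) = f.eval 1 := IsLocalization.Away.lift_eq u hψu f
  have hφ : Function.Injective φ := by
    rw [injective_iff_map_eq_zero]
    intro z hz
    obtain ⟨n, f, hf⟩ := IsLocalization.Away.surj u z
    have h1 := congrArg φ hf
    rw [map_mul, hz, zero_mul] at h1
    have h2 : f = 0 := by
      have := (hφι f).symm.trans h1.symm
      simpa using this
    rw [h2, map_zero] at hf
    exact (hιu.pow n).mul_left_eq_zero.1 hf
  have hu' := congrArg ι hu
  rw [map_mul, map_mul] at hu'
  have hu1 : IsUnit (ι (1 - C α * X)) := by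
    rw [hu'] at hιu
    exact isUnit_of_mul_isUnit_left (isUnit_of_mul_isUnit_left hιu)
  have hu2 : IsUnit (ι (1 - C β * X)) := by
    rw [hu'] at hιu
    exact isUnit_of_mul_isUnit_right (isUnit_of_mul_isUnit_left hιu)
  have hu3 : IsUnit (ι (1 - C (α * β) * X ^ 2)) := by
    rw [hu'] at hιu
    exact isUnit_of_mul_isUnit_right hιu
  obtain ⟨i1, h1⟩ := hu1.exists_right_inv
  obtain ⟨i2, h2⟩ := hu2.exists_right_inv
  obtain ⟨i3, h3⟩ := hu3.exists_right_inv
  obtain ⟨P, hP⟩ : ∃ P, P = ι (C α * X) * i1 := ⟨_, rfl⟩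
  obtain ⟨Q, hQ⟩ : ∃ Q, Q = ι (C β * X) * i2 := ⟨_, rfl⟩
  have hP1 : P * ι (1 - C α * X) = ι (C α * X) := by
    rw [hP]; linear_combination ι (C α * X) * h1
  have hQ1 : Q * ι (1 - C β * X) = ι (C β * X) := by
    rw [hQ]; linear_combination ι (C β * X) * h2
  obtain ⟨E, hE⟩ : ∃ E, E = -(ι (1 - C α * X) * ι (1 - C β * X) * i3) := ⟨_, rfl⟩
  have hE1 : E * (-1 - P - Q) = 1 := by
    simp only [map_sub, map_mul, map_one, map_pow] at *
    rw [hE]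
    linear_combination h3 + i3 * (1 - ι (C β) * ι X) * hP1 + i3 * (1 - ι (C α) * ι X) * hQ1
  have key : wronsk P Q E 0 = PowerSeries.C (-1 - P - Q) := by
    have h4 : wronsk (φ P) (φ Q) (φ E) 0 = PowerSeries.C (-1 - φ P - φ Q) := by
      refine wronsk_powerSeries (α := α) (β := β) ?_ ?_ ?_
      · have := congrArg φ hP1
        rw [map_mul, hφι, hφι] at this
        simpa using this
      · have := congrArg φ hQ1
        rw [map_mul, hφι, hφι] at this
        simpa using this
      · have := congrArg φ hE1
        simpa using this
    refine PowerSeries.map_injective φ hφ ?_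
    rw [map_wronsk, map_zero, h4, PowerSeries.map_C]
    simp
  have h4 := congrArg (PowerSeries.map ψ) key
  have hψP : ψ P = p := by
    have := congrArg ψ hP1
    rw [map_mul, hψι, hψι] at this
    simp only [eval_sub, eval_one, eval_mul, eval_C, eval_X, mul_one, hα1] at this
    rw [hα] at this
    field_simp at this
    exact this
  have hψQ : ψ Q = q := by
    have := congrArg ψ hQ1
    rw [map_mul, hψι, hψι] at this
    simp only [eval_sub, eval_one, eval_mul, eval_C, eval_X, mul_one, hβ1] at this
    rw [hβ] at this
    field_simp at this
    exact this
  have hψE : ψ E = d := by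
    have := congrArg ψ hE1
    rw [map_mul, map_sub, map_sub, map_neg, map_one, hψP, hψQ] at this
    linear_combination d * this - ψ E * hd
  have hψδ : ψ (-1 - P - Q) = -1 - p - q := by
    rw [map_sub, map_sub, map_neg, map_one, hψP, hψQ]
  rwa [map_wronsk, hψP, hψQ, hψE, map_zero, PowerSeries.map_C, hψδ] at h4

end WronskianValue

end FigureEight

end

noncomputable section

namespace FigureEight

set_option linter.unusedSectionVars false

open Polynomial

/-! ### Symmetric functions and the functional equations over a field -/

section Symmetric

variable {A B : Type*} [CommRing A] [Algebra ℚ A] [CommRing B] [Algebra ℚ B]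

/-- The power sums of two elements with elementary symmetric functions `e₁`, `e₂`. -/
def powerSum (e₁ e₂ : A) : ℕ → A
  | 0 => 2
  | 1 => e₁
  | n + 2 => e₁ * powerSum e₁ e₂ (n + 1) - e₂ * powerSum e₁ e₂ n

theorem powerSum_add_mul (p q : A) (n : ℕ) : powerSum (p + q) (p * q) n = p ^ n + q ^ n := by
  induction n using Nat.twoStepInduction with
  | zero => simp [powerSum]; norm_num
  | one => simp [powerSum]
  | more n ih1 ih2 => rw [powerSum, ih1, ih2]; ring

theorem map_powerSum (f : A →+* B) (e₁ e₂ : A) (n : ℕ) :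
    f (powerSum e₁ e₂ n) = powerSum (f e₁) (f e₂) n := by
  induction n using Nat.twoStepInduction with
  | zero => exact map_ofNat f 2
  | one => simp [powerSum]
  | more n ih1 ih2 => rw [powerSum, powerSum, map_sub, map_mul, map_mul, ih1, ih2]

/-- `polylogPair p q m` in terms of the elementary symmetric functions of `p`, `q`. -/
def polylogSym (e₁ e₂ : A) (m : ℕ) : A :=
  (negPolylogPoly m).sum fun n c => algebraMap ℚ A c * powerSum e₁ e₂ n

theorem polylogSym_add_mul (p q : A) (m : ℕ) :
    polylogSym (p + q) (p * q) m = polylogPair p q m := by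
  simp only [polylogSym, powerSum_add_mul, polylogPair, polylogVal, aeval_def, eval₂_eq_sum,
    Polynomial.sum, mul_add, Finset.sum_add_distrib]

theorem map_polylogSym (f : A →+* B) (e₁ e₂ : A) (m : ℕ) :
    f (polylogSym e₁ e₂ m) = polylogSym (f e₁) (f e₂) m := by
  have hq (r : ℚ) : f (algebraMap ℚ A r) = algebraMap ℚ B r := by simp
  simp only [polylogSym, Polynomial.sum, map_sum, map_mul, map_powerSum, hq]

/-- The series `gaussF p q d κ` in terms of `e₁ = p + q`, `e₂ = p q`. -/
def symF (e₁ e₂ d κ : A) : PowerSeries A := evenPart (gaussInt (polylogSym e₁ e₂) d κ)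

/-- On the curve p and q are not functions of t = x y, but p + q and p q are. Writing the integral
in these two makes it depend on t and d only, so that it can be expanded at t = 0. -/
theorem symF_add_mul (p q d κ : A) : symF (p + q) (p * q) d κ = gaussF p q d κ := by
  rw [symF, gaussF, show polylogSym (p + q) (p * q) = polylogPair p q from
    funext (polylogSym_add_mul p q)]

theorem map_symF (f : A →+* B) (e₁ e₂ d κ : A) :
    PowerSeries.map f (symF e₁ e₂ d κ) = symF (f e₁) (f e₂) (f d) (f κ) := by
  rw [symF, symF, map_evenPart, map_gaussInt,
    show (fun m => f (polylogSym e₁ e₂ m)) = polylogSym (f e₁) (f e₂) from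
      funext (map_polylogSym f e₁ e₂)]

theorem constantCoeff_symF (e₁ e₂ d κ : A) : PowerSeries.constantCoeff (symF e₁ e₂ d κ) = 1 := by
  rw [← PowerSeries.coeff_zero_eq_constantCoeff_apply, symF, coeff_evenPart, mul_zero, gaussInt,
    coeff_avgSeries, PowerSeries.coeff_zero_eq_constantCoeff_apply,
    constantCoeff_expSeries (constantCoeff_gaussExpLin _ _), ← C_1, ← monomial_zero_left,
    gaussAvg_monomial]
  simp [gaussMoment]

variable {K : Type*} [Field K] [Algebra ℚ K]

/-- The series with `y₁ + y₂ = 1 + t + t²`, `y₁ y₂ = t²`. -/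
def curveF (t d κ : K) : PowerSeries K := symF (t - t⁻¹ - 1) (-t) d κ

/-- Identities in p and q are applied over the algebraic closure and descend because coefficientwise
extension of scalars is injective. The last two conditions hold because (1 + p)(1 + q) = -t⁻¹. -/
theorem exists_roots {t : K} (ht : t ≠ 0) : ∃ p q : AlgebraicClosure K,
    p + q = algebraMap K _ (t - t⁻¹ - 1) ∧ p * q = algebraMap K _ (-t) ∧ 1 + p ≠ 0 ∧ 1 + q ≠ 0 := by
  obtain ⟨e₁, he₁⟩ : ∃ e₁, e₁ = algebraMap K (AlgebraicClosure K) (t - t⁻¹ - 1) := ⟨_, rfl⟩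
  obtain ⟨e₂, he₂⟩ : ∃ e₂, e₂ = algebraMap K (AlgebraicClosure K) (-t) := ⟨_, rfl⟩
  have hdeg : (X ^ 2 + (C (-e₁) * X + C e₂) : (AlgebraicClosure K)[X]).degree = 2 := by
    compute_degree!
  obtain ⟨p, hp⟩ := IsAlgClosed.exists_root _ (by rw [hdeg]; norm_num)
  simp only [IsRoot, eval_add, eval_pow, eval_X, eval_mul, eval_C] at hp
  have h1 : (1 + p) * (1 + (e₁ - p)) = algebraMap K _ (-t⁻¹) := by
    have : algebraMap K (AlgebraicClosure K) (-t⁻¹) = 1 + e₁ + e₂ := by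
      rw [he₁, he₂, ← map_one (algebraMap K (AlgebraicClosure K)), ← map_add, ← map_add]
      congr 1; ring
    rw [this]
    linear_combination -hp
  have h2 : (1 + p) * (1 + (e₁ - p)) ≠ 0 := by
    rw [h1]
    simpa using ht
  refine ⟨p, e₁ - p, by rw [← he₁]; ring, by rw [← he₂]; linear_combination -hp,
    left_ne_zero_of_mul h2, right_ne_zero_of_mul h2⟩

theorem curveF_recurrence {t d : K} (ht : t ≠ 0) (hd : d * (t⁻¹ - t) = 1) (κ : K) :
    PowerSeries.C (t + t⁻¹ + 1) * curveF t d κ - PowerSeries.C t⁻¹ * curveF t d (κ - 1)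
      - PowerSeries.C t * curveF t d (κ + 1)
      = expSeries (PowerSeries.C κ * PowerSeries.X) * curveF t d κ := by
  obtain ⟨p, q, h1, h2, -, -⟩ := exists_roots ht
  let f := algebraMap K (AlgebraicClosure K)
  have hf : Function.Injective f := f.injective
  have hF (κ : K) : PowerSeries.map f (curveF t d κ) = gaussF p q (f d) (f κ) := by
    rw [curveF, map_symF, ← symF_add_mul, h1, h2]
  refine PowerSeries.map_injective f hf ?_
  have hpq : -1 - p - q = f (t⁻¹ - t) := by
    rw [show f (t⁻¹ - t) = -1 - f (t - t⁻¹ - 1) by rw [← map_one f, ← map_neg, ← map_sub]; congr 1; ring,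
      ← h1]
    ring
  have h := gaussF_recurrence (d := f d) (p := p) (q := q) (by rw [hpq, ← map_mul, hd, map_one])
    (f κ)
  have e1 : (1 + p) * (1 + q) = f (-t⁻¹) := by
    rw [show (1 + p) * (1 + q) = 1 + (p + q) + p * q by ring, h1, h2, ← map_one f, ← map_add,
      ← map_add]
    congr 1; ring
  have e2 : p + q + 2 * p * q = f (- (t + t⁻¹ + 1)) := by
    rw [show p + q + 2 * p * q = (p + q) + p * q + p * q by ring, h1, h2, ← map_add, ← map_add]
    congr 1; ring
  rw [e1, e2, h2, ← map_one f, ← map_sub, ← map_add, ← hF, ← hF, ← hF, ← PowerSeries.map_C,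
    ← PowerSeries.map_C, ← PowerSeries.map_C, ← PowerSeries.map_C, ← PowerSeries.map_X f,
    ← map_mul, ← map_mul, ← map_mul, ← map_mul, ← map_expSeries f (by simp), ← map_sub,
    ← map_add, ← map_mul] at h
  rw [← h]
  refine congrArg (PowerSeries.map f) ?_
  simp only [map_neg]
  ring

theorem curveF_wronsk {t d : K} (ht : t ≠ 0) (hd : d * (t⁻¹ - t) = 1) :
    PowerSeries.C t⁻¹ * (curveF t d 0 * PowerSeries.rescale (-1) (curveF t d (-1)))
      - PowerSeries.C t * (curveF t d 1 * PowerSeries.rescale (-1) (curveF t d 0))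
      = PowerSeries.C (t⁻¹ - t) := by
  obtain ⟨p, q, h1, h2, hp, hq⟩ := exists_roots ht
  let f := algebraMap K (AlgebraicClosure K)
  have hf : Function.Injective f := f.injective
  have hF (κ : K) : PowerSeries.map f (curveF t d κ) = gaussF p q (f d) (f κ) := by
    rw [curveF, map_symF, ← symF_add_mul, h1, h2]
  refine PowerSeries.map_injective f hf ?_
  have hpq : -1 - p - q = f (t⁻¹ - t) := by
    rw [show f (t⁻¹ - t) = -1 - f (t - t⁻¹ - 1) by rw [← map_one f, ← map_neg, ← map_sub]; congr 1; ring,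
      ← h1]
    ring
  have h := wronsk_eq (d := f d) hp hq (by rw [hpq, ← map_mul, hd, map_one])
  have e1 : (1 + p) * (1 + q) = f (-t⁻¹) := by
    rw [show (1 + p) * (1 + q) = 1 + (p + q) + p * q by ring, h1, h2, ← map_one f, ← map_add,
      ← map_add]
    congr 1; ring
  have g0 : gaussF p q (f d) 0 = PowerSeries.map f (curveF t d 0) := by rw [hF, map_zero]
  have g1 : gaussF p q (f d) 1 = PowerSeries.map f (curveF t d 1) := by rw [hF, map_one]
  have g2 : gaussF p q (f d) (-1) = PowerSeries.map f (curveF t d (-1)) := by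
    rw [hF, map_neg, map_one]
  rw [wronsk, e1, h2, hpq, zero_add, neg_zero, zero_sub, g0, g1, g2, ← map_rescale_neg_one, ← map_rescale_neg_one,
    ← PowerSeries.map_C, ← PowerSeries.map_C, ← PowerSeries.map_C, ← map_mul, ← map_mul, ← map_mul,
    ← map_mul, ← map_sub] at h
  rw [← h]
  refine congrArg (PowerSeries.map f) ?_
  simp only [map_neg]
  ring

end Symmetric

end FigureEight

end

noncomputable section

namespace FigureEight

set_option linter.unusedSectionVars false

open Polynomial

/-! ### Substitution of the logarithm -/

section LogSubst

variable {A B : Type*} [CommRing A] [Algebra ℚ A] [CommRing B] [Algebra ℚ B]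

/-- The substitution `ħ = ε log (1 + Q)`. -/
def logSubst (ε : A) : PowerSeries A →+* PowerSeries A :=
  (PowerSeries.substAlgHom (R := A) (PowerSeries.HasSubst.log (A := A))).toRingHom.comp
    (PowerSeries.rescale ε)

theorem logSubst_apply (ε : A) (f : PowerSeries A) :
    logSubst ε f = (PowerSeries.rescale ε f).subst (PowerSeries.log A) := by
  rw [← PowerSeries.coe_substAlgHom (PowerSeries.HasSubst.log (A := A))]
  rfl

theorem logSubst_C (ε a : A) : logSubst ε (PowerSeries.C a) = PowerSeries.C a := by
  rw [logSubst_apply, rescale_C, PowerSeries.subst_C]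
  rfl

theorem constantCoeff_logSubst (ε : A) (f : PowerSeries A) :
    PowerSeries.constantCoeff (logSubst ε f) = PowerSeries.constantCoeff f := by
  have h1 : f = PowerSeries.C (PowerSeries.constantCoeff f)
      + (f - PowerSeries.C (PowerSeries.constantCoeff f)) := by ring
  have h2 : PowerSeries.constantCoeff (logSubst ε
      (f - PowerSeries.C (PowerSeries.constantCoeff f))) = 0 := by
    rw [logSubst_apply]
    refine PowerSeries.constantCoeff_subst_eq_zero PowerSeries.constantCoeff_log _ ?_
    rw [← PowerSeries.coeff_zero_eq_constantCoeff_apply, PowerSeries.coeff_rescale]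
    simp
  rw [h1, map_add, map_add, h2, logSubst_C]
  simp

theorem map_logSubst (g : A →+* B) (ε : A) (f : PowerSeries A) :
    PowerSeries.map g (logSubst ε f) = logSubst (g ε) (PowerSeries.map g f) := by
  rw [logSubst_apply, logSubst_apply]
  have h1 := PowerSeries.map_subst (PowerSeries.HasSubst.log (A := A)) (h := g)
    (PowerSeries.rescale ε f)
  have h2 : PowerSeries.map g (PowerSeries.rescale ε f)
      = PowerSeries.rescale (g ε) (PowerSeries.map g f) := by
    ext n; simp [PowerSeries.coeff_rescale]
  rw [← h2, ← PowerSeries.map_log g]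
  exact h1

theorem logSubst_expSeries (ε κ : A) : logSubst ε (expSeries (PowerSeries.C κ * PowerSeries.X))
    = expSeries (PowerSeries.C (κ * ε) * PowerSeries.log A) := by
  rw [logSubst_apply, rescale_expSeries _ (by simp), map_mul, rescale_C, PowerSeries.rescale_X,
    expSeries_subst (by simp) PowerSeries.constantCoeff_log]
  refine congrArg expSeries ?_
  rw [← mul_assoc, ← map_mul, ← PowerSeries.coe_substAlgHom (PowerSeries.HasSubst.log (A := A)),
    map_mul, PowerSeries.substAlgHom_X, PowerSeries.coe_substAlgHom, PowerSeries.subst_C]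
  rfl

theorem expSeries_log : expSeries (PowerSeries.log A) = 1 + PowerSeries.X := by
  symm
  refine eq_expSeries PowerSeries.constantCoeff_log ?_ (by simp)
  rw [PowerSeries.deriv_log]
  ext n
  rcases n with _ | n
  · simp
  · simp [mul_add, PowerSeries.coeff_succ_mul_X, pow_succ, PowerSeries.coeff_one]

theorem expSeries_nat_mul {g : PowerSeries A} (hg : PowerSeries.constantCoeff g = 0) (k : ℕ) :
    expSeries (PowerSeries.C (k : A) * g) = expSeries g ^ k := by
  induction k with
  | zero => simp [expSeries_zero]
  | succ k ih =>
    rw [Nat.cast_succ, map_add, add_mul, expSeries_add (by simp [hg]) (by simp [hg]), ih, map_one,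
      one_mul, pow_succ]

/-- The series is (1 + Q)^(±k). This is what makes the coefficients of the recurrence integral in
the variable q - 1, while in ħ they are not. -/
theorem exists_expSeries_log_eq_map {ε : A} (hε : ε = 1 ∨ ε = -1) (k : ℕ) :
    ∃ b : PowerSeries ℤ, PowerSeries.constantCoeff b = 1 ∧
      expSeries (PowerSeries.C ((k : A) * ε) * PowerSeries.log A)
        = PowerSeries.map (Int.castRingHom A) b := by
  suffices h : ∃ b : PowerSeries ℤ, PowerSeries.constantCoeff b = 1 ∧
      expSeries (PowerSeries.C ε * PowerSeries.log A)
        = PowerSeries.map (Int.castRingHom A) b by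
    obtain ⟨b, hb, h⟩ := h
    refine ⟨b ^ k, by rw [map_pow, hb, one_pow], ?_⟩
    rw [map_mul, mul_assoc, expSeries_nat_mul (by simp), h, map_pow]
  rcases hε with rfl | rfl
  · refine ⟨1 + PowerSeries.X, by simp, ?_⟩
    rw [map_one, one_mul, expSeries_log]
    simp
  · obtain ⟨b, hb⟩ : ∃ b : PowerSeries ℤ, (1 + PowerSeries.X) * b = 1 :=
      (PowerSeries.isUnit_iff_constantCoeff.2 (by simp)).exists_right_inv
    refine ⟨b, ?_, ?_⟩
    · have := congrArg PowerSeries.constantCoeff hb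
      simpa using this
    · have h1 := expSeries_mul_neg (PowerSeries.constantCoeff_log (A := A))
      have h2 := congrArg (PowerSeries.map (Int.castRingHom A)) hb
      rw [map_mul, map_one, map_add, map_one, PowerSeries.map_X] at h2
      rw [expSeries_log] at h1
      rw [map_neg, map_one, neg_one_mul]
      linear_combination (PowerSeries.map (Int.castRingHom A) b) * h1
        - expSeries (-PowerSeries.log A) * h2

end LogSubst

/-! ### Integrality of expansions at `t = 0` -/

section Integrality

/-- The image of `ℤ⟦t⟧` in the field of Laurent series. -/
def integralSeries : Subring (LaurentSeries ℚ) :=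
  ((HahnSeries.ofPowerSeries ℤ ℚ).comp (PowerSeries.map (Int.castRingHom ℚ))).range

theorem mem_integralSeries {f : LaurentSeries ℚ} : f ∈ integralSeries ↔
    (∀ n < 0, f.coeff n = 0) ∧ ∀ n, ∃ z : ℤ, f.coeff n = z := by
  constructor
  · rintro ⟨g, rfl⟩
    have h (n : ℤ) : ((HahnSeries.ofPowerSeries ℤ ℚ) (PowerSeries.map (Int.castRingHom ℚ) g)).coeff n
        = if n < 0 then 0 else ((PowerSeries.coeff n.natAbs g : ℤ) : ℚ) := by
      rw [PowerSeries.coeff_coe]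
      split_ifs <;> simp
    simp only [RingHom.comp_apply, h]
    refine ⟨fun n hn => if_pos hn, fun n => ?_⟩
    split_ifs
    · exact ⟨0, by simp⟩
    · exact ⟨_, rfl⟩
  · rintro ⟨h1, h2⟩
    choose z hz using h2
    refine ⟨PowerSeries.mk fun n => z n, ?_⟩
    ext n
    rw [RingHom.comp_apply, PowerSeries.coeff_coe]
    split_ifs with hn
    · exact (h1 n hn).symm
    · rw [PowerSeries.coeff_map, PowerSeries.coeff_mk, hz]
      have : ((n.natAbs : ℕ) : ℤ) = n := Int.natAbs_of_nonneg (not_lt.1 hn)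
      rw [this]
      simp

/-- The variable of the field of Laurent series. -/
def tVar : LaurentSeries ℚ := HahnSeries.single 1 1

theorem tVar_ne_zero : tVar ≠ 0 := HahnSeries.single_ne_zero one_ne_zero

theorem tVar_mem : tVar ∈ integralSeries := ⟨PowerSeries.X, by simp [tVar]⟩

theorem coeff_tVar_pow_mul (m : ℕ) (f : LaurentSeries ℚ) (n : ℤ) :
    (tVar ^ m * f).coeff n = f.coeff (n - m) := by
  rw [tVar, HahnSeries.single_pow, one_pow, HahnSeries.coeff_single_mul, one_mul]
  simp

/-- Iterating m times leaves the unknown only in t^(2m) a_{k+m}. Since the pole orders are bounded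
uniformly in k, this term does not reach a given power of t once m is large. -/
theorem integral_of_contraction {a c : ℕ → LaurentSeries ℚ} (hc : ∀ k, c k ∈ integralSeries)
    (ha : ∀ k, a k = c k + tVar ^ 2 * a (k + 1)) {b : ℤ} (hb : ∀ k, ∀ n < b, (a k).coeff n = 0)
    (k : ℕ) : a k ∈ integralSeries := by
  have h (m : ℕ) : ∃ s ∈ integralSeries, a k = s + tVar ^ (2 * m) * a (k + m) := by
    induction m with
    | zero => exact ⟨0, zero_mem _, by simp⟩
    | succ m ih =>
      obtain ⟨s, hs, h⟩ := ih
      refine ⟨s + tVar ^ (2 * m) * c (k + m),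
        add_mem hs (mul_mem (pow_mem tVar_mem _) (hc _)), ?_⟩
      rw [h, ha (k + m)]
      ring_nf
  have h' (n : ℤ) : ∃ s ∈ integralSeries, (a k).coeff n = s.coeff n := by
    -- With this m one has n - 2m < b, so the remainder has zero coefficient at n.
    obtain ⟨s, hs, h⟩ := h (n - b + 1).toNat
    refine ⟨s, hs, ?_⟩
    rw [h, HahnSeries.coeff_add, coeff_tVar_pow_mul, hb, add_zero]
    have := Int.self_le_toNat (n - b + 1)
    push_cast
    omega
  rw [mem_integralSeries]
  refine ⟨fun n hn => ?_, fun n => ?_⟩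
  · obtain ⟨s, hs, h⟩ := h' n
    rw [h]
    exact (mem_integralSeries.1 hs).1 n hn
  · obtain ⟨s, hs, h⟩ := h' n
    rw [h]
    exact (mem_integralSeries.1 hs).2 n

theorem eval_nat_bounded (P : (LaurentSeries ℚ)[X]) :
    ∃ b : ℤ, ∀ k : ℕ, ∀ n < b, (P.eval (k : LaurentSeries ℚ)).coeff n = 0 := by
  induction P using Polynomial.induction_on' with
  | add p q hp hq =>
    obtain ⟨b, hb⟩ := hp
    obtain ⟨c, hc⟩ := hq
    refine ⟨min b c, fun k n hn => ?_⟩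
    rw [eval_add, HahnSeries.coeff_add, hb k n (lt_of_lt_of_le hn (min_le_left _ _)),
      hc k n (lt_of_lt_of_le hn (min_le_right _ _)), add_zero]
  | monomial i a =>
    refine ⟨a.order, fun k n hn => ?_⟩
    rw [eval_monomial, mul_comm, ← Nat.cast_pow, ← nsmul_eq_mul, HahnSeries.coeff_nsmul,
      Pi.smul_apply, HahnSeries.coeff_eq_zero_of_lt_order hn, smul_zero]

/-- Induction on the degree in Q. Because v and E have no constant term, the quadratic part of
coefficient n involves only coefficients of v below n, and the linear part is the contraction of
`integral_of_contraction`. -/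
theorem integral_of_recurrence {v E : ℕ → PowerSeries (LaurentSeries ℚ)}
    (hE : ∀ k n, PowerSeries.coeff n (E k) ∈ integralSeries)
    (hE0 : ∀ k, PowerSeries.constantCoeff (E k) = 0)
    (hv0 : ∀ k, PowerSeries.constantCoeff (v k) = 0)
    (hv : ∀ k, v k = (1 + v k) * (PowerSeries.C tVar * E k + PowerSeries.C (tVar ^ 2) * v (k + 1)))
    (hb : ∀ n, ∃ b : ℤ, ∀ k, ∀ i < b, (PowerSeries.coeff n (v k)).coeff i = 0) (n k : ℕ) :
    PowerSeries.coeff n (v k) ∈ integralSeries := by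
  induction n using Nat.strong_induction_on generalizing k with
  | _ n ih =>
    obtain ⟨b, hb⟩ := hb n
    refine integral_of_contraction (a := fun k => PowerSeries.coeff n (v k))
      (c := fun k => tVar * PowerSeries.coeff n (E k) + PowerSeries.coeff n (v k *
        (PowerSeries.C tVar * E k + PowerSeries.C (tVar ^ 2) * v (k + 1)))) ?_ ?_ hb k
    · intro k
      refine add_mem (mul_mem tVar_mem (hE _ _)) ?_
      rw [PowerSeries.coeff_mul]
      refine sum_mem fun ij hij => ?_
      obtain ⟨i, j⟩ := ij
      have hij := Finset.HasAntidiagonal.mem_antidiagonal.1 hij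
      simp only at hij ⊢
      rcases Nat.eq_zero_or_pos i with rfl | hi
      · rw [PowerSeries.coeff_zero_eq_constantCoeff_apply, hv0, zero_mul]
        exact zero_mem _
      rcases Nat.eq_zero_or_pos j with rfl | hj
      · rw [PowerSeries.coeff_zero_eq_constantCoeff_apply (PowerSeries.C tVar * E k + _)]
        simp [hE0, hv0, zero_mem]
      rw [map_add, PowerSeries.coeff_C_mul, PowerSeries.coeff_C_mul]
      exact mul_mem (ih i (by omega) k) (add_mem (mul_mem tVar_mem (hE _ _))
        (mul_mem (pow_mem tVar_mem _) (ih j (by omega) (k + 1))))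
    · intro k
      have := congrArg (PowerSeries.coeff n) (hv k)
      rw [add_mul, one_mul, map_add, map_add, PowerSeries.coeff_C_mul, PowerSeries.coeff_C_mul]
        at this
      linear_combination this

theorem isUnit_one_sub_tVar_sq : ∃ i ∈ integralSeries, i * (1 - tVar ^ 2) = 1 := by
  obtain ⟨b, hb⟩ : ∃ b : PowerSeries ℤ, (1 - PowerSeries.X ^ 2) * b = 1 :=
    (PowerSeries.isUnit_iff_constantCoeff.2 (by simp)).exists_right_inv
  refine ⟨_, ⟨b, rfl⟩, ?_⟩
  have := congrArg ((HahnSeries.ofPowerSeries ℤ ℚ).comp (PowerSeries.map (Int.castRingHom ℚ))) hb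
  have h2 : (HahnSeries.ofPowerSeries ℤ ℚ).comp (PowerSeries.map (Int.castRingHom ℚ))
      (1 - PowerSeries.X ^ 2) = 1 - tVar ^ 2 := by simp [tVar]
  rw [map_mul, map_one, mul_comm, h2] at this
  exact this

/-- The ratios u_k of the values at κ = k + 1 and κ = k satisfy the Riccati form of the three-term
recurrence, and `integral_of_recurrence` applies to v_k = u_k - 1. The index increases with k, so
u_0 is controlled by all later ratios. -/
theorem curveF_ratio {d : LaurentSeries ℚ} (hd : d * (tVar⁻¹ - tVar) = 1)
    {ε : LaurentSeries ℚ} (hε : ε = 1 ∨ ε = -1) :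
    ∃ v : PowerSeries (LaurentSeries ℚ), PowerSeries.constantCoeff v = 0 ∧
      (∀ n, PowerSeries.coeff n v ∈ integralSeries) ∧
      logSubst ε (curveF tVar d 1) = (1 + v) * logSubst ε (curveF tVar d 0) := by
  -- With κ a polynomial variable, each Q-coefficient of u_k is the value at k of one polynomial;
  -- this gives the bound on pole orders that is uniform in k.
  obtain ⟨Fp, hFp⟩ : ∃ Fp : (LaurentSeries ℚ)[X] → PowerSeries (LaurentSeries ℚ)[X],
      Fp = symF (C (tVar - tVar⁻¹ - 1)) (C (-tVar)) (C d) := ⟨_, rfl⟩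
  have hFp0 (κ) : PowerSeries.constantCoeff (Fp κ) = 1 := by rw [hFp, constantCoeff_symF]
  obtain ⟨G, hG⟩ : ∃ G, Fp X * G = 1 :=
    (PowerSeries.isUnit_iff_constantCoeff.2 (by rw [hFp0]; exact isUnit_one)).exists_right_inv
  have hG0 : PowerSeries.constantCoeff G = 1 := by
    have := congrArg PowerSeries.constantCoeff hG
    rwa [map_mul, hFp0, one_mul, map_one] at this
  let ev (k : ℕ) : PowerSeries (LaurentSeries ℚ)[X] →+* PowerSeries (LaurentSeries ℚ) :=
    PowerSeries.map (evalRingHom (k : LaurentSeries ℚ))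
  have hev (k : ℕ) (κ) : ev k (Fp κ) = curveF tVar d (κ.eval (k : LaurentSeries ℚ)) := by
    simp only [ev]
    rw [hFp, map_symF, curveF]
    simp
  let u (k : ℕ) := logSubst ε (ev k (Fp (X + 1) * G))
  let F (k : ℕ) := logSubst ε (curveF tVar d k)
  have hF0 (k : ℕ) : PowerSeries.constantCoeff (F k) = 1 := by
    simp only [F]
    rw [constantCoeff_logSubst, curveF, constantCoeff_symF]
  have huF (k : ℕ) : F (k + 1) = u k * F k := by
    have h1 := congrArg (fun f => logSubst ε (ev k f)) hG
    simp only [map_mul, map_one, hev, eval_X] at h1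
    simp only [F, u, map_mul, hev, eval_add, eval_X, eval_one, Nat.cast_succ]
    linear_combination (-logSubst ε (curveF tVar d (k + 1))) * h1
  have hu0 (k : ℕ) : PowerSeries.constantCoeff (u k) = 1 := by
    have := congrArg PowerSeries.constantCoeff (huF k)
    rw [map_mul, hF0, hF0, mul_one] at this
    exact this.symm
  choose b hb0 hb using exists_expSeries_log_eq_map hε
  have hrec (k : ℕ) : u k * (PowerSeries.C (tVar + tVar⁻¹ + 1)
      - PowerSeries.map (Int.castRingHom _) (b (k + 1)) - PowerSeries.C tVar * u (k + 1))
      = PowerSeries.C tVar⁻¹ := by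
    have h1 := congrArg (logSubst ε) (curveF_recurrence tVar_ne_zero hd ((k + 1 : ℕ)))
    rw [map_mul, logSubst_expSeries, hb, map_sub, map_sub, map_mul, map_mul, map_mul, logSubst_C,
      logSubst_C, logSubst_C] at h1
    have e1 : ((k + 1 : ℕ) : LaurentSeries ℚ) - 1 = (k : ℕ) := by push_cast; ring
    have e2 : ((k + 1 : ℕ) : LaurentSeries ℚ) + 1 = (k + 1 + 1 : ℕ) := by push_cast; ring
    rw [e1, e2] at h1
    change PowerSeries.C (tVar + tVar⁻¹ + 1) * F (k + 1) - PowerSeries.C tVar⁻¹ * F k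
      - PowerSeries.C tVar * F (k + 1 + 1) = _ * F (k + 1) at h1
    rw [huF (k + 1), huF k] at h1
    have hF : F k ≠ 0 := by
      intro h
      have := hF0 k
      rw [h, map_zero] at this
      exact zero_ne_one this
    refine mul_right_cancel₀ hF ?_
    linear_combination h1
  have hCC : PowerSeries.C tVar * PowerSeries.C tVar⁻¹ = (1 : PowerSeries (LaurentSeries ℚ)) := by
    rw [← map_mul, mul_inv_cancel₀ tVar_ne_zero, map_one]
  have hmem := integral_of_recurrence (v := fun k => u k - 1)
    (E := fun k => PowerSeries.map (Int.castRingHom _) (b (k + 1)) - 1) ?_ ?_ ?_ ?_ ?_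
  · refine ⟨u 0 - 1, ?_, fun n => hmem n 0, ?_⟩
    · rw [map_sub, hu0, map_one, sub_self]
    · have := huF 0
      simp only [F] at this
      simpa using this
  · intro k n
    rw [map_sub, PowerSeries.coeff_map, PowerSeries.coeff_one]
    refine sub_mem (intCast_mem _ _) ?_
    split_ifs
    exacts [one_mem _, zero_mem _]
  · intro k
    rw [map_sub, ← PowerSeries.coeff_zero_eq_constantCoeff_apply, PowerSeries.coeff_map,
      PowerSeries.coeff_zero_eq_constantCoeff_apply, hb0]
    simp
  · intro k
    rw [map_sub, hu0, map_one, sub_self]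
  · intro k
    have h1 := hrec k
    simp only [map_add, map_one, map_pow] at h1 ⊢
    linear_combination PowerSeries.C tVar * h1 + (1 - u k) * hCC
  · intro n
    obtain ⟨P, hP⟩ : ∃ P : (LaurentSeries ℚ)[X], ∀ k : ℕ,
        PowerSeries.coeff n (u k) = P.eval (k : LaurentSeries ℚ) := by
      refine ⟨PowerSeries.coeff n (logSubst (C ε) (Fp (X + 1) * G)), fun k => ?_⟩
      have := map_logSubst (evalRingHom (k : LaurentSeries ℚ)) (C ε) (Fp (X + 1) * G)
      rw [coe_evalRingHom, eval_C] at this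
      have h2 := congrArg (PowerSeries.coeff n) this
      rw [PowerSeries.coeff_map, coe_evalRingHom] at h2
      exact h2.symm
    obtain ⟨c, hc⟩ := eval_nat_bounded (P - C (PowerSeries.coeff n 1))
    refine ⟨c, fun k i hi => ?_⟩
    have := hc k i hi
    rwa [eval_sub, eval_C, ← hP, ← map_sub] at this

/-- The expansion at `t = 0` of the coefficients of the product of the two Gaussian integrals is
integral. -/
theorem curveF_prod_integral {d : LaurentSeries ℚ} (hd : d * (tVar⁻¹ - tVar) = 1) (n : ℕ) :
    ∃ s ∈ integralSeries, PowerSeries.coeff n (logSubst 1 (PowerSeries.C d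
      * (curveF tVar d 0 * PowerSeries.rescale (-1) (curveF tVar d 0)))) = tVar * s := by
  have hneg (f : PowerSeries (LaurentSeries ℚ)) :
      logSubst 1 (PowerSeries.rescale (-1) f) = logSubst (-1) f := by
    rw [logSubst_apply, logSubst_apply, PowerSeries.rescale_one]
    rfl
  obtain ⟨v, hv0, hv, h1⟩ := curveF_ratio hd (Or.inl rfl)
  obtain ⟨w, hw0, hw, h2⟩ := curveF_ratio hd (Or.inr rfl)
  have h3 := congrArg (logSubst 1) (curveF_wronsk tVar_ne_zero hd)
  have h4 := congrArg (logSubst (-1)) (curveF_recurrence tVar_ne_zero hd 0)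
  simp only [map_mul, map_sub, logSubst_C, hneg, zero_add, zero_sub, map_zero, zero_mul,
    expSeries_zero, one_mul] at h3 h4
  rw [h2] at h4
  rw [h1] at h3
  rw [map_mul (logSubst 1), map_mul (logSubst 1), logSubst_C, hneg]
  obtain ⟨P, hP⟩ : ∃ P, P = PowerSeries.C d
    * (logSubst 1 (curveF tVar d 0) * logSubst (-1) (curveF tVar d 0)) := ⟨_, rfl⟩
  rw [← hP]
  have hCC : PowerSeries.C tVar * PowerSeries.C tVar⁻¹ = (1 : PowerSeries (LaurentSeries ℚ)) := by
    rw [← map_mul, mul_inv_cancel₀ tVar_ne_zero, map_one]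
  have hd' : PowerSeries.C d * (PowerSeries.C tVar⁻¹ - PowerSeries.C tVar)
      = (1 : PowerSeries (LaurentSeries ℚ)) := by
    rw [← map_sub, ← map_mul, hd, map_one]
  -- Eliminating the integral at κ = -1 between the Wronskian and the recurrence at κ = 0 leaves (1
  -- - t² - t² (v + w)) P = t. Since 1 - t² is invertible over ℤ⟦t⟧ and v, w have no constant term
  -- in Q, the coefficients of P are found recursively.
  have key : P = PowerSeries.C tVar + PowerSeries.C (tVar ^ 2) * P
      + PowerSeries.C (tVar ^ 2) * (P * (v + w)) := by
    simp only [map_add, map_one, map_pow] at h3 h4 ⊢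
    generalize logSubst 1 (curveF tVar d 0) = F at *
    generalize logSubst (-1) (curveF tVar d 0) = F' at *
    generalize logSubst (-1) (curveF tVar d (-1)) = F'' at *
    generalize (PowerSeries.C tVar : PowerSeries (LaurentSeries ℚ)) = t at *
    generalize (PowerSeries.C tVar⁻¹ : PowerSeries (LaurentSeries ℚ)) = t' at *
    generalize (PowerSeries.C d : PowerSeries (LaurentSeries ℚ)) = D at *
    rw [hP]
    linear_combination t * D * h3 + t * D * F * h4 + t * hd' - D * F * F' * hCC
  obtain ⟨i, hi, hi1⟩ := isUnit_one_sub_tVar_sq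
  induction n using Nat.strong_induction_on with
  | _ n ih =>
    have h5 := congrArg (PowerSeries.coeff n) key
    rw [map_add, map_add, PowerSeries.coeff_C_mul, PowerSeries.coeff_C_mul, PowerSeries.coeff_C]
      at h5
    have h6 : ∃ s ∈ integralSeries, PowerSeries.coeff n (P * (v + w)) = tVar * s := by
      choose! s hs hs' using ih
      refine ⟨∑ ij ∈ Finset.HasAntidiagonal.antidiagonal n,
        if ij.2 = 0 then 0 else s ij.1 * (PowerSeries.coeff ij.2 v + PowerSeries.coeff ij.2 w),
        ?_, ?_⟩
      · refine sum_mem fun ij hij => ?_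
        have hij := Finset.HasAntidiagonal.mem_antidiagonal.1 hij
        split_ifs
        · exact zero_mem _
        · exact mul_mem (hs _ (by omega)) (add_mem (hv _) (hw _))
      · rw [PowerSeries.coeff_mul, Finset.mul_sum]
        refine Finset.sum_congr rfl fun ij hij => ?_
        have hij := Finset.HasAntidiagonal.mem_antidiagonal.1 hij
        split_ifs with h0
        · rw [h0, PowerSeries.coeff_zero_eq_constantCoeff_apply (v + w), map_add, hv0, hw0]
          simp
        · rw [hs' _ (by omega), map_add]
          ring
    obtain ⟨s, hs, h6⟩ := h6
    rw [h6] at h5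
    refine ⟨i * ((if n = 0 then 1 else 0) + tVar ^ 2 * s), mul_mem hi (add_mem ?_
      (mul_mem (pow_mem tVar_mem _) hs)), ?_⟩
    · split_ifs
      exacts [one_mem _, zero_mem _]
    · have h7 : (if n = 0 then tVar else 0) = tVar * (if n = 0 then 1 else 0) := by
        split_ifs <;> simp
      rw [h7] at h5
      linear_combination i * h5 - PowerSeries.coeff n P * hi1

end Integrality

end FigureEight

end

noncomputable section

namespace FigureEight

set_option linter.unusedSectionVars false

open Polynomial

/-! ### The symmetry `t ↦ t⁻¹` -/

section Involution

variable {A : Type*} [CommRing A] [Algebra ℚ A]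

/-- The effect on the values of polylogarithms of `y₁ ↦ y₁⁻¹`, `y₂ ↦ y₂⁻¹`. -/
def invPolylog (ℓ : ℕ → A) (m : ℕ) : A := if m = 0 then -2 - ℓ 0 else (-1) ^ (m + 1) * ℓ m

/-- Since ħ = s², the change ħ ↦ -ħ is s ↦ i s, and with v ↦ i v it also sends u = s v to -u. The
resulting signs are those of Li_{-m}(1/z) = (-1)^(m+1) Li_{-m}(z) for m ≥ 1. The exceptional rule
for ℓ 0 is absorbed by the linear term s v / 2 and produces the constant -2 B_2 / 2! = -1/6. -/
theorem gaussExp_invPolylog {i : A} (hi : i ^ 2 = -1) (ℓ : ℕ → A) :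
    gaussExp (invPolylog ℓ)
      = PowerSeries.rescale (C i) (PowerSeries.map (compRingHom (C i * X)) (gaussExp ℓ))
        + PowerSeries.C (C (algebraMap ℚ A (-1 / 6))) * PowerSeries.X ^ 2 := by
  have hi' (k : ℕ) : i ^ (2 * k) = (-1) ^ k := by rw [pow_mul, hi]
  ext m j
  rw [map_add, PowerSeries.coeff_rescale, PowerSeries.coeff_map, coe_compRingHom_apply, coeff_add,
    ← C_pow, coeff_C_mul, comp_C_mul_X_coeff, PowerSeries.coeff_C_mul, coeff_C_mul,
    PowerSeries.coeff_X_pow]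
  rcases eq_or_ne m 0 with rfl | hm
  · simp [constantCoeff_gaussExp]
  rw [coeff_coeff_gaussExp _ hm, coeff_coeff_gaussExp _ hm]
  by_cases h : Even (m + j) ∧ j ≤ m + 2
  · rw [if_pos h, if_pos h]
    obtain ⟨⟨k, hk⟩, hj⟩ := h
    have hr : m - (m + 2 - j) / 2 = k - 1 := by omega
    have hpow : i ^ m * i ^ j = (-1) ^ k := by rw [← pow_add, hk, ← two_mul, hi']
    rw [hr, invPolylog]
    rcases Nat.lt_or_ge 1 k with hk1 | hk1
    · rw [if_neg (by omega), if_neg (show ¬ (m = 1 ∧ j = 1) by omega), show k - 1 + 1 = k by omega]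
      by_cases h2 : m = 2 ∧ j = 0
      · omega
      · have : (if m = 2 then (1 : A[X]) else 0).coeff j = 0 := by
          by_cases h3 : m = 2
          · rw [if_pos h3, coeff_one, if_neg (by omega)]
          · rw [if_neg h3, coeff_zero]
        rw [this]
        linear_combination (-algebraMap ℚ A (bernoulli' ((m + 2 - j) / 2)
          / (((m + 2 - j) / 2).factorial * j.factorial : ℚ)) * ℓ (k - 1)) * hpow
    · have hk2 : k = 1 := by omega
      subst hk2
      rw [if_pos (by omega)]
      have hmj : (m = 1 ∧ j = 1) ∨ (m = 2 ∧ j = 0) := by omega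
      rcases hmj with ⟨rfl, rfl⟩ | ⟨rfl, rfl⟩
      · have hb : algebraMap ℚ A (bernoulli' ((1 + 2 - 1) / 2)
            / (((1 + 2 - 1) / 2).factorial * (1 : ℕ).factorial : ℚ)) = half A := by
          norm_num [half, bernoulli'_one]
        rw [hb]
        simp only [and_self, if_true, show ¬ (1 = 2) by decide, if_false, coeff_zero]
        linear_combination (-(half A * ℓ 0 + half A)) * hpow
      · have hb : algebraMap ℚ A (bernoulli' ((2 + 2 - 0) / 2)
            / (((2 + 2 - 0) / 2).factorial * (0 : ℕ).factorial : ℚ)) * 2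
              = - algebraMap ℚ A (-1 / 6) := by
          rw [← map_ofNat (algebraMap ℚ A) 2, ← map_mul, ← map_neg]
          norm_num [bernoulli'_two]
        simp only [show ¬ (2 = 1 ∧ 0 = 1) by decide, if_true, if_false, coeff_one_zero]
        linear_combination (-1 : A) * hb - algebraMap ℚ A (bernoulli' ((2 + 2 - 0) / 2)
            / (((2 + 2 - 0) / 2).factorial * (0 : ℕ).factorial : ℚ)) * ℓ 0 * hpow
  · rw [if_neg h, if_neg h, if_neg (by rintro ⟨rfl, rfl⟩; exact h ⟨by decide, by omega⟩)]
    have : (if m = 2 then (1 : A[X]) else 0).coeff j = 0 := by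
      split_ifs with h3
      · rw [coeff_one, if_neg]
        rintro rfl
        exact h ⟨by rw [h3]; decide, by omega⟩
      · rw [coeff_zero]
    rw [this]
    simp

theorem gaussAvg_neg {i : A} (hi : i ^ 2 = -1) (d : A) (p : A[X]) :
    gaussAvg (-d) (p.comp (C i * X)) = gaussAvg d p := by
  induction p using Polynomial.induction_on' with
  | add p q hp hq => rw [add_comp, map_add, map_add, hp, hq]
  | monomial n a =>
    rw [monomial_comp, mul_pow, ← C_pow, ← mul_assoc, ← C_mul, C_mul_X_pow_eq_monomial,
      gaussAvg_monomial, gaussAvg_monomial, gaussMoment, gaussMoment]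
    split_ifs with h
    · obtain ⟨k, rfl⟩ := h
      rw [show (k + k) / 2 = k by omega, ← two_mul, pow_mul, hi, neg_pow d]
      have : ((-1 : A) ^ k) * (-1) ^ k = 1 := by rw [← mul_pow]; simp
      linear_combination a * ((2 * k - 1).doubleFactorial : A) * d ^ k * this
    · simp

theorem gaussInt_invPolylog {i : A} (hi : i ^ 2 = -1) (ℓ : ℕ → A) (d : A) :
    gaussInt (invPolylog ℓ) (-d) 0
      = expSeries (PowerSeries.C (algebraMap ℚ A (-1 / 6)) * PowerSeries.X ^ 2)
        * PowerSeries.rescale i (gaussInt ℓ d 0) := by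
  have h0 (ℓ : ℕ → A) : gaussExpLin ℓ 0 = gaussExp ℓ := by simp [gaussExpLin]
  have hc := constantCoeff_gaussExp ℓ
  have hsq {R : Type _} [CommRing R] (a : R) :
      PowerSeries.constantCoeff (PowerSeries.C a * PowerSeries.X ^ 2) = 0 := by simp
  have hc1 : PowerSeries.constantCoeff (PowerSeries.map (compRingHom (C i * X)) (gaussExp ℓ)) = 0 := by
    rw [constantCoeff_map', hc, map_zero]
  have hc2 : PowerSeries.constantCoeff (PowerSeries.rescale (C i)
      (PowerSeries.map (compRingHom (C i * X)) (gaussExp ℓ))) = 0 := by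
    rw [← PowerSeries.coeff_zero_eq_constantCoeff_apply, PowerSeries.coeff_rescale,
      PowerSeries.coeff_zero_eq_constantCoeff_apply, hc1, mul_zero]
  rw [gaussInt, gaussInt, h0, h0, gaussExp_invPolylog hi, expSeries_add hc2 (hsq _),
    ← rescale_expSeries _ hc1, ← map_expSeries _ hc, mul_comm]
  have h1 : expSeries (PowerSeries.C (C (algebraMap ℚ A (-1 / 6))) * PowerSeries.X ^ 2)
      = PowerSeries.map C
        (expSeries (PowerSeries.C (algebraMap ℚ A (-1 / 6)) * PowerSeries.X ^ 2)) := by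
    rw [map_expSeries _ (hsq _), map_mul, map_pow, PowerSeries.map_C, PowerSeries.map_X]
  rw [h1, avgSeries_map_C_mul]
  refine congrArg (HMul.hMul _) ?_
  ext n
  rw [coeff_avgSeries, PowerSeries.coeff_rescale, PowerSeries.coeff_map, ← C_pow, gaussAvg_C_mul,
    coe_compRingHom_apply, gaussAvg_neg hi, PowerSeries.coeff_rescale, coeff_avgSeries]

/-- The inversion z ↦ z⁻¹ acts on z / (1 - z) by p ↦ -1 - p. -/
theorem negPolylogPoly_comp (m : ℕ) : (negPolylogPoly (m + 1)).comp (-1 - X)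
    = (-1) ^ m * negPolylogPoly (m + 1) := by
  induction m with
  | zero => simp [negPolylogPoly]; ring
  | succ m ih =>
    have h := congrArg derivative ih
    have h1 : derivative ((-1 : ℚ[X]) ^ m * negPolylogPoly (m + 1))
        = (-1) ^ m * derivative (negPolylogPoly (m + 1)) := by
      rw [show ((-1 : ℚ[X]) ^ m) = C ((-1) ^ m) by simp, derivative_C_mul]
    rw [derivative_comp, h1] at h
    simp only [derivative_sub, derivative_neg, derivative_one, derivative_X] at h
    rw [negPolylogPoly, mul_comp]
    simp only [add_comp, X_comp, pow_comp]
    rw [pow_succ]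
    linear_combination (-(X + X ^ 2)) * h

theorem polylogPair_inv (p q : A) :
    polylogPair (-1 - p) (-1 - q) = invPolylog (polylogPair p q) := by
  ext m
  rcases m with _ | m
  · rw [invPolylog, if_pos rfl, polylogPair_zero, polylogPair_zero]; ring
  · have h (p : A) : polylogVal (-1 - p) (m + 1) = (-1) ^ m * polylogVal p (m + 1) := by
      have := congrArg (aeval p) (negPolylogPoly_comp m)
      rw [aeval_comp] at this
      simpa [polylogVal] using this
    rw [invPolylog, if_neg (Nat.succ_ne_zero m), polylogPair, polylogPair, h, h]
    ring

theorem evenPart_rescale {i : A} (hi : i ^ 2 = -1) (f : PowerSeries A) :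
    evenPart (PowerSeries.rescale i f) = PowerSeries.rescale (-1) (evenPart f) := by
  ext n
  rw [coeff_evenPart, PowerSeries.coeff_rescale, PowerSeries.coeff_rescale, coeff_evenPart, pow_mul,
    hi]

variable {K : Type*} [Field K] [Algebra ℚ K]

theorem curveF_inv {i : K} (hi : i ^ 2 = -1) {t : K} (ht : t ≠ 0) (d : K) :
    curveF t⁻¹ (-d) 0 = expSeries (PowerSeries.C (algebraMap ℚ K (-1 / 6)) * PowerSeries.X)
      * PowerSeries.rescale (-1) (curveF t d 0) := by
  obtain ⟨p, q, h1, h2, -, -⟩ := exists_roots ht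
  let f := algebraMap K (AlgebraicClosure K)
  refine PowerSeries.map_injective f f.injective ?_
  have h3 : PowerSeries.map f (curveF t d 0) = evenPart (gaussInt (polylogPair p q) (f d) 0) := by
    rw [curveF, map_symF, ← h1, ← h2, symF_add_mul, gaussF, map_zero]
  have h4 : PowerSeries.map f (curveF t⁻¹ (-d) 0)
      = evenPart (gaussInt (polylogPair (-1 - p) (-1 - q)) (-f d) 0) := by
    rw [curveF, map_symF, show f (t⁻¹ - t⁻¹⁻¹ - 1) = (-1 - p) + (-1 - q) by
        rw [show (-1 - p) + (-1 - q) = -1 - 1 - (p + q) by ring, h1, ← map_one f, ← map_neg,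
          ← map_sub, ← map_sub]
        congr 1
        rw [inv_inv]
        ring,
      show f (-t⁻¹) = (-1 - p) * (-1 - q) by
        rw [show (-1 - p) * (-1 - q) = 1 + (p + q) + p * q by ring, h1, h2, ← map_one f,
          ← map_add, ← map_add]
        congr 1; ring,
      symF_add_mul, gaussF, map_zero, map_neg]
  have hfi : f i ^ 2 = -1 := by rw [← map_pow, hi, map_neg, map_one]
  rw [h4, polylogPair_inv, gaussInt_invPolylog hfi, evenPart_expSeries_mul, evenPart_rescale hfi,
    ← h3, map_mul, map_rescale_neg_one, map_expSeries _ (by simp), map_mul, PowerSeries.map_C,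
    PowerSeries.map_X, show f (algebraMap ℚ K (-1 / 6)) = algebraMap ℚ _ (-1 / 6) from
      RingHom.congr_fun (Subsingleton.elim (f.comp (algebraMap ℚ K)) (algebraMap ℚ _)) _]

/-- The product of the two Gaussian integrals, divided by `δ = d⁻¹`. -/
def curveProd {A : Type*} [CommRing A] [Algebra ℚ A] (e₁ e₂ d : A) : PowerSeries A :=
  logSubst 1 (PowerSeries.C d * (symF e₁ e₂ d 0 * PowerSeries.rescale (-1) (symF e₁ e₂ d 0)))

/-- By `curveF_inv` the involution exchanges the two factors of the product up to e^(-ħ/6) and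
e^(ħ/6), which cancel. Only the sign of d remains. -/
theorem curveProd_inv {i : K} (hi : i ^ 2 = -1) {t : K} (ht : t ≠ 0) (d : K) :
    curveProd (t⁻¹ - t - 1) (-t⁻¹) (-d) = -curveProd (t - t⁻¹ - 1) (-t) d := by
  have h := curveF_inv hi ht d
  rw [curveF, curveF, inv_inv] at h
  have h0 : PowerSeries.constantCoeff
      (PowerSeries.C (algebraMap ℚ K (-1 / 6)) * PowerSeries.X : PowerSeries K) = 0 := by simp
  have h1 : PowerSeries.rescale (-1) (PowerSeries.C (algebraMap ℚ K (-1 / 6)) * PowerSeries.X)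
      = -(PowerSeries.C (algebraMap ℚ K (-1 / 6)) * PowerSeries.X) := by
    rw [map_mul, rescale_C, PowerSeries.rescale_X]
    simp
  have h2 (f : PowerSeries K) : PowerSeries.rescale (-1) (PowerSeries.rescale (-1) f) = f := by
    rw [PowerSeries.rescale_rescale]; simp
  rw [curveProd, curveProd, h, map_mul (PowerSeries.rescale (-1)), rescale_expSeries _ h0, h1, h2,
    ← map_neg]
  refine congrArg (logSubst 1) ?_
  rw [map_neg]
  linear_combination (-PowerSeries.C d * (symF (t - t⁻¹ - 1) (-t) d 0
    * PowerSeries.rescale (-1) (symF (t - t⁻¹ - 1) (-t) d 0))) * expSeries_mul_neg h0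

end Involution

end FigureEight

end

noncomputable section

namespace FigureEight

set_option linter.unusedSectionVars false

open Polynomial

/-! ### Degree bounds and descent to the ring of functions of `x + x⁻¹` -/

section Degree

variable {A B : Type*} [CommRing A] [Algebra ℚ A] [CommRing B] [Algebra ℚ B]

/-- A monomial s^m v^j of the exponent has m ≥ 1 and j ≤ m + 2 ≤ 3 m. As v^(2j) averages to a
multiple of d^j, the coefficient of ħ^n = s^(2n) will have degree at most 3 n in d. -/
theorem natDegree_coeff_gaussExpLin_le (ℓ : ℕ → A) (m : ℕ) :
    (PowerSeries.coeff m (gaussExpLin ℓ 0)).natDegree ≤ 3 * m := by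
  rw [natDegree_le_iff_coeff_eq_zero]
  intro j hj
  rw [coeff_coeff_gaussExpLin]
  rcases eq_or_ne m 0 with rfl | hm
  · simp [constantCoeff_gaussExp]
  · rw [coeff_coeff_gaussExp _ hm, if_neg (by omega), if_neg (by omega)]
    simp

theorem natDegree_coeff_expSeries_le {g : PowerSeries A[X]} (h0 : PowerSeries.constantCoeff g = 0)
    {c : ℕ} (hg : ∀ m, (PowerSeries.coeff m g).natDegree ≤ c * m) (m : ℕ) :
    (PowerSeries.coeff m (expSeries g)).natDegree ≤ c * m := by
  induction m using Nat.strong_induction_on with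
  | _ m ih =>
    rcases m with _ | m
    · rw [PowerSeries.coeff_zero_eq_constantCoeff_apply, constantCoeff_expSeries h0]
      simp
    · have h := congrArg (PowerSeries.coeff m) (derivative_expSeries h0)
      rw [PowerSeries.coeff_derivative] at h
      have h1 : PowerSeries.coeff (m + 1) (expSeries g) = C (algebraMap ℚ A (1 / (m + 1)))
          * PowerSeries.coeff m (PowerSeries.derivative A[X] g * expSeries g) := by
        rw [← h]
        have : C (algebraMap ℚ A (1 / (m + 1))) * ((m : A[X]) + 1) = 1 := by
          have h2 : ((m : A[X]) + 1) = C (algebraMap ℚ A ((m : ℚ) + 1)) := by simp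
          rw [h2, ← C_mul, ← map_mul, one_div, inv_mul_cancel₀ (by positivity), map_one, C_1]
        linear_combination (-PowerSeries.coeff (m + 1) (expSeries g)) * this
      rw [h1]
      refine (natDegree_C_mul_le _ _).trans ?_
      rw [PowerSeries.coeff_mul]
      refine natDegree_sum_le_of_forall_le _ _ fun ij hij => ?_
      have hij := Finset.HasAntidiagonal.mem_antidiagonal.1 hij
      rw [PowerSeries.coeff_derivative]
      have h3 : ((ij.1 : A[X]) + 1).natDegree ≤ 0 := by
        rw [← Nat.cast_succ]
        exact (natDegree_natCast _).le
      have := natDegree_mul_le_of_le (natDegree_mul_le_of_le (hg (ij.1 + 1)) h3)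
        (ih ij.2 (by omega))
      refine this.trans (le_of_eq ?_)
      rw [← hij]
      ring

theorem natDegree_gaussAvg_X_le (p : A[X]) {n : ℕ} (hp : p.natDegree ≤ 2 * n) :
    (gaussAvg X (p.map C)).natDegree ≤ n := by
  rw [p.as_sum_range' (2 * n + 1) (by omega), Polynomial.map_sum, map_sum]
  refine natDegree_sum_le_of_forall_le _ _ fun j hj => ?_
  rw [Finset.mem_range] at hj
  rw [map_monomial, gaussAvg_monomial]
  refine (natDegree_C_mul_le _ _).trans ?_
  rw [gaussMoment]
  split_ifs
  · refine (natDegree_mul_le_of_le (natDegree_natCast _).le (natDegree_X_pow_le _)).trans ?_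
    omega
  · simp

/-- The Gaussian integral as a polynomial in the variance. -/
def gaussPoly (ℓ : ℕ → A) : PowerSeries A[X] :=
  evenPart (avgSeries X (PowerSeries.map (mapRingHom C) (expSeries (gaussExpLin ℓ 0))))

theorem natDegree_coeff_gaussPoly_le (ℓ : ℕ → A) (n : ℕ) :
    (PowerSeries.coeff n (gaussPoly ℓ)).natDegree ≤ 3 * n := by
  rw [gaussPoly, coeff_evenPart, coeff_avgSeries, PowerSeries.coeff_map, coe_mapRingHom]
  refine natDegree_gaussAvg_X_le _ ?_
  have := natDegree_coeff_expSeries_le (constantCoeff_gaussExpLin ℓ 0)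
    (natDegree_coeff_gaussExpLin_le ℓ) (2 * n)
  omega

theorem map_gaussPoly (g : A →+* B) (d : B) (ℓ : ℕ → A) :
    PowerSeries.map (eval₂RingHom g d) (gaussPoly ℓ)
      = evenPart (gaussInt (fun m => g (ℓ m)) d 0) := by
  rw [gaussPoly, map_evenPart, gaussInt]
  have h1 := map_gaussExpLin g ℓ 0
  rw [map_zero] at h1
  rw [← h1, ← map_expSeries _ (constantCoeff_gaussExpLin ℓ 0)]
  refine congrArg evenPart ?_
  ext n
  rw [PowerSeries.coeff_map, coeff_avgSeries, coeff_avgSeries, map_gaussAvg, PowerSeries.coeff_map,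
    PowerSeries.coeff_map, coe_eval₂RingHom, eval₂_X, coe_mapRingHom, coe_mapRingHom,
    Polynomial.map_map]
  congr 2
  ext a
  simp

theorem natDegree_coeff_mul_le {f g : PowerSeries A[X]} {c a b : ℕ}
    (hf : ∀ n, (PowerSeries.coeff n f).natDegree ≤ c * n + a)
    (hg : ∀ n, (PowerSeries.coeff n g).natDegree ≤ c * n + b) (n : ℕ) :
    (PowerSeries.coeff n (f * g)).natDegree ≤ c * n + (a + b) := by
  rw [PowerSeries.coeff_mul]
  refine natDegree_sum_le_of_forall_le _ _ fun ij hij => ?_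
  have hij := Finset.HasAntidiagonal.mem_antidiagonal.1 hij
  refine (natDegree_mul_le_of_le (hf _) (hg _)).trans (le_of_eq ?_)
  rw [← hij]
  ring

theorem natDegree_coeff_logSubst_le {f : PowerSeries A[X]} {c a : ℕ}
    (hf : ∀ n, (PowerSeries.coeff n f).natDegree ≤ c * n + a) (n : ℕ) :
    (PowerSeries.coeff n (logSubst 1 f)).natDegree ≤ c * n + a := by
  rw [logSubst_apply, PowerSeries.rescale_one, RingHom.id_apply,
    PowerSeries.coeff_subst' PowerSeries.HasSubst.log]
  refine finsum_induction (fun p : A[X] => p.natDegree ≤ c * n + a) (by simp)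
    (fun p q hp hq => natDegree_add_le_of_degree_le hp hq) fun i => ?_
  rcases le_or_gt i n with hi | hi
  · have h1 : PowerSeries.coeff n (PowerSeries.log A[X] ^ i)
        = C (PowerSeries.coeff n (PowerSeries.log A ^ i)) := by
      rw [← PowerSeries.map_log (C : A →+* A[X]), ← map_pow, PowerSeries.coeff_map]
    rw [h1, smul_eq_mul, mul_comm]
    refine (natDegree_C_mul_le _ _).trans ((hf i).trans ?_)
    gcongr
  · have h1 : PowerSeries.coeff n (PowerSeries.log A[X] ^ i) = 0 :=
      PowerSeries.coeff_of_lt_order _ (lt_of_lt_of_le (by exact_mod_cast hi)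
        (PowerSeries.le_order_pow_of_constantCoeff_eq_zero i PowerSeries.constantCoeff_log))
    rw [h1, smul_zero]
    simp

/-- The series `curveProd` as a polynomial in `d`. -/
def curveProdPoly (e₁ e₂ : A) : PowerSeries A[X] :=
  logSubst 1 (PowerSeries.C X * (gaussPoly (polylogSym e₁ e₂)
    * PowerSeries.rescale (-1) (gaussPoly (polylogSym e₁ e₂))))

theorem natDegree_coeff_curveProdPoly_le (e₁ e₂ : A) (n : ℕ) :
    (PowerSeries.coeff n (curveProdPoly e₁ e₂)).natDegree ≤ 3 * n + 1 := by
  refine natDegree_coeff_logSubst_le (fun n => ?_) n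
  have h1 (n : ℕ) := natDegree_coeff_gaussPoly_le (polylogSym e₁ e₂) n
  rw [PowerSeries.coeff_C_mul]
  refine (natDegree_mul_le_of_le natDegree_X_le (natDegree_coeff_mul_le (c := 3) (a := 0) (b := 0)
    h1 (fun n => ?_) n)).trans (by omega)
  rw [PowerSeries.coeff_rescale]
  have h2 : ((-1 : A[X]) ^ n) = C ((-1) ^ n) := by simp
  rw [h2]
  exact (natDegree_C_mul_le _ _).trans (h1 n)

theorem map_curveProdPoly (g : A →+* B) (d : B) (e₁ e₂ : A) :
    PowerSeries.map (eval₂RingHom g d) (curveProdPoly e₁ e₂) = curveProd (g e₁) (g e₂) d := by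
  rw [curveProdPoly, curveProd, map_logSubst,
    map_mul (PowerSeries.map _), map_mul (PowerSeries.map _), map_rescale_neg_one, map_gaussPoly,
    PowerSeries.map_C, map_one, coe_eval₂RingHom, eval₂_X, symF]
  have : (fun m => g (polylogSym e₁ e₂ m)) = polylogSym (g e₁) (g e₂) := by
    ext m; exact map_polylogSym g _ _ m
  rw [this]

/-- Multiplication by δ^m clears the powers of d = δ⁻¹. The element L lies in A itself and serves
all specialisations g at once, so no localization of A is needed. -/
theorem exists_homogenization (P : A[X]) (δ : A) {m : ℕ} (hm : P.natDegree ≤ m) :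
    ∃ L : A, ∀ {B : Type} [CommRing B] (g : A →+* B) (d : B), d * g δ = 1 →
      g L = g δ ^ m * P.eval₂ g d := by
  refine ⟨∑ j ∈ Finset.range (m + 1), P.coeff j * δ ^ (m - j), fun g d hd => ?_⟩
  rw [eval₂_eq_sum_range' g (Nat.lt_succ_of_le hm), map_sum, Finset.mul_sum]
  refine Finset.sum_congr rfl fun j hj => ?_
  rw [Finset.mem_range] at hj
  have h1 : g δ ^ m = g δ ^ (m - j) * g δ ^ j := by rw [← pow_add]; congr 1; omega
  have h2 : g δ ^ j * d ^ j = 1 := by rw [← mul_pow, mul_comm, hd, one_pow]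
  rw [h1, map_mul, map_pow]
  linear_combination (-(g δ ^ (m - j) * g (P.coeff j))) * h2

end Degree

/-! ### Symmetric Laurent polynomials in t -/

section Laurent

-- L is half of L + `invert` L, and T^n + T^(-n) is a polynomial in T + T⁻¹ by the Chebyshev
-- recursion. The summand 1 matches x + x⁻¹ = t + t⁻¹ + 1.
open LaurentPolynomial in
theorem exists_polynomial_of_invert_eq {L : LaurentPolynomial ℚ} (h : invert L = L) :
    ∃ f : ℚ[X], L = aeval (T 1 + T (-1) + 1 : LaurentPolynomial ℚ) f := by
  let R := (aeval (T 1 + T (-1) + 1 : LaurentPolynomial ℚ) : ℚ[X] →ₐ[ℚ] _).range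
  have hX : (T 1 + T (-1) : LaurentPolynomial ℚ) ∈ R :=
    ⟨X - 1, by simp⟩
  have hT (n : ℕ) : (T n + T (-n) : LaurentPolynomial ℚ) ∈ R := by
    induction n using Nat.twoStepInduction with
    | zero =>
      simp only [Nat.cast_zero, neg_zero, T_zero]
      exact add_mem (one_mem _) (one_mem _)
    | one => simpa using hX
    | more n ih1 ih2 =>
      have : (T ((n + 2 : ℕ) : ℤ) + T (-((n + 2 : ℕ) : ℤ)) : LaurentPolynomial ℚ)
          = (T 1 + T (-1)) * (T ((n + 1 : ℕ) : ℤ) + T (-((n + 1 : ℕ) : ℤ)))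
            - (T (n : ℤ) + T (-(n : ℤ))) := by
        simp only [add_mul, mul_add, ← T_add]
        push_cast
        ring_nf
      rw [this]
      exact sub_mem (mul_mem hX ih2) ih1
  have hL (L : LaurentPolynomial ℚ) : L + invert L ∈ R := by
    induction L using LaurentPolynomial.induction_on' with
    | add p q hp hq =>
      rw [map_add]
      convert add_mem hp hq using 1
      ring
    | C_mul_T n a =>
      rw [map_mul, invert_C, invert_T, ← mul_add]
      have hn : (T n + T (-n) : LaurentPolynomial ℚ) ∈ R := by
        rcases Int.eq_nat_or_neg n with ⟨k, rfl | rfl⟩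
        · exact hT k
        · rw [neg_neg, add_comm]; exact hT k
      rw [← LaurentPolynomial.smul_eq_C_mul]
      exact R.smul_mem hn a
  have h2 := hL L
  rw [h] at h2
  have h3 : L = (1 / 2 : ℚ) • (L + L) := by
    rw [← two_smul ℚ L, smul_smul]; norm_num
  obtain ⟨f, hf⟩ := R.smul_mem h2 (1 / 2)
  exact ⟨f, h3.trans hf.symm⟩

-- The degree in d is at most 3 n + 1, so δ^(4n+1) clears the denominators. Its exponent is odd for
-- every n, so the sign of δ under t ↦ t⁻¹ cancels that of `curveProd_inv` and the Laurent
-- polynomial is symmetric. The symmetry is checked at complex values of t, where a square root of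
-- -1 is available.
open LaurentPolynomial in
theorem exists_curveProd_eq (n : ℕ) : ∃ f : ℚ[X], ∀ {B : Type} [CommRing B] [Algebra ℚ B]
    (t : Bˣ) (d : B), d * (((t⁻¹ : Bˣ) : B) - t) = 1 →
      aeval ((t : B) + ((t⁻¹ : Bˣ) : B) + 1) f = (((t⁻¹ : Bˣ) : B) - t) ^ (4 * n + 1)
        * PowerSeries.coeff n (curveProd ((t : B) - ((t⁻¹ : Bˣ) : B) - 1) (-t) d) := by
  obtain ⟨P, hP⟩ : ∃ P : (LaurentPolynomial ℚ)[X], P = PowerSeries.coeff n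
      (curveProdPoly (T 1 - T (-1) - 1 : LaurentPolynomial ℚ) (-T 1)) := ⟨_, rfl⟩
  have hPdeg : P.natDegree ≤ 4 * n + 1 := by
    rw [hP]
    exact (natDegree_coeff_curveProdPoly_le _ _ n).trans (by omega)
  obtain ⟨L, hL⟩ := exists_homogenization P (T (-1) - T 1) hPdeg
  have hev {B : Type} [CommRing B] [Algebra ℚ B] (t : Bˣ) (d : B)
      (hd : d * (((t⁻¹ : Bˣ) : B) - t) = 1) :
      LaurentPolynomial.eval₂ (algebraMap ℚ B) t L = (((t⁻¹ : Bˣ) : B) - t) ^ (4 * n + 1)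
        * PowerSeries.coeff n (curveProd ((t : B) - ((t⁻¹ : Bˣ) : B) - 1) (-t) d) := by
    have h1 := hL (LaurentPolynomial.eval₂ (algebraMap ℚ B) t) d (by
      rw [map_sub, eval₂_T, eval₂_T]; simpa using hd)
    rw [h1]
    have h2 := congrArg (PowerSeries.coeff n) (map_curveProdPoly
      (LaurentPolynomial.eval₂ (algebraMap ℚ B) t) d (T 1 - T (-1) - 1) (-T 1))
    rw [PowerSeries.coeff_map, ← hP, coe_eval₂RingHom] at h2
    rw [h2]
    simp only [map_sub, map_neg, eval₂_T, map_one]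
    simp
  have hcomp (t : ℂˣ) : LaurentPolynomial.eval₂ (algebraMap ℚ ℂ) t (invert L)
      = LaurentPolynomial.eval₂ (algebraMap ℚ ℂ) t⁻¹ L := by
    clear hL hev
    induction L using LaurentPolynomial.induction_on' with
    | add p q hp hq => rw [map_add, map_add, map_add, hp, hq]
    | C_mul_T n a => rw [map_mul, invert_C, invert_T, eval₂_C_mul_T, eval₂_C_mul_T, inv_zpow']
  have hroot (t : ℂˣ) (ht : ((t⁻¹ : ℂˣ) : ℂ) - t ≠ 0) :
      LaurentPolynomial.eval₂ (algebraMap ℚ ℂ) t (invert L - L) = 0 := by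
    have h1 := hev t (((t⁻¹ : ℂˣ) : ℂ) - t)⁻¹ (inv_mul_cancel₀ ht)
    have h2 := hev t⁻¹ (-(((t⁻¹ : ℂˣ) : ℂ) - t)⁻¹) (by
      rw [inv_inv, neg_mul, ← mul_neg, neg_sub, inv_mul_cancel₀ ht])
    have h3 := curveProd_inv (i := Complex.I) Complex.I_sq t.ne_zero (((t⁻¹ : ℂˣ) : ℂ) - t)⁻¹
    simp only [inv_inv, Units.val_inv_eq_inv_val] at h1 h2 h3
    rw [map_sub, hcomp, h1, h2, h3, map_neg]
    have h4 : ((t : ℂ) - (t : ℂ)⁻¹) ^ (4 * n + 1) = -((t : ℂ)⁻¹ - t) ^ (4 * n + 1) := by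
      rw [← neg_sub, Odd.neg_pow ⟨2 * n, by ring⟩]
    rw [h4]
    ring
  have hinv : invert L = L := by
    obtain ⟨m, f, hf⟩ := exists_T_pow (invert L - L)
    have hf0 : f = 0 := by
      rw [← Polynomial.map_eq_zero (algebraMap ℚ ℂ)]
      -- The points t = k + 2 avoid 0 and the zeros ±1 of t⁻¹ - t.
      refine Polynomial.eq_zero_of_infinite_isRoot _ ((Set.infinite_range_of_injective
        (f := fun k : ℕ => ((k + 2 : ℕ) : ℂ)) fun a b hab => by simpa using hab).mono ?_)
      rintro _ ⟨k, rfl⟩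
      have hk : ((k + 2 : ℕ) : ℂ) ≠ 0 := by exact_mod_cast Nat.succ_ne_zero (k + 1)
      have h1 := hroot (Units.mk0 _ hk) (by
        rw [Units.val_inv_eq_inv_val, Units.val_mk0, sub_ne_zero]
        intro h
        have h5 : ((k + 2 : ℕ) : ℂ) * ((k + 2 : ℕ) : ℂ) = 1 := by
          nth_rewrite 1 [← h]
          exact inv_mul_cancel₀ hk
        norm_cast at h5
        have := Nat.eq_one_of_mul_eq_one_right h5
        omega)
      have h2 := congrArg (LaurentPolynomial.eval₂ (algebraMap ℚ ℂ) (Units.mk0 _ hk)) hf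
      rw [map_mul, h1, zero_mul, eval₂_toLaurent, Units.val_mk0] at h2
      change Polynomial.eval _ _ = 0
      rw [eval_map]
      exact h2
    rw [hf0, map_zero] at hf
    have := (isUnit_T (R := ℚ) m).mul_left_eq_zero.1 hf.symm
    exact sub_eq_zero.1 this
  obtain ⟨f, hf⟩ := exists_polynomial_of_invert_eq hinv
  refine ⟨f, fun {B} _ _ t d hd => ?_⟩
  rw [← hev t d hd, hf]
  have h := Polynomial.aeval_algHom_apply
    (LaurentPolynomial.eval₂ (algebraMap ℚ B) t).toRatAlgHom (T 1 + T (-1) + 1) f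
  rw [RingHom.toRatAlgHom_apply, RingHom.toRatAlgHom_apply, map_add, map_add, eval₂_T, eval₂_T,
    map_one] at h
  simpa using h

end Laurent

end FigureEight

end

noncomputable section

namespace FigureEight

set_option linter.unusedSectionVars false

open Polynomial

/-! ### Integrality of the polynomials in x + x⁻¹ -/

section IntegralPolynomial

/-- The function `x + x⁻¹ = t + t⁻¹ + 1` expanded at `t = 0`. -/
def uVar : LaurentSeries ℚ := tVar + tVar⁻¹ + 1

theorem tVar_mul_uVar : tVar * uVar = 1 + tVar + tVar ^ 2 := by
  rw [uVar]
  linear_combination mul_inv_cancel₀ tVar_ne_zero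

theorem tVar_mul_uVar_pow (i : ℕ) : tVar ^ i * uVar ^ i = (HahnSeries.ofPowerSeries ℤ ℚ)
    ((1 + PowerSeries.X + PowerSeries.X ^ 2) ^ i) := by
  rw [← mul_pow, tVar_mul_uVar, map_pow]
  congr 1
  simp [tVar]

theorem coeff_uVar_pow (i n : ℕ) (h : i ≤ n) :
    (uVar ^ i).coeff (-(n : ℤ)) = if i = n then 1 else 0 := by
  have h1 : (uVar ^ i).coeff (-(n : ℤ)) = (tVar ^ i * uVar ^ i).coeff (-(n : ℤ) + i) := by
    rw [coeff_tVar_pow_mul]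
    congr 1
    ring
  rw [h1, tVar_mul_uVar_pow, PowerSeries.coeff_coe]
  split_ifs with h2 h3 h3
  · omega
  · rfl
  · subst h3
    simp
  · omega

theorem coeff_rat_smul (r : ℚ) (f : LaurentSeries ℚ) (n : ℤ) :
    (algebraMap ℚ (LaurentSeries ℚ) r * f).coeff n = r * f.coeff n := by
  have : algebraMap ℚ (LaurentSeries ℚ) r = HahnSeries.C r :=
    RingHom.congr_fun (RingHom.ext_rat _ _) r
  rw [this, HahnSeries.C_mul_eq_smul, HahnSeries.coeff_smul, smul_eq_mul]

theorem coeff_aeval_uVar {f : ℚ[X]} {n : ℕ} (hf : f.natDegree ≤ n) (m : ℕ) :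
    (tVar ^ m * aeval uVar f).coeff (m - n) = f.coeff n := by
  rw [coeff_tVar_pow_mul, aeval_eq_sum_range' (Nat.lt_succ_of_le hf), HahnSeries.coeff_sum,
    show (m : ℤ) - n - m = -(n : ℤ) by ring]
  rw [Finset.sum_eq_single n]
  · rw [Algebra.smul_def, coeff_rat_smul, coeff_uVar_pow _ _ le_rfl]
    simp
  · intro i hi hin
    rw [Finset.mem_range] at hi
    rw [Algebra.smul_def, coeff_rat_smul, coeff_uVar_pow _ _ (by omega), if_neg hin, mul_zero]
  · intro h
    simp at h

/-- Because ξ^n begins with t^(-n), the top coefficient of f is the coefficient of t^(m - n) in an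
integral series: it is an integer, and zero if n > m. Subtracting the leading term lowers the
degree. -/
theorem exists_int_polynomial {m n : ℕ} {f : ℚ[X]} (hf : f.natDegree ≤ n)
    (hI : tVar ^ m * aeval uVar f ∈ integralSeries) :
    ∃ g : ℤ[X], g.natDegree ≤ m ∧ f = g.map (Int.castRingHom ℚ) := by
  induction n generalizing f with
  | zero =>
    obtain ⟨z, hz⟩ := (mem_integralSeries.1 hI).2 m
    have h := coeff_aeval_uVar hf m
    rw [Nat.cast_zero, sub_zero, hz] at h
    refine ⟨C z, by simp, ?_⟩
    rw [eq_C_of_natDegree_le_zero hf, ← h]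
    simp
  | succ n ih =>
    have h := coeff_aeval_uVar hf m
    rcases le_or_gt (n + 1) m with hm | hm
    · obtain ⟨z, hz⟩ := (mem_integralSeries.1 hI).2 (m - (n + 1 : ℕ))
      rw [hz] at h
      have hI' : tVar ^ m * aeval uVar (f - C (z : ℚ) * X ^ (n + 1)) ∈ integralSeries := by
        rw [map_sub, mul_sub]
        refine sub_mem hI ?_
        have : tVar ^ m * aeval uVar (C (z : ℚ) * X ^ (n + 1) : ℚ[X])
            = (z : LaurentSeries ℚ) * tVar ^ (m - (n + 1)) * (1 + tVar + tVar ^ 2) ^ (n + 1) := by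
          rw [← tVar_mul_uVar, mul_pow, show m = m - (n + 1) + (n + 1) by omega, pow_add,
            Nat.add_sub_cancel]
          simp
          ring
        rw [this]
        exact mul_mem (mul_mem (intCast_mem _ _) (pow_mem tVar_mem _))
          (pow_mem (add_mem (add_mem (one_mem _) tVar_mem) (pow_mem tVar_mem _)) _)
      obtain ⟨g, hg, hgf⟩ := ih (f := f - C (z : ℚ) * X ^ (n + 1)) (by
        rw [natDegree_le_iff_coeff_eq_zero]
        intro k hk
        rw [coeff_sub, coeff_C_mul_X_pow]
        split_ifs with hkn
        · rw [hkn, ← h, sub_self]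
        · rw [coeff_eq_zero_of_natDegree_lt (by omega), sub_zero]) hI'
      refine ⟨g + C z * X ^ (n + 1), ?_, ?_⟩
      · exact natDegree_add_le_of_degree_le hg ((natDegree_C_mul_X_pow_le _ _).trans hm)
      · rw [Polynomial.map_add, ← hgf]
        simp
    · rw [(mem_integralSeries.1 hI).1 _ (by omega)] at h
      refine ih ?_ hI
      rw [natDegree_le_iff_coeff_eq_zero]
      intro k hk
      rcases Nat.eq_or_lt_of_le (Nat.succ_le_of_lt hk) with rfl | hk
      · exact h.symm
      · exact coeff_eq_zero_of_natDegree_lt (by omega)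

/-- The expansion of f at t = 0 is δ^(4n+1) t s with s integral, and t^(4n) times it is (1 -
t²)^(4n+1) s. This gives both integrality and the degree bound. -/
theorem exists_int_curveProd_eq (n : ℕ) : ∃ f : ℤ[X], f.natDegree ≤ 4 * n ∧
    ∀ {B : Type} [CommRing B] [Algebra ℚ B] (t : Bˣ) (d : B), d * (((t⁻¹ : Bˣ) : B) - t) = 1 →
      aeval ((t : B) + ((t⁻¹ : Bˣ) : B) + 1) (f.map (Int.castRingHom ℚ)) = (((t⁻¹ : Bˣ) : B) - t) ^ (4 * n + 1)
        * PowerSeries.coeff n (curveProd ((t : B) - ((t⁻¹ : Bˣ) : B) - 1) (-t) d) := by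
  obtain ⟨f, hf⟩ := exists_curveProd_eq n
  have ht2 : tVar⁻¹ - tVar ≠ 0 := by
    intro h
    obtain ⟨i, -, hi⟩ := isUnit_one_sub_tVar_sq
    have : (1 : LaurentSeries ℚ) - tVar ^ 2 = tVar * (tVar⁻¹ - tVar) := by
      linear_combination (-1 : LaurentSeries ℚ) * mul_inv_cancel₀ tVar_ne_zero
    rw [this, h, mul_zero, mul_zero] at hi
    exact zero_ne_one hi
  have h1 := hf (Units.mk0 tVar tVar_ne_zero) (tVar⁻¹ - tVar)⁻¹ (by
    simpa using inv_mul_cancel₀ ht2)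
  obtain ⟨s, hs, h2⟩ := curveF_prod_integral (inv_mul_cancel₀ ht2) n
  simp only [Units.val_inv_eq_inv_val, Units.val_mk0] at h1
  rw [curveF] at h2
  rw [curveProd, h2] at h1
  obtain ⟨g, hg, hgf⟩ := exists_int_polynomial (m := 4 * n) (f := f) le_rfl (by
    rw [uVar, h1]
    have : tVar ^ (4 * n) * ((tVar⁻¹ - tVar) ^ (4 * n + 1) * (tVar * s))
        = (1 - tVar ^ 2) ^ (4 * n + 1) * s := by
      have h3 : (1 : LaurentSeries ℚ) - tVar ^ 2 = tVar * (tVar⁻¹ - tVar) := by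
        linear_combination (-1 : LaurentSeries ℚ) * mul_inv_cancel₀ tVar_ne_zero
      rw [h3, mul_pow, pow_succ tVar]
      ring
    rw [this]
    exact mul_mem (pow_mem (sub_mem (one_mem _) (pow_mem tVar_mem _)) _) hs)
  refine ⟨g, hg, fun t d hd => ?_⟩
  rw [← hf t d hd, hgf]

end IntegralPolynomial

/-! ### The coefficients of the series on the curve -/

section Curve

theorem x_mul_inv : x * inv x = 1 := Ring.mul_inverse_cancel _ isUnit_x

theorem xy_mul_inv : x * y * inv (x * y) = 1 := Ring.mul_inverse_cancel _ isUnit_xy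

theorem inv_δ_mul : inv δ * δ = 1 := Ring.inverse_mul_cancel _ isUnit_δ

theorem δ_eq : δ = inv (x * y) - x * y := by
  unfold δ
  linear_combination (-(x * y)) * xy_mul_inv

theorem xy_add_inv : x * y + inv (x * y) + 1 = x + inv x := by
  have h : x * (x * y) * (x * y + inv (x * y)) = x * (x * y) * (x + inv x - 1) := by
    linear_combination x * curve_eq + x * xy_mul_inv - (x * y) * x_mul_inv
  linear_combination (isUnit_x.mul isUnit_xy).mul_left_cancel h

theorem gaussAverage_eq (p : CoordRing[X]) : gaussAverage p = gaussAvg (inv δ) p := by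
  rw [gaussAverage, gaussAvg_apply, Polynomial.sum, Polynomial.sum]
  refine Finset.sum_congr rfl fun j _ => ?_
  rw [gaussMoment]
  split_ifs
  · ring
  · rw [mul_zero]

theorem gaussIntegral_eq : gaussIntegral = symF (x * y - inv (x * y) - 1) (-(x * y)) (inv δ) 0 := by
  obtain ⟨p, hp⟩ : ∃ p, p = y * inv (1 - y) := ⟨_, rfl⟩
  obtain ⟨q, hq⟩ : ∃ q, q = x ^ 2 * y * inv (1 - x ^ 2 * y) := ⟨_, rfl⟩
  have h1 : (1 - y) * inv (1 - y) = 1 := Ring.mul_inverse_cancel _ isUnit_one_sub_y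
  have h2 : (1 - x ^ 2 * y) * inv (1 - x ^ 2 * y) = 1 :=
    Ring.mul_inverse_cancel _ isUnit_one_sub_xxy
  have hadd : p + q = x * y - inv (x * y) - 1 := by
    have := hessian_eq
    simp only [negPolylog, negPolylogPoly, aeval_X] at this
    rw [hp, hq]
    linear_combination this - δ_eq
  have hmul : p * q = -(x * y) := by
    rw [hp, hq]
    apply isUnit_one_sub_mul.mul_left_cancel
    linear_combination x ^ 2 * y ^ 2 * (1 - x ^ 2 * y) * inv (1 - x ^ 2 * y) * h1
      + x ^ 2 * y ^ 2 * h2 + x * y * curve_eq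
  have hg : gaussExponent = gaussExpLin (polylogPair p q) 0 := by
    rw [gaussExpLin, map_zero, map_zero, zero_mul, add_zero, hp, hq]
    rfl
  rw [← hadd, ← hmul, symF_add_mul, gaussF]
  ext n
  rw [gaussIntegral, PowerSeries.coeff_mk, gaussAverage_eq, coeff_evenPart, gaussInt,
    coeff_avgSeries, hg, expSeries]

theorem rescale_exp_eq {A : Type*} [CommRing A] [Algebra ℚ A] (a : A) :
    PowerSeries.rescale a (PowerSeries.exp A) = expSeries (PowerSeries.C a * PowerSeries.X) := by
  refine eq_expSeries (by simp) ?_ ?_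
  · rw [derivative_rescale, PowerSeries.derivative_exp, derivative_mul', PowerSeries.derivative_C,
      PowerSeries.derivative_X]
    ring
  · rw [← PowerSeries.coeff_zero_eq_constantCoeff_apply, PowerSeries.coeff_rescale]
    simp

/-- The factors e^(ħ/12) and e^(-ħ/12) cancel in the product. -/
theorem fSym_eq : fSym = curveProd (x * y - inv (x * y) - 1) (-(x * y)) (inv δ) := by
  rw [curveProd, logSubst_apply, PowerSeries.rescale_one, RingHom.id_apply, fSym]
  refine congrArg (PowerSeries.subst (PowerSeries.log CoordRing)) ?_
  rw [fSymHbar, fSeries, rescale_exp_eq, ← gaussIntegral_eq]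
  obtain ⟨c, hc⟩ : ∃ c, c = algebraMap ℚ CoordRing (1 / 12) := ⟨_, rfl⟩
  rw [← hc]
  have h0 : PowerSeries.constantCoeff (PowerSeries.C c * PowerSeries.X : PowerSeries CoordRing) = 0 := by
    simp
  have h1 : PowerSeries.rescale (-1) (PowerSeries.C c * PowerSeries.X : PowerSeries CoordRing)
      = -(PowerSeries.C c * PowerSeries.X) := by
    rw [map_mul, rescale_C, PowerSeries.rescale_X]
    simp
  rw [map_mul (PowerSeries.rescale (-1)), rescale_expSeries _ h0, h1]
  linear_combination (PowerSeries.C (inv δ) * (gaussIntegral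
    * PowerSeries.rescale (-1) gaussIntegral)) * expSeries_mul_neg h0

/-- The coefficients of `fSym` are integral polynomials in `x + x⁻¹` divided by powers of `δ`. -/
theorem exists_coeff_fSym_eq (n : ℕ) : ∃ f : ℤ[X], f.natDegree ≤ 4 * n ∧
    PowerSeries.coeff n fSym = inv δ ^ (4 * n + 1) * aeval (x + inv x) (f.map (Int.castRingHom ℚ)) := by
  obtain ⟨f, hf, h⟩ := exists_int_curveProd_eq n
  refine ⟨f, hf, ?_⟩
  have h1 := h (B := CoordRing) ⟨x * y, inv (x * y), xy_mul_inv, by rw [mul_comm]; exact xy_mul_inv⟩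
    (inv δ) (by
      change inv δ * (inv (x * y) - x * y) = 1
      rw [← δ_eq, inv_δ_mul])
  change aeval (x * y + inv (x * y) + 1) (f.map (Int.castRingHom ℚ)) = (inv (x * y) - x * y) ^ (4 * n + 1)
    * PowerSeries.coeff n (curveProd (x * y - inv (x * y) - 1) (-(x * y)) (inv δ)) at h1
  rw [← δ_eq, xy_add_inv, ← fSym_eq] at h1
  have h2 : inv δ ^ (4 * n + 1) * δ ^ (4 * n + 1) = 1 := by rw [← mul_pow, inv_δ_mul, one_pow]
  rw [h1]
  linear_combination (-PowerSeries.coeff n fSym) * h2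

end Curve

end FigureEight

end

noncomputable section

namespace FigureEight

set_option linter.unusedSectionVars false

open Polynomial

/-! ### Exact forms and the span of ω and ω' -/

section ExactForms

/-- The function `x + x⁻¹` on the curve. -/
def ξ : CoordRing := x + inv x

/-- The function `x - x⁻¹` on the curve. -/
def w : CoordRing := x - inv x

/-- The polynomial with value `δ²` at `x + x⁻¹`. -/
def polD : ℚ[X] := X ^ 2 - 2 * X - 3

/-- The polynomial with value `(x - x⁻¹)²` at `x + x⁻¹`. -/
def polA : ℚ[X] := X ^ 2 - 4

/-- The polynomial with value `δ⁶ ω' / ω` at `x + x⁻¹`. -/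
def polN : ℚ[X] := X ^ 3 - X ^ 2 - 5 * X + 7

/-- The function `p(x + x⁻¹) (δ²)^(-L) δ (x - x⁻¹)` has the differential
`theta L p (x + x⁻¹) (δ²)^(-L) ω`. -/
def theta (L : ℕ) (p : ℚ[X]) : ℚ[X] :=
  X * polD * p + C (1 / 2 - L : ℚ) * polA * (2 * X - 2) * p + polA * polD * derivative p

theorem aeval_polD_eq {A : Type*} [CommRing A] [Algebra ℚ A] (a : A) :
    aeval a polD = a ^ 2 - 2 * a - 3 := by
  simp [polD, map_ofNat]

theorem aeval_polA_eq {A : Type*} [CommRing A] [Algebra ℚ A] (a : A) :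
    aeval a polA = a ^ 2 - 4 := by
  simp [polA, map_ofNat]

theorem aeval_two_mul_X_sub_two {A : Type*} [CommRing A] [Algebra ℚ A] (a : A) :
    aeval a (2 * X - 2 : ℚ[X]) = 2 * a - 2 := by
  simp [map_ofNat]

theorem derivative_polD : derivative polD = 2 * X - 2 := by
  simp [polD]
  norm_num

theorem δ_sq : δ ^ 2 = ξ ^ 2 - 2 * ξ - 3 := by
  rw [delta_sq, ξ]
  linear_combination (-2 : CoordRing) * x_mul_inv

theorem aeval_polD : aeval ξ polD = δ ^ 2 := by
  rw [δ_sq, aeval_polD_eq]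

theorem w_sq : w ^ 2 = ξ ^ 2 - 4 := by
  rw [ξ, w]
  linear_combination (-4 : CoordRing) * x_mul_inv

theorem aeval_polA : aeval ξ polA = w ^ 2 := by
  rw [w_sq, aeval_polA_eq]

/-- The universal derivation. -/
abbrev dR : Derivation ℚ CoordRing Forms := KaehlerDifferential.D ℚ CoordRing

theorem dR_mul {a b a' b' : CoordRing} (ha : dR a = a' • ω) (hb : dR b = b' • ω) :
    dR (a * b) = (a * b' + b * a') • ω := by
  rw [Derivation.leibniz, ha, hb, smul_smul, smul_smul, add_smul]

theorem dR_x : dR x = (x * δ) • ω := by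
  rw [ω, dlogx, smul_smul, smul_smul]
  have : x * δ * (inv δ * inv x) = 1 := by
    linear_combination x * inv x * inv_δ_mul + x_mul_inv
  rw [← mul_assoc] at this
  rw [this, one_smul]

theorem dR_inv {a b a' : CoordRing} (h : b * a = 1) (ha : dR a = a' • ω) :
    dR b = (-b ^ 2 * a') • ω := by
  rw [Derivation.leibniz_of_mul_eq_one dR h, ha, smul_smul]

theorem dR_inv_x : dR (inv x) = (-(inv x * δ)) • ω := by
  rw [dR_inv (by rw [mul_comm]; exact x_mul_inv) dR_x]
  congr 1
  linear_combination (-(inv x * δ)) * x_mul_inv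

theorem dR_ξ : dR ξ = (δ * w) • ω := by
  rw [ξ, map_add, dR_x, dR_inv_x, ← add_smul, w]
  congr 1
  ring

theorem dR_w : dR w = (ξ * δ) • ω := by
  rw [w, map_sub, dR_x, dR_inv_x, ← sub_smul, ξ]
  congr 1
  ring

theorem dR_aeval (p : ℚ[X]) : dR (aeval ξ p) = (aeval ξ (derivative p) * (δ * w)) • ω := by
  rw [Derivation.map_aeval, dR_ξ, smul_smul]

theorem dR_δ : dR δ = ((ξ - 1) * w) • ω := by
  have h1 := dR_aeval polD
  rw [aeval_polD, pow_two δ, Derivation.leibniz, ← add_smul] at h1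
  have h2 : ((half CoordRing) * inv δ) • (δ + δ) • dR δ = dR δ := by
    rw [smul_smul]
    have : half CoordRing * inv δ * (δ + δ) = 1 := by
      linear_combination (half CoordRing + half CoordRing) * inv_δ_mul + half_add_half (A := CoordRing)
    rw [this, one_smul]
  rw [← h2, h1, smul_smul]
  congr 1
  rw [derivative_polD, aeval_two_mul_X_sub_two]
  linear_combination (ξ - 1) * w * (2 * half CoordRing * inv_δ_mul + half_add_half (A := CoordRing))

theorem dR_δ_mul_w : dR (δ * w) = (ξ * δ ^ 2 + (ξ - 1) * w ^ 2) • ω := by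
  rw [dR_mul dR_δ dR_w]
  congr 1
  ring

theorem dR_inv_δ_pow (n : ℕ) :
    dR (inv δ ^ n) = (-(n : CoordRing) * inv δ ^ (n + 1) * ((ξ - 1) * w)) • ω := by
  induction n with
  | zero => simp
  | succ n ih =>
    rw [pow_succ (inv δ) n, dR_mul ih (dR_inv inv_δ_mul dR_δ)]
    congr 1
    push_cast
    ring

/-- The function `f(x + x⁻¹) / δ^(2 M)` on the curve. -/
def frac (M : ℕ) : ℚ[X] →ₗ[ℚ] CoordRing :=
  (LinearMap.mulLeft ℚ (inv δ ^ (2 * M))).comp (aeval ξ).toLinearMap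

theorem frac_apply (M : ℕ) (f : ℚ[X]) : frac M f = inv δ ^ (2 * M) * aeval ξ f := rfl

theorem frac_succ (M : ℕ) (f : ℚ[X]) : frac (M + 1) (polD * f) = frac M f := by
  rw [frac_apply, frac_apply, map_mul (aeval ξ), aeval_polD, mul_add, pow_add]
  linear_combination inv δ ^ (2 * M) * aeval ξ f * (inv δ * δ + 1) * inv_δ_mul

theorem dR_frac_mul (L : ℕ) (p : ℚ[X]) :
    dR (frac L p * (δ * w)) = frac L (theta L p) • ω := by
  rw [frac_apply, dR_mul (dR_mul (dR_inv_δ_pow _) (dR_aeval p)) dR_δ_mul_w, frac_apply]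
  congr 1
  have hc : aeval ξ (C (1 / 2 - L : ℚ)) = half CoordRing - L := by
    rw [aeval_C, map_sub, half, map_natCast]
  simp only [theta, map_add, map_mul, aeval_polD, aeval_polA, hc, aeval_two_mul_X_sub_two, aeval_X]
  have h3 : inv δ ^ (2 * L + 1) * δ = inv δ ^ (2 * L) := by
    linear_combination inv δ ^ (2 * L) * inv_δ_mul
  push_cast
  linear_combination (-2 * L * (ξ - 1) * w ^ 2 * aeval ξ p) * h3
    + inv δ ^ (2 * L) * w ^ 2 * (1 - ξ) * aeval ξ p * half_add_half (A := CoordRing)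

/-- The class of `f(x + x⁻¹) / δ^(2 M) ω`. -/
def fracCls (M : ℕ) : ℚ[X] →ₗ[ℚ] H1dR :=
  exactForms.mkQ.comp (((LinearMap.toSpanSingleton CoordRing Forms ω).restrictScalars ℚ).comp
    (frac M))

theorem fracCls_apply (M : ℕ) (f : ℚ[X]) : fracCls M f = cls (frac M f • ω) := rfl

theorem fracCls_succ (M : ℕ) (f : ℚ[X]) : fracCls (M + 1) (polD * f) = fracCls M f := by
  rw [fracCls_apply, frac_succ, fracCls_apply]

theorem fracCls_theta (L : ℕ) (p : ℚ[X]) : fracCls L (theta L p) = 0 := by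
  rw [fracCls_apply, ← dR_frac_mul, cls, Submodule.mkQ_apply, Submodule.Quotient.mk_eq_zero]
  exact ⟨_, rfl⟩

theorem fracCls_eq_zero_iff (M : ℕ) (f : ℚ[X]) :
    fracCls M f = 0 ↔ ∃ h, dR h = frac M f • ω := by
  rw [fracCls_apply, cls, Submodule.mkQ_apply, Submodule.Quotient.mk_eq_zero]
  rfl

theorem cls_ω : cls ω = fracCls 0 1 := by
  rw [fracCls_apply, frac_apply]
  simp

theorem cls_ω' : cls ω' = fracCls 3 polN := by
  rw [fracCls_apply, frac_apply, ω', ω, smul_smul]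
  congr 2
  simp only [polN, map_add, map_sub, map_mul, map_pow, aeval_X, map_ofNat, ξ]
  linear_combination (-inv δ ^ 7 * (3 * (x + inv x) - 2)) * x_mul_inv

theorem exists_cls_gCoeff_eq (k : ℕ) : ∃ f : ℤ[X], f.natDegree ≤ 4 * k ∧
    cls (gCoeff k) = fracCls (2 * k) (f.map (Int.castRingHom ℚ)) := by
  obtain ⟨f, hf, h⟩ := exists_coeff_fSym_eq k
  refine ⟨f, hf, ?_⟩
  rw [fracCls_apply, frac_apply, gCoeff, h, ω, smul_smul, ← ξ]
  congr 2
  ring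

/-! ### Reduction of the pole order -/

theorem polD_dvd {f : ℚ[X]} (h1 : f.eval 3 = 0) (h2 : f.eval (-1) = 0) : polD ∣ f := by
  obtain ⟨g, rfl⟩ := dvd_iff_isRoot.2 h1
  rw [eval_mul, mul_eq_zero] at h2
  obtain ⟨g, rfl⟩ := dvd_iff_isRoot.2 (h2.resolve_left (by norm_num))
  refine ⟨g, ?_⟩
  simp only [polD, map_neg, map_one, map_ofNat]
  ring

theorem polD_eval_three : polD.eval 3 = 0 := by norm_num [polD]

theorem polD_eval_neg_one : polD.eval (-1) = 0 := by norm_num [polD]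

theorem natDegree_polD : polD.natDegree = 2 := by
  unfold polD
  compute_degree!

theorem polD_ne_zero : polD ≠ 0 := by
  intro h
  have := natDegree_polD
  rw [h] at this
  simp at this

theorem natDegree_theta_le (L : ℕ) (p : ℚ[X]) : (theta L p).natDegree ≤ p.natDegree + 3 := by
  have hA : polA.natDegree ≤ 2 := by
    unfold polA
    compute_degree
  have hD := natDegree_polD.le
  have hX : (2 * X - 2 : ℚ[X]).natDegree ≤ 1 := by compute_degree
  have hd := natDegree_derivative_le p
  rw [theta]
  refine natDegree_add_le_of_degree_le (natDegree_add_le_of_degree_le ?_ ?_) ?_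
  · refine (natDegree_mul_le_of_le (natDegree_mul_le_of_le natDegree_X_le hD) le_rfl).trans ?_
    omega
  · refine (natDegree_mul_le_of_le (natDegree_mul_le_of_le (natDegree_mul_le_of_le
      (natDegree_C _).le hA) hX) le_rfl).trans ?_
    omega
  · by_cases h0 : p.natDegree = 0
    · rw [derivative_of_natDegree_zero h0, mul_zero]
      simp
    · refine (natDegree_mul_le_of_le (natDegree_mul_le_of_le hA hD) hd).trans ?_
      omega

/-- At the zeros 3 and -1 of `polD` the polynomial `theta` L p reduces to (1/2 - L) `polA` (2 X - 2)
p, with nonzero factors. So a linear p can be interpolated to make f - `theta` L p divisible by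
`polD`. -/
theorem exists_theta_add_polD_mul {M : ℕ} {f : ℚ[X]} (hM : 1 ≤ M) (hf : f.natDegree ≤ 2 * (M + 1)) :
    ∃ p g : ℚ[X], f = theta (M + 1) p + polD * g ∧ g.natDegree ≤ 2 * M := by
  obtain ⟨c, hc⟩ : ∃ c : ℚ, c = 1 / 2 - (M + 1 : ℕ) := ⟨_, rfl⟩
  have hc0 : c ≠ 0 := by
    rw [hc]
    have : (1 : ℚ) ≤ M := by exact_mod_cast hM
    push_cast
    intro h
    linarith
  -- Here 20 and 12 are the values of `polA` (2 X - 2) at 3 and -1; u and v are the values that p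
  -- must take there.
  obtain ⟨u, hu⟩ : ∃ u, u = f.eval 3 / (20 * c) := ⟨_, rfl⟩
  obtain ⟨v, hv⟩ : ∃ v, v = f.eval (-1) / (12 * c) := ⟨_, rfl⟩
  obtain ⟨p, hp⟩ : ∃ p : ℚ[X], p = C ((u - v) / 4) * X + C ((u + 3 * v) / 4) := ⟨_, rfl⟩
  have hp1 : p.natDegree ≤ 1 := by rw [hp]; compute_degree
  have h3 : (theta (M + 1) p).eval 3 = f.eval 3 := by
    rw [theta]
    simp only [eval_add, eval_mul, polD_eval_three, eval_C, ← hc]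
    have : p.eval 3 = u := by rw [hp]; simp; ring
    rw [this, hu]
    simp [polA]
    field_simp
    ring
  have h4 : (theta (M + 1) p).eval (-1) = f.eval (-1) := by
    rw [theta]
    simp only [eval_add, eval_mul, polD_eval_neg_one, eval_C, ← hc]
    have : p.eval (-1) = v := by rw [hp]; simp; ring
    rw [this, hv]
    simp [polA]
    field_simp
    ring
  obtain ⟨g, hg⟩ := polD_dvd (f := f - theta (M + 1) p) (by rw [eval_sub, h3, sub_self])
    (by rw [eval_sub, h4, sub_self])
  refine ⟨p, g, by rw [← hg]; ring, ?_⟩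
  by_cases hg0 : g = 0
  · simp [hg0]
  have h5 : (polD * g).natDegree ≤ 2 * (M + 1) := by
    rw [← hg]
    refine (natDegree_sub_le_of_le hf (natDegree_theta_le _ _)).trans ?_
    omega
  rw [natDegree_mul polD_ne_zero hg0, natDegree_polD] at h5
  omega

theorem theta_one_one : theta 1 1 = - X ^ 2 + X - 4 := by
  have : (C (1 / 2 - (1 : ℕ) : ℚ) : ℚ[X]) * 2 = -1 := by
    have h : (2 : ℚ[X]) = C 2 := rfl
    rw [h, ← C_mul, ← C_1, ← C_neg]
    norm_num
  rw [theta, polA, polD, derivative_one]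
  linear_combination (X ^ 2 - 4) * (X - 1) * this

theorem fracCls_one_eq {f : ℚ[X]} (hf : f.natDegree ≤ 2) :
    ∃ a b : ℚ, fracCls 1 f = a • fracCls 1 1 + b • fracCls 1 X := by
  have h1 : f = (f.coeff 0 - 4 * f.coeff 2) • 1 + (f.coeff 1 + f.coeff 2) • X
      - f.coeff 2 • theta 1 1 := by
    rw [theta_one_one]
    nth_rw 1 [as_sum_range' f 3 (by omega)]
    simp only [Finset.sum_range_succ, Finset.sum_range_zero, smul_eq_C_mul, C_sub, C_mul, C_add,
      ← C_mul_X_pow_eq_monomial, pow_zero, zero_add]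
    have h : (C 4 : ℚ[X]) = 4 := rfl
    rw [h]
    ring
  refine ⟨f.coeff 0 - 4 * f.coeff 2, f.coeff 1 + f.coeff 2, ?_⟩
  nth_rw 1 [h1]
  rw [map_sub, map_add, map_smul, map_smul, map_smul, fracCls_theta, smul_zero, sub_zero]

theorem exists_fracCls_eq {M : ℕ} {f : ℚ[X]} (hf : f.natDegree ≤ 2 * (M + 1)) :
    ∃ a b : ℚ, fracCls (M + 1) f = a • fracCls 1 1 + b • fracCls 1 X := by
  induction M generalizing f with
  | zero => exact fracCls_one_eq hf
  | succ M ih =>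
    obtain ⟨p, g, h, hg⟩ := exists_theta_add_polD_mul (by omega) hf
    rw [h, map_add, fracCls_theta, zero_add, fracCls_succ]
    exact ih hg

/-- The explicit reduction of ω' from δ^(-6) ω to δ^(-2) ω, with denominators cleared. -/
theorem theta_three_polN : 1350 * polN
    = theta 3 (-396 + 75 * X + 13 * X ^ 2 - 8 * X ^ 3)
      + polD * (polD * (70 - 30 * X - 8 * X ^ 2)) := by
  have : (C (1 / 2 - (3 : ℕ) : ℚ) : ℚ[X]) * 2 = -5 := by
    have h : (2 : ℚ[X]) = C 2 := rfl
    have h' : (5 : ℚ[X]) = C 5 := rfl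
    rw [h, h', ← C_mul, ← C_neg]
    norm_num
  obtain ⟨p, hp⟩ : ∃ p : ℚ[X], p = -396 + 75 * X + 13 * X ^ 2 - 8 * X ^ 3 := ⟨_, rfl⟩
  have hd : derivative p = 75 + 26 * X - 24 * X ^ 2 := by
    rw [hp]
    simp only [derivative_add, derivative_sub, derivative_mul, derivative_neg, derivative_ofNat,
      derivative_X, derivative_X_pow, Nat.cast_ofNat, map_ofNat]
    ring
  rw [← hp, theta, hd, hp, polA, polD, polN]
  linear_combination (-(X ^ 2 - 4) * (X - 1) * (-396 + 75 * X + 13 * X ^ 2 - 8 * X ^ 3)) * this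

theorem cls_ω_eq : cls ω = -(7 : ℚ) • fracCls 1 1 - fracCls 1 X := by
  rw [cls_ω, ← fracCls_succ, zero_add, ← map_smul, ← map_sub, ← sub_eq_zero, ← map_sub,
    ← neg_eq_zero, ← map_neg, ← fracCls_theta 1 1, theta_one_one, polD]
  refine congrArg (fracCls 1) ?_
  simp only [smul_eq_C_mul, C_neg]
  have h : (C 7 : ℚ[X]) = 7 := rfl
  rw [h]
  ring

theorem cls_ω'_eq : (675 : ℚ) • cls ω' = (51 : ℚ) • fracCls 1 1 - (19 : ℚ) • fracCls 1 X := by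
  have h1 : (1350 : ℚ) • cls ω' = fracCls 1 (70 - 30 * X - 8 * X ^ 2) := by
    have h : (1350 : ℚ) • polN = 1350 * polN := smul_eq_C_mul _
    rw [cls_ω', ← map_smul, h, theta_three_polN, map_add, fracCls_theta, zero_add, fracCls_succ,
      fracCls_succ]
  have h2 : (2 : ℚ) • (675 : ℚ) • cls ω'
      = (2 : ℚ) • ((51 : ℚ) • fracCls 1 1 - (19 : ℚ) • fracCls 1 X) := by
    rw [smul_smul, show (2 * 675 : ℚ) = 1350 by norm_num, h1, ← map_smul, ← map_smul, ← map_sub,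
      ← map_smul, ← sub_eq_zero, ← map_sub, ← smul_zero (8 : ℚ), ← fracCls_theta 1 1, ← map_smul,
      theta_one_one]
    refine congrArg (fracCls 1) ?_
    simp only [smul_eq_C_mul]
    have e1 : (C 2 : ℚ[X]) = 2 := rfl
    have e2 : (C 51 : ℚ[X]) = 51 := rfl
    have e3 : (C 19 : ℚ[X]) = 19 := rfl
    have e4 : (C 8 : ℚ[X]) = 8 := rfl
    rw [e1, e2, e3, e4]
    ring
  exact smul_right_injective _ (by norm_num : (2 : ℚ) ≠ 0) h2

/-- The classes of `ω` and `ω'` span the classes of the forms `f(x + x⁻¹) / δ^(2 M) ω` with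
`f` of degree at most `2 M`. -/
theorem exists_fracCls_eq_cls {M : ℕ} {f : ℚ[X]} (hf : f.natDegree ≤ 2 * M) :
    ∃ a b : ℚ, fracCls M f = a • cls ω + b • cls ω' := by
  -- Numerator and denominator are multiplied by `polD`, so that M = 0 is covered as well. The
  -- number 184 = 51 + 7 · 19 below arises in expressing δ^(-2) ω through ω and ω'.
  obtain ⟨a, b, h⟩ := exists_fracCls_eq (M := M) (f := polD * f)
    ((natDegree_mul_le_of_le natDegree_polD.le hf).trans (by omega))
  rw [fracCls_succ] at h
  have h1 : fracCls 1 X = -(7 : ℚ) • fracCls 1 1 - cls ω := by rw [cls_ω_eq]; abel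
  have h2 := cls_ω'_eq
  rw [h1] at h2
  have h3 : fracCls 1 1 = (1 / 184 : ℚ) • ((675 : ℚ) • cls ω' - (19 : ℚ) • cls ω) := by
    rw [h2]
    module
  rw [h1, h3] at h
  refine ⟨-(19 / 184) * (a - 7 * b) - b, 675 / 184 * (a - 7 * b), h.trans ?_⟩
  module

end ExactForms

end FigureEight

end

noncomputable section

namespace FigureEight

set_option linter.unusedSectionVars false

open Polynomial

/-! ### Generators of the coordinate ring over the functions of x + x⁻¹ -/

section Decomposition

/-- The products of negative even powers of `δ` with combinations of `1`, `x - x⁻¹`, `δ` and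
`δ (x - x⁻¹)` whose coefficients are polynomials in `x + x⁻¹`. -/
def IsCombination (h : CoordRing) : Prop :=
  ∃ (L : ℕ) (p₀ p₁ p₂ p₃ : ℚ[X]), h = inv δ ^ (2 * L)
    * (aeval ξ p₀ + aeval ξ p₁ * w + aeval ξ p₂ * δ + aeval ξ p₃ * (δ * w))

theorem inv_δ_pow_mul (L : ℕ) : inv δ ^ (2 * L) * aeval ξ (polD ^ L) = 1 := by
  rw [map_pow, aeval_polD, ← pow_mul, ← mul_pow, inv_δ_mul, one_pow]

theorem IsCombination.add {h k : CoordRing} (hh : IsCombination h) (hk : IsCombination k) :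
    IsCombination (h + k) := by
  obtain ⟨L, p₀, p₁, p₂, p₃, rfl⟩ := hh
  obtain ⟨M, q₀, q₁, q₂, q₃, rfl⟩ := hk
  refine ⟨L + M, p₀ * polD ^ M + q₀ * polD ^ L, p₁ * polD ^ M + q₁ * polD ^ L,
    p₂ * polD ^ M + q₂ * polD ^ L, p₃ * polD ^ M + q₃ * polD ^ L, ?_⟩
  simp only [map_add (aeval ξ), map_mul (aeval ξ), mul_add 2, pow_add]
  linear_combination (-inv δ ^ (2 * L)
    * (aeval ξ p₀ + aeval ξ p₁ * w + aeval ξ p₂ * δ + aeval ξ p₃ * (δ * w))) * inv_δ_pow_mul M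
    - inv δ ^ (2 * M)
    * (aeval ξ q₀ + aeval ξ q₁ * w + aeval ξ q₂ * δ + aeval ξ q₃ * (δ * w)) * inv_δ_pow_mul L

theorem IsCombination.mul {h k : CoordRing} (hh : IsCombination h) (hk : IsCombination k) :
    IsCombination (h * k) := by
  obtain ⟨L, p₀, p₁, p₂, p₃, rfl⟩ := hh
  obtain ⟨M, q₀, q₁, q₂, q₃, rfl⟩ := hk
  refine ⟨L + M, p₀ * q₀ + p₁ * q₁ * polA + p₂ * q₂ * polD + p₃ * q₃ * (polA * polD),
    p₀ * q₁ + p₁ * q₀ + (p₂ * q₃ + p₃ * q₂) * polD,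
    p₀ * q₂ + p₂ * q₀ + (p₁ * q₃ + p₃ * q₁) * polA,
    p₀ * q₃ + p₃ * q₀ + p₁ * q₂ + p₂ * q₁, ?_⟩
  simp only [map_add (aeval ξ), map_mul (aeval ξ), mul_add 2, pow_add, aeval_polD, aeval_polA]
  ring

theorem isCombination_one : IsCombination 1 := ⟨0, 1, 0, 0, 0, by simp⟩

theorem isCombination_algebraMap (r : ℚ) : IsCombination (algebraMap ℚ CoordRing r) :=
  ⟨0, C r, 0, 0, 0, by simp⟩

theorem isCombination_ξ : IsCombination ξ := ⟨0, X, 0, 0, 0, by simp⟩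

theorem isCombination_w : IsCombination w := ⟨0, 0, 1, 0, 0, by simp⟩

theorem isCombination_δ : IsCombination δ := ⟨0, 0, 0, 1, 0, by simp⟩

theorem isCombination_inv_δ : IsCombination (inv δ) := ⟨1, 0, 0, 1, 0, by
  simp only [map_zero, map_one]
  linear_combination (-inv δ) * inv_δ_mul⟩

theorem IsCombination.neg {h : CoordRing} (hh : IsCombination h) : IsCombination (-h) := by
  have := (isCombination_algebraMap (-1)).mul hh
  simpa using this

theorem IsCombination.half_mul {h : CoordRing} (hh : IsCombination h) :
    IsCombination (half CoordRing * h) := (isCombination_algebraMap _).mul hh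

theorem IsCombination.pow {h : CoordRing} (hh : IsCombination h) (n : ℕ) :
    IsCombination (h ^ n) := by
  induction n with
  | zero => simpa using isCombination_one
  | succ n ih => rw [pow_succ]; exact ih.mul hh

theorem x_eq : x = half CoordRing * (ξ + w) := by
  have h : ξ + w = x + x := by rw [ξ, w]; ring
  rw [h]
  linear_combination (-x) * half_add_half (A := CoordRing)

theorem inv_x_eq : inv x = half CoordRing * (ξ + -w) := by
  have h : ξ + -w = inv x + inv x := by rw [ξ, w]; ring
  rw [h]
  linear_combination (-inv x) * half_add_half (A := CoordRing)

theorem xy_eq : x * y = half CoordRing * (ξ + -1 + -δ) := by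
  have h : x * y + inv (x * y) + 1 = ξ := xy_add_inv
  linear_combination (-(x * y)) * half_add_half (A := CoordRing) + half CoordRing * h
    + half CoordRing * δ_eq

theorem inv_xy_eq : inv (x * y) = half CoordRing * (ξ + -1 + δ) := by
  have h : x * y + inv (x * y) + 1 = ξ := xy_add_inv
  linear_combination (-inv (x * y)) * half_add_half (A := CoordRing) + half CoordRing * h
    - half CoordRing * δ_eq

theorem y_eq : y = inv x * (x * y) := by
  linear_combination (-y) * x_mul_inv

theorem isCombination_x : IsCombination x := by
  rw [x_eq]
  exact (isCombination_ξ.add isCombination_w).half_mul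

theorem isCombination_y : IsCombination y := by
  rw [y_eq, inv_x_eq, xy_eq]
  exact (isCombination_ξ.add isCombination_w.neg).half_mul.mul
    ((isCombination_ξ.add isCombination_one.neg).add isCombination_δ.neg).half_mul

/-- The ring is generated by ξ, w, δ and δ⁻¹, and the relations w² = `polA`(ξ), δ² = `polD`(ξ)
reduce products to these four terms. Uniqueness of the expression is not needed. -/
theorem isCombination (h : CoordRing) : IsCombination h := by
  obtain ⟨n, a, ha⟩ := IsLocalization.Away.surj (x₀ * y₀ * (1 - x₀ ^ 2 * y₀ ^ 2)) h
  have h1 : algebraMap PlaneRing CoordRing (x₀ * y₀ * (1 - x₀ ^ 2 * y₀ ^ 2))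
      * (inv (x * y) ^ 2 * inv δ) = 1 := by
    have : algebraMap PlaneRing CoordRing (x₀ * y₀ * (1 - x₀ ^ 2 * y₀ ^ 2))
      = x * y * (1 - x ^ 2 * y ^ 2) := by simp [x, y]
    rw [this]
    have h2 : 1 - x ^ 2 * y ^ 2 = x * y * δ := by
      rw [δ_eq]
      linear_combination -xy_mul_inv
    rw [h2]
    linear_combination (x * y * inv (x * y)) ^ 2 * inv_δ_mul
      + (x * y * inv (x * y) + 1) * xy_mul_inv
  have h2 : h = algebraMap PlaneRing CoordRing a * (inv (x * y) ^ 2 * inv δ) ^ n := by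
    have h3 := congrArg (fun b => h * b ^ n) h1
    simp only [one_pow, mul_one] at h3
    rw [← ha, mul_assoc]
    exact h3.symm.trans (congrArg (HMul.hMul h) (mul_pow _ _ n))
  rw [h2]
  clear h2 ha
  refine IsCombination.mul ?_ (((IsCombination.pow ?_ 2).mul isCombination_inv_δ).pow n)
  · obtain ⟨p, rfl⟩ := Ideal.Quotient.mk_surjective a
    induction p using MvPolynomial.induction_on with
    | C r =>
      have : algebraMap PlaneRing CoordRing (Ideal.Quotient.mk curveIdeal (MvPolynomial.C r))
          = algebraMap ℚ CoordRing r := by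
        exact RingHom.congr_fun (RingHom.ext_rat (((algebraMap PlaneRing CoordRing).comp
          (Ideal.Quotient.mk curveIdeal)).comp MvPolynomial.C) _) r
      rw [this]
      exact isCombination_algebraMap r
    | add p q hp hq =>
      rw [map_add, map_add]
      exact hp.add hq
    | mul_X p i hp =>
      rw [map_mul, map_mul]
      refine hp.mul ?_
      fin_cases i
      · exact isCombination_x
      · exact isCombination_y
  · rw [inv_xy_eq]
    exact ((isCombination_ξ.add isCombination_one.neg).add isCombination_δ).half_mul

end Decomposition

/-! ### Homomorphisms out of the coordinate ring -/

section Homomorphisms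

variable {B : Type} [CommRing B] [Algebra ℚ B]

/-- The coordinates are recovered as x = (ξ + w)/2 and x y = (ξ - 1 - δ)/2. The signs of the two
square roots may be chosen independently. -/
theorem exists_hom_of_curve {X₁ W₁ D₁ : B} (hW : W₁ ^ 2 = X₁ ^ 2 - 4)
    (hD : D₁ ^ 2 = X₁ ^ 2 - 2 * X₁ - 3) (hu : IsUnit D₁) :
    ∃ φ : CoordRing →+* B, φ ξ = X₁ ∧ φ w = W₁ ∧ φ δ = D₁ := by
  obtain ⟨c, hc⟩ : ∃ c, c = half B := ⟨_, rfl⟩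
  have h2 : c + c = 1 := by rw [hc, half_add_half]
  obtain ⟨x₁, hx⟩ : ∃ x₁, x₁ = c * (X₁ + W₁) := ⟨_, rfl⟩
  obtain ⟨x₂, hx'⟩ : ∃ x₂, x₂ = c * (X₁ - W₁) := ⟨_, rfl⟩
  obtain ⟨t₁, ht⟩ : ∃ t₁, t₁ = c * (X₁ - 1 - D₁) := ⟨_, rfl⟩
  obtain ⟨t₂, ht'⟩ : ∃ t₂, t₂ = c * (X₁ - 1 + D₁) := ⟨_, rfl⟩
  have hxx : x₁ * x₂ = 1 := by
    rw [hx, hx']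
    linear_combination (-c ^ 2) * hW + (2 * c + 1) * h2
  have htt : t₁ * t₂ = 1 := by
    rw [ht, ht']
    linear_combination (-c ^ 2) * hD + (2 * c + 1) * h2
  have hxa : x₁ + x₂ = X₁ := by
    rw [hx, hx']
    linear_combination X₁ * h2
  have hta : t₁ + t₂ = X₁ - 1 := by
    rw [ht, ht']
    linear_combination (X₁ - 1) * h2
  have hts : t₂ - t₁ = D₁ := by
    rw [ht, ht']
    linear_combination D₁ * h2
  have hxs : x₁ - x₂ = W₁ := by
    rw [hx, hx']
    linear_combination W₁ * h2
  let e : MvPolynomial (Fin 2) ℚ →+* B :=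
    (MvPolynomial.aeval ![x₁, t₁ * x₂] : MvPolynomial (Fin 2) ℚ →ₐ[ℚ] B).toRingHom
  have e0 : e (MvPolynomial.X 0) = x₁ := by simp [e]
  have e1 : e (MvPolynomial.X 1) = t₁ * x₂ := by simp [e]
  have he : ∀ a ∈ curveIdeal, e a = 0 := by
    intro a ha
    have : curveIdeal ≤ RingHom.ker e := by
      rw [curveIdeal, Ideal.span_singleton_le_iff_mem, RingHom.mem_ker]
      simp only [map_add, map_mul, map_sub, map_one, map_pow, e0, e1]
      linear_combination (t₁ - x₁ * t₁ + x₁ * x₂ * t₁ ^ 2 + t₁ ^ 2) * hxx - t₁ * hxa + t₁ * hta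
        - htt
    exact this ha
  let q : PlaneRing →+* B := Ideal.Quotient.lift curveIdeal e he
  have q0 : q x₀ = x₁ := by simp [q, x₀, e0]
  have q1 : q y₀ = t₁ * x₂ := by simp [q, y₀, e1]
  have hq : IsUnit (q (x₀ * y₀ * (1 - x₀ ^ 2 * y₀ ^ 2))) := by
    have : q (x₀ * y₀ * (1 - x₀ ^ 2 * y₀ ^ 2)) = t₁ * t₁ * D₁ := by
      simp only [map_mul, map_sub, map_one, map_pow, q0, q1]
      rw [← hts]
      linear_combination (t₁ - t₁ ^ 3 * ((x₁ * x₂) ^ 2 + x₁ * x₂ + 1)) * hxx - t₁ * htt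
    rw [this]
    exact ((IsUnit.of_mul_eq_one _ htt).mul (IsUnit.of_mul_eq_one _ htt)).mul hu
  let φ : CoordRing →+* B := IsLocalization.Away.lift (x₀ * y₀ * (1 - x₀ ^ 2 * y₀ ^ 2)) hq
  have p0 : φ x = x₁ := by
    rw [← q0]
    exact IsLocalization.Away.lift_eq _ hq x₀
  have p1 : φ y = t₁ * x₂ := by
    rw [← q1]
    exact IsLocalization.Away.lift_eq _ hq y₀
  have p2 : φ (inv x) = x₂ := by
    have := congrArg φ x_mul_inv
    rw [map_mul, map_one, p0] at this
    linear_combination x₂ * this - φ (inv x) * hxx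
  have p3 : φ (x * y) = t₁ := by
    rw [map_mul, p0, p1]
    linear_combination t₁ * hxx
  have p4 : φ (inv (x * y)) = t₂ := by
    have := congrArg φ xy_mul_inv
    rw [map_mul, map_one, p3] at this
    linear_combination t₂ * this - φ (inv (x * y)) * htt
  refine ⟨φ, ?_, ?_, ?_⟩
  · rw [ξ, map_add, p0, p2, hxa]
  · rw [w, map_sub, p0, p2, hxs]
  · rw [δ_eq, map_sub, p3, p4, hts]

/-- The derivation d ∘ φ factors through the Kähler forms, and the image of ω is eliminated by dξ =
δ w ω. -/
theorem derivation_of_dR_eq (φ : CoordRing →+* B) (d : Derivation ℚ B B) {h g : CoordRing}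
    (hg : dR h = g • ω) : d (φ h) * φ (δ * w) = φ g * d (φ ξ) := by
  let _ : Algebra CoordRing B := φ.toAlgebra
  have : IsScalarTower ℚ CoordRing B := IsScalarTower.of_algebraMap_eq' (RingHom.ext_rat _ _)
  let d' : Derivation ℚ CoordRing B := d.compAlgebraMap CoordRing
  have h1 : ∀ a, d'.liftKaehlerDifferential (dR a) = d (φ a) := fun a =>
    d'.liftKaehlerDifferential_comp_D a
  have h2 : ∀ (a : CoordRing) (b : B), a • b = φ a * b := fun a b => rfl
  have h3 := congrArg d'.liftKaehlerDifferential hg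
  have h4 := congrArg d'.liftKaehlerDifferential dR_ξ
  rw [h1, map_smul, h2] at h3 h4
  rw [h3, h4]
  ring

end Homomorphisms

end FigureEight

end

noncomputable section

namespace FigureEight

set_option linter.unusedSectionVars false

open Polynomial

/-! ### Square roots of power series -/

section SquareRoots

variable {K : Type} [Field K] [Algebra ℚ K]

theorem exists_derivative_eq (f : PowerSeries K) :
    ∃ g : PowerSeries K, PowerSeries.derivative K g = f ∧ PowerSeries.constantCoeff g = 0 := by
  have : CharZero K := algebraRat.charZero K
  refine ⟨PowerSeries.mk fun n => PowerSeries.coeff (n - 1) f * (n : K)⁻¹, ?_, ?_⟩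
  · ext n
    rw [PowerSeries.coeff_derivative, PowerSeries.coeff_mk, Nat.add_sub_cancel]
    have : (n : K) + 1 ≠ 0 := by exact_mod_cast n.succ_ne_zero
    push_cast
    field_simp
  · rw [← PowerSeries.coeff_zero_eq_constantCoeff_apply, PowerSeries.coeff_mk]
    simp

/-- A power series with constant term `1` has an inverse square root. -/
theorem exists_sq_mul_eq_one {g : PowerSeries K} (hg : PowerSeries.constantCoeff g = 1) :
    ∃ y : PowerSeries K, PowerSeries.constantCoeff y = 1 ∧ y ^ 2 * g = 1 := by
  have hgi : g * g⁻¹ = 1 := PowerSeries.mul_inv_cancel _ (by rw [hg]; exact one_ne_zero)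
  obtain ⟨l, hl, hl0⟩ := exists_derivative_eq (-(half (PowerSeries K)
    * (PowerSeries.derivative K g * g⁻¹)))
  refine ⟨expSeries l, constantCoeff_expSeries hl0, ?_⟩
  refine eq_of_derivative_eq_mul (h := 0) ?_ ?_ ?_
  · rw [pow_two, derivative_mul', derivative_mul', derivative_expSeries hl0, hl]
    linear_combination (-(expSeries l) ^ 2 * PowerSeries.derivative K g)
      * (half_add_half (A := PowerSeries K))
      - 2 * half (PowerSeries K) * PowerSeries.derivative K g * (expSeries l) ^ 2 * hgi
  · rw [zero_mul, Derivation.map_one_eq_zero]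
  · rw [map_mul, map_pow, constantCoeff_expSeries hl0, hg]
    simp

theorem exists_sq_eq {g : PowerSeries ℝ} (hg : 0 < PowerSeries.constantCoeff g) :
    ∃ y : PowerSeries ℝ, y ^ 2 = g ∧ IsUnit y := by
  obtain ⟨c, hc⟩ : ∃ c, c = PowerSeries.constantCoeff g := ⟨_, rfl⟩
  rw [← hc] at hg
  obtain ⟨y, hy0, hy⟩ := exists_sq_mul_eq_one (g := PowerSeries.C c⁻¹ * g) (by
    rw [map_mul, PowerSeries.constantCoeff_C, ← hc, inv_mul_cancel₀ hg.ne'])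
  have h1 : (PowerSeries.C √c) ^ 2 * PowerSeries.C c⁻¹ = (1 : PowerSeries ℝ) := by
    rw [← map_pow, Real.sq_sqrt hg.le, ← map_mul, mul_inv_cancel₀ hg.ne', map_one]
  refine ⟨PowerSeries.C √c * (y * (PowerSeries.C c⁻¹ * g)), ?_, ?_⟩
  · linear_combination (PowerSeries.C √c) ^ 2 * PowerSeries.C c⁻¹ * g * hy + g * h1
  · rw [PowerSeries.isUnit_iff_constantCoeff, map_mul, map_mul, map_mul, hy0,
      PowerSeries.constantCoeff_C, PowerSeries.constantCoeff_C, ← hc, inv_mul_cancel₀ hg.ne']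
    simpa using (Real.sqrt_pos.2 hg).ne'

end SquareRoots

/-! ### Primitives of exact forms -/

section Exactness

theorem hom_aeval {A B : Type} [CommRing A] [Algebra ℚ A] [CommRing B] [Algebra ℚ B]
    (φ : A →+* B) (a : A) (p : ℚ[X]) : φ (aeval a p) = aeval (φ a) p :=
  (aeval_algHom_apply φ.toRatAlgHom a p).symm

theorem aeval_X_add_C_injective {K : Type} [Field K] [Algebra ℚ K] (c : K) {p : ℚ[X]}
    (h : aeval (PowerSeries.X + PowerSeries.C c) p = 0) : p = 0 := by
  have h1 := hom_aeval (Polynomial.coeToPowerSeries.ringHom (R := K)) (X + C c) p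
  have h2 : Polynomial.coeToPowerSeries.ringHom (R := K) (X + C c)
      = PowerSeries.X + PowerSeries.C c := by simp
  rw [h2, h, Polynomial.coeToPowerSeries.ringHom_apply, Polynomial.coe_eq_zero_iff] at h1
  have h3 : aeval (X + C c) p = (p.map (algebraMap ℚ K)).comp (X + C c) := by
    rw [comp, eval₂_map, aeval_def]
    rfl
  rw [h3, comp_X_add_C_eq_zero_iff, Polynomial.map_eq_zero] at h1
  exact h1

/-- A form `f(x + x⁻¹) / δ^(2 M) ω` that is exact is the differential of
`p(x + x⁻¹) / δ^(2 L) δ (x - x⁻¹)` for some `p` and `L`. -/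
theorem exists_theta_of_dR_eq {M : ℕ} {f : ℚ[X]} {h : CoordRing} (hh : dR h = frac M f • ω) :
    ∃ (L : ℕ) (p : ℚ[X]), f * polD ^ L = theta L p * polD ^ M := by
  obtain ⟨L, p₀, p₁, p₂, p₃, hp⟩ := isCombination h
  -- Expansion around ξ = 4, where ξ² - 4 = 12 and δ² = 5 are positive, so that real square roots
  -- exist.
  obtain ⟨χ, hχ⟩ : ∃ χ : PowerSeries ℝ, χ = PowerSeries.X + PowerSeries.C 4 := ⟨_, rfl⟩
  obtain ⟨W, hW, -⟩ := exists_sq_eq (g := χ ^ 2 - 4) (by rw [hχ]; simp [map_ofNat]; norm_num)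
  obtain ⟨D, hD, hDu⟩ := exists_sq_eq (g := χ ^ 2 - 2 * χ - 3) (by rw [hχ]; simp [map_ofNat]; norm_num)
  obtain ⟨E, hE⟩ := hDu.exists_left_inv
  let d : Derivation ℚ (PowerSeries ℝ) (PowerSeries ℝ) :=
    (PowerSeries.derivative ℝ).restrictScalars ℚ
  have hdχ : d χ = 1 := by
    change PowerSeries.derivative ℝ χ = 1
    rw [hχ, map_add, PowerSeries.derivative_X, PowerSeries.derivative_C, add_zero]
  have hfrac : ∀ (φ : CoordRing →+* PowerSeries ℝ) (n : ℕ) (q : ℚ[X]), φ ξ = χ →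
      φ δ ^ 2 = D ^ 2 → φ (inv δ ^ (2 * n)) = (E ^ 2) ^ n ∧
        φ (frac n q) = (E ^ 2) ^ n * aeval χ q := by
    intro φ n q h1 h2
    have h3 : φ (inv δ) ^ 2 = E ^ 2 := by
      have h4 := congrArg φ inv_δ_mul
      rw [map_mul, map_one] at h4
      linear_combination E ^ 2 * (φ (inv δ) * φ δ + 1) * h4 - φ (inv δ) ^ 2 * E ^ 2 * h2
        - φ (inv δ) ^ 2 * (E * D + 1) * hE
    have h5 : φ (inv δ ^ (2 * n)) = (E ^ 2) ^ n := by rw [map_pow, pow_mul, h3]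
    rw [frac_apply, map_mul, h5, hom_aeval, h1]
    exact ⟨rfl, rfl⟩
  have key : ∀ W' D' : PowerSeries ℝ, W' ^ 2 = W ^ 2 → D' ^ 2 = D ^ 2 → IsUnit D' →
      d ((E ^ 2) ^ L * (aeval χ p₀ + aeval χ p₁ * W' + aeval χ p₂ * D' + aeval χ p₃ * (D' * W')))
        * (D' * W') = (E ^ 2) ^ M * aeval χ f := by
    intro W' D' h1 h2 h3
    obtain ⟨φ, φ1, φ2, φ3⟩ := exists_hom_of_curve (h1.trans hW) (h2.trans hD) h3
    have h4 := derivation_of_dR_eq φ d hh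
    rw [φ1, hdχ, mul_one, (hfrac φ M f φ1 (by rw [φ3, h2])).2, map_mul φ δ, φ2, φ3, hp] at h4
    rw [map_mul, (hfrac φ L 0 φ1 (by rw [φ3, h2])).1] at h4
    simp only [map_add φ, map_mul φ, hom_aeval, φ1, φ2, φ3] at h4
    exact h4
  have key' : d ((E ^ 2) ^ L * (aeval χ p₃ * (D * W))) * (D * W)
      = (E ^ 2) ^ L * aeval χ (theta L p₃) := by
    obtain ⟨φ, φ1, φ2, φ3⟩ := exists_hom_of_curve hW hD hDu
    have h4 := derivation_of_dR_eq φ d (dR_frac_mul L p₃)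
    rw [φ1, hdχ, mul_one, (hfrac φ L _ φ1 (by rw [φ3])).2, map_mul φ, map_mul φ δ, φ2, φ3,
      (hfrac φ L _ φ1 (by rw [φ3])).2, mul_assoc] at h4
    exact h4
  -- Adding the four choices of signs of δ and w projects the primitive onto its δ w component,
  -- since the other components are even in δ or in w.
  have hsum : (4 : PowerSeries ℝ) * ((E ^ 2) ^ M * aeval χ f)
      = 4 * ((E ^ 2) ^ L * aeval χ (theta L p₃)) := by
    have k1 := key W D rfl rfl hDu
    have k2 := key (-W) D (by ring) rfl hDu
    have k3 := key W (-D) rfl (by ring) hDu.neg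
    have k4 := key (-W) (-D) (by ring) (by ring) hDu.neg
    rw [← key']
    have h5 : (E ^ 2) ^ L * (aeval χ p₃ * (D * W)) + (E ^ 2) ^ L * (aeval χ p₃ * (D * W))
        + (E ^ 2) ^ L * (aeval χ p₃ * (D * W)) + (E ^ 2) ^ L * (aeval χ p₃ * (D * W))
        = (E ^ 2) ^ L * (aeval χ p₀ + aeval χ p₁ * W + aeval χ p₂ * D + aeval χ p₃ * (D * W))
        - (E ^ 2) ^ L * (aeval χ p₀ + aeval χ p₁ * -W + aeval χ p₂ * D + aeval χ p₃ * (D * -W))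
        - (E ^ 2) ^ L * (aeval χ p₀ + aeval χ p₁ * W + aeval χ p₂ * -D + aeval χ p₃ * (-D * W))
        + (E ^ 2) ^ L * (aeval χ p₀ + aeval χ p₁ * -W + aeval χ p₂ * -D
          + aeval χ p₃ * (-D * -W)) := by
      ring
    have h6 := congrArg d h5
    simp only [map_add d, map_sub d] at h6
    linear_combination -k1 - k2 - k3 - k4 - (D * W) * h6
  have h7 : (E ^ 2) ^ M * aeval χ f = (E ^ 2) ^ L * aeval χ (theta L p₃) := by
    have h4 : PowerSeries.C (4⁻¹ : ℝ) * (4 : PowerSeries ℝ) = 1 := by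
      have : (4 : PowerSeries ℝ) = PowerSeries.C 4 := rfl
      rw [this, ← map_mul]
      norm_num
    linear_combination PowerSeries.C (4⁻¹ : ℝ) * hsum
      + ((E ^ 2) ^ L * aeval χ (theta L p₃) - (E ^ 2) ^ M * aeval χ f) * h4
  refine ⟨L, p₃, sub_eq_zero.1 (aeval_X_add_C_injective (4 : ℝ) ?_)⟩
  rw [← hχ, map_sub, map_mul, map_mul, map_pow, map_pow, aeval_polD_eq, ← hD]
  have h8 : ∀ n, (E ^ 2) ^ n * (D ^ 2) ^ n = 1 := fun n => by
    rw [← mul_pow, ← mul_pow, hE, one_pow, one_pow]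
  linear_combination (D ^ 2) ^ M * (D ^ 2) ^ L * h7 - aeval χ f * (D ^ 2) ^ L * h8 M
    + aeval χ (theta L p₃) * (D ^ 2) ^ M * h8 L

theorem coeff_theta {L e : ℕ} {p : ℚ[X]} (hp : p.natDegree ≤ e) :
    (theta L p).coeff (e + 3) = (e + 2 - 2 * L) * p.coeff e := by
  have h1 : theta L p = (X * polD + C (1 / 2 - L : ℚ) * polA * (2 * X - 2)) * p
      + polA * polD * derivative p := by rw [theta]; ring
  obtain ⟨c, hc⟩ : ∃ c : ℚ, c = 1 / 2 - L := ⟨_, rfl⟩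
  have h2 : X * polD + C (1 / 2 - L : ℚ) * polA * (2 * X - 2) = C (1 + 2 * c) * X ^ 3
      + C (-2 - 2 * c) * X ^ 2 + C (-3 - 8 * c) * X + C (8 * c) := by
    rw [← hc, polA, polD]
    have e2 : (C 2 : ℚ[X]) = 2 := rfl
    have e3 : (C 3 : ℚ[X]) = 3 := rfl
    have e8 : (C 8 : ℚ[X]) = 8 := rfl
    simp only [C_add, C_sub, C_mul, C_1, C_neg, e2, e3, e8]
    ring
  have h3 : polA * polD = X ^ 4 - 2 * X ^ 3 - 7 * X ^ 2 + 8 * X + 12 := by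
    rw [polA, polD]
    ring
  have h4 : (polA * polD).natDegree ≤ 4 := by rw [h3]; compute_degree
  have h5 : (polA * polD).coeff 4 = 1 := by rw [h3]; compute_degree <;> norm_num
  rw [h1, coeff_add, add_comm e 3, coeff_mul_add_eq_of_natDegree_le (df := 3) (by
    rw [h2]; compute_degree) hp]
  have h6 : (polA * polD * derivative p).coeff (3 + e) = e * p.coeff e := by
    cases e with
    | zero => rw [derivative_of_natDegree_zero (by omega)]; simp
    | succ e =>
      rw [show 3 + (e + 1) = 4 + e by ring, coeff_mul_add_eq_of_natDegree_le h4
        ((natDegree_derivative_le p).trans (by omega)), h5, coeff_derivative]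
      push_cast
      ring
  have h7 : (X * polD + C (1 / 2 - L : ℚ) * polA * (2 * X - 2)).coeff 3 = 1 + 2 * c := by
    rw [h2]
    simp only [coeff_add, coeff_C_mul, coeff_X_pow, coeff_X, coeff_C]
    norm_num
  rw [h6, h7, hc]
  ring

/-- If deg p + 2 > 2 L, the factor deg p + 2 - 2 L of the top coefficient of `theta` L p is nonzero,
so no cancellation occurs at infinity. This bounds the primitive by the form. -/
theorem natDegree_add_two_le_of_theta {L : ℕ} {p : ℚ[X]} (hp : p ≠ 0)
    (h : (theta L p).natDegree ≤ 2 * L) : p.natDegree + 2 ≤ 2 * L := by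
  by_contra! hlt
  have h1 := coeff_theta (L := L) (le_refl p.natDegree)
  have h2 : (theta L p).coeff (p.natDegree + 3) = 0 := coeff_eq_zero_of_natDegree_lt (by omega)
  rw [h2] at h1
  refine mul_ne_zero ?_ (leadingCoeff_ne_zero.2 hp) h1.symm
  have : (2 * L : ℚ) < p.natDegree + 2 := by exact_mod_cast hlt
  intro h3
  linarith

end Exactness

end FigureEight

end

noncomputable section

namespace FigureEight

set_option linter.unusedSectionVars false

open Polynomial

/-! ### Functionals on the cohomology

The zeros of `polD` are `1 + e / 2` for `e = 4` and `e = -4`; expansions at such a zero are power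
series in a variable `s`, with `polD = s (s + e)`. -/

section LocalExpansions

/-- The coordinate expanded at a zero of `polD`. -/
def chi (e : ℚ) : PowerSeries ℚ := PowerSeries.X + PowerSeries.C (1 + e / 2)

/-- The inverse of `s + e`. -/
def invS (e : ℚ) : PowerSeries ℚ := PowerSeries.mk fun n => e⁻¹ * (-e⁻¹) ^ n

/-- The expansion of `polD * polA / s`. -/
def serC (e : ℚ) : PowerSeries ℚ := (PowerSeries.X + PowerSeries.C e) * (chi e ^ 2 - 4)

/-- The inverse square root of `serC e`, divided by its constant term. -/
def rootC (e : ℚ) : PowerSeries ℚ := Classical.epsilon fun y =>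
  PowerSeries.constantCoeff y = 1 ∧ y ^ 2 * (PowerSeries.C (e + 16)⁻¹ * serC e) = 1

/-- The series `K` with `s K' - K / 2 = rootC e * n * invS e`. -/
def serK (e : ℚ) (n : ℚ[X]) : PowerSeries ℚ := PowerSeries.mk fun i =>
  2 / (2 * i - 1) * PowerSeries.coeff i (rootC e * (aeval (chi e) n * invS e))

/-- The solution `κ` of `s c κ' - c κ / 2 + s c' κ / 2 = n / (s + e)` with `c = serC e`. -/
def serKappa (e : ℚ) (n : ℚ[X]) : PowerSeries ℚ := PowerSeries.C (e + 16)⁻¹ * (serK e n * rootC e)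

variable {e : ℚ}

theorem add_mul_invS (he : e ^ 2 = 16) : (PowerSeries.X + PowerSeries.C e) * invS e = 1 := by
  have he0 : e ≠ 0 := by rintro rfl; norm_num at he
  ext n
  rw [add_mul, map_add, PowerSeries.coeff_C_mul, invS]
  cases n with
  | zero => simp [he0]
  | succ n =>
    rw [PowerSeries.coeff_succ_X_mul, PowerSeries.coeff_mk, PowerSeries.coeff_mk,
      PowerSeries.coeff_one, if_neg (Nat.succ_ne_zero n), pow_succ]
    field_simp
    ring

theorem C_sq_eq (he : e ^ 2 = 16) : (PowerSeries.C (e / 2)) ^ 2 = (4 : PowerSeries ℚ) := by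
  rw [← map_pow, div_pow, he]
  norm_num
  rfl

theorem C_half_add (e : ℚ) : PowerSeries.C (e / 2) + PowerSeries.C (e / 2) = PowerSeries.C e := by
  rw [← map_add, add_halves]

theorem aeval_chi_polD (he : e ^ 2 = 16) :
    aeval (chi e) polD = PowerSeries.X * (PowerSeries.X + PowerSeries.C e) := by
  rw [aeval_polD_eq, chi, map_add, map_one]
  linear_combination C_sq_eq he + PowerSeries.X * C_half_add e

theorem aeval_chi_derivative_polD :
    aeval (chi e) (2 * X - 2 : ℚ[X]) = PowerSeries.X + (PowerSeries.X + PowerSeries.C e) := by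
  rw [aeval_two_mul_X_sub_two, chi, map_add, map_one]
  linear_combination C_half_add e

theorem derivative_chi : PowerSeries.derivative ℚ (chi e) = 1 := by
  rw [chi, map_add, PowerSeries.derivative_X, PowerSeries.derivative_C, add_zero]

theorem derivative_aeval_chi (p : ℚ[X]) :
    PowerSeries.derivative ℚ (aeval (chi e) p) = aeval (chi e) (derivative p) := by
  rw [Derivation.map_aeval, derivative_chi, smul_eq_mul, mul_one]

theorem derivative_invS (he : e ^ 2 = 16) :
    PowerSeries.derivative ℚ (invS e) = -invS e ^ 2 := by
  have h := congrArg (PowerSeries.derivative ℚ) (add_mul_invS he)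
  rw [derivative_mul', map_add, PowerSeries.derivative_X, PowerSeries.derivative_C,
    Derivation.map_one_eq_zero] at h
  linear_combination invS e * h - PowerSeries.derivative ℚ (invS e) * add_mul_invS he

theorem derivative_pow' (f : PowerSeries ℚ) (n : ℕ) :
    PowerSeries.derivative ℚ (f ^ n) = n * f ^ (n - 1) * PowerSeries.derivative ℚ f := by
  rw [Derivation.leibniz_pow, nsmul_eq_mul, smul_eq_mul, mul_assoc]

theorem derivative_invS_pow (he : e ^ 2 = 16) (n : ℕ) :
    PowerSeries.derivative ℚ (invS e ^ n) = -(n : PowerSeries ℚ) * invS e ^ (n + 1) := by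
  rw [derivative_pow', derivative_invS he]
  cases n with
  | zero => simp
  | succ n =>
    rw [Nat.add_sub_cancel]
    ring

theorem add_sixteen_ne_zero (he : e ^ 2 = 16) : e + 16 ≠ 0 := by
  intro h
  have : e = -16 := by linarith
  rw [this] at he
  norm_num at he

theorem constantCoeff_chi : PowerSeries.constantCoeff (chi e) = 1 + e / 2 := by
  simp [chi]

theorem constantCoeff_serC (he : e ^ 2 = 16) : PowerSeries.constantCoeff (serC e) = e + 16 := by
  have h4 : PowerSeries.constantCoeff (4 : PowerSeries ℚ) = 4 := map_ofNat _ 4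
  rw [serC, map_mul, map_add, map_sub, map_pow, constantCoeff_chi, h4,
    PowerSeries.constantCoeff_X, PowerSeries.constantCoeff_C]
  linear_combination (1 + e / 4) * he

theorem rootC_spec (he : e ^ 2 = 16) : PowerSeries.constantCoeff (rootC e) = 1 ∧
    rootC e ^ 2 * (PowerSeries.C (e + 16)⁻¹ * serC e) = 1 := by
  refine Classical.epsilon_spec (exists_sq_mul_eq_one (g := PowerSeries.C (e + 16)⁻¹ * serC e) ?_)
  rw [map_mul, constantCoeff_serC he, PowerSeries.constantCoeff_C,
    inv_mul_cancel₀ (add_sixteen_ne_zero he)]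

theorem serK_ode (n : ℚ[X]) :
    PowerSeries.X * PowerSeries.derivative ℚ (serK e n) - PowerSeries.C (1 / 2) * serK e n
      = rootC e * (aeval (chi e) n * invS e) := by
  ext i
  have h : (2 : ℚ) * i - 1 ≠ 0 := by
    intro h
    have : (2 * i : ℤ) = 1 := by exact_mod_cast (by linarith : (2 : ℚ) * i = 1)
    omega
  rw [map_sub, PowerSeries.coeff_C_mul]
  have h2 : PowerSeries.coeff i (PowerSeries.X * PowerSeries.derivative ℚ (serK e n))
      = i * PowerSeries.coeff i (serK e n) := by
    cases i with
    | zero => simp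
    | succ i =>
      rw [PowerSeries.coeff_succ_X_mul, PowerSeries.coeff_derivative]
      push_cast
      ring
  rw [h2, serK, PowerSeries.coeff_mk]
  generalize PowerSeries.coeff i (rootC e * (aeval (chi e) n * invS e)) = a
  have h3 : 2 / (2 * (i : ℚ) - 1) * (2 * i - 1) = 2 := div_mul_cancel₀ _ h
  linear_combination a / 2 * h3

/-- The meaning of the equation is that (κ / s) δ w is a formal primitive of n δ^(-2) ω at the zero
of `polD`, as (δ w)² = s c. Splitting off the inverse square root of c reduces it to `serK_ode`. -/
theorem serKappa_ode (he : e ^ 2 = 16) (n : ℚ[X]) :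
    PowerSeries.X * serC e * PowerSeries.derivative ℚ (serKappa e n)
      + PowerSeries.C (1 / 2) * (PowerSeries.X * PowerSeries.derivative ℚ (serC e)
        * serKappa e n - serC e * serKappa e n) = aeval (chi e) n * invS e := by
  obtain ⟨-, h1⟩ := rootC_spec he
  have h2 := serK_ode (e := e) n
  rw [serKappa, derivative_mul', derivative_mul', PowerSeries.derivative_C]
  have h3 := congrArg (PowerSeries.derivative ℚ) h1
  rw [derivative_mul', derivative_mul', PowerSeries.derivative_C, pow_two, derivative_mul',
    Derivation.map_one_eq_zero] at h3
  have h4 : PowerSeries.C (1 / 2) * 2 = (1 : PowerSeries ℚ) := by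
    have : (2 : PowerSeries ℚ) = PowerSeries.C 2 := rfl
    rw [this, ← map_mul]
    norm_num
  generalize PowerSeries.C (e + 16)⁻¹ = a at *
  generalize PowerSeries.C (1 / 2 : ℚ) = b at *
  generalize PowerSeries.derivative ℚ (rootC e) = r' at *
  generalize PowerSeries.derivative ℚ (serK e n) = k' at *
  generalize PowerSeries.derivative ℚ (serC e) = c' at *
  generalize rootC e = r at *
  generalize serK e n = k at *
  generalize serC e = c at *
  have h5 : r' * (a * c) + b * (a * c') * r = 0 := by
    linear_combination r * (a * c) * b * h3 - r ^ 2 * r' * (a * c) ^ 2 * h4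
      - (r' * (a * c) + b * (a * c') * r) * h1
  linear_combination a * c * r * h2 + PowerSeries.X * k * h5 + aeval (chi e) n * invS e * h1

end LocalExpansions

end FigureEight

end

noncomputable section

namespace FigureEight

set_option linter.unusedSectionVars false

open Polynomial

section Functionals

/-- The contribution of one zero of `polD` to the functional `lam`. -/
def lamAt (e : ℚ) (n : ℚ[X]) (M : ℕ) : ℚ[X] →ₗ[ℚ] ℚ :=
  (PowerSeries.coeff M).comp
    ((LinearMap.mulLeft ℚ (serKappa e n * invS e ^ M)).comp (aeval (chi e)).toLinearMap)

/-- A functional on the forms `f(x + x⁻¹) / δ^(2 M) ω`, which vanishes on the exact forms if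
`f` and `n` have degrees at most `2 M` and `2`: the sum over the zeros of `polD` of the residues
of the product of `f / polD ^ M` and `serKappa`, divided by `s`. -/
def lam (n : ℚ[X]) (M : ℕ) : ℚ[X] →ₗ[ℚ] ℚ := lamAt 4 n M + lamAt (-4) n M

variable {e : ℚ}

theorem lamAt_apply (n : ℚ[X]) (M : ℕ) (f : ℚ[X]) : lamAt e n M f
    = PowerSeries.coeff M (serKappa e n * invS e ^ M * aeval (chi e) f) := rfl

theorem lam_apply (n : ℚ[X]) (M : ℕ) (f : ℚ[X]) : lam n M f = lamAt 4 n M f + lamAt (-4) n M f :=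
  rfl

theorem sq_four : (4 : ℚ) ^ 2 = 16 := by norm_num

theorem sq_neg_four : (-4 : ℚ) ^ 2 = 16 := by norm_num

theorem coeff_succ_invS_mul (he : e ^ 2 = 16) (M : ℕ) (a : PowerSeries ℚ) (g : ℚ[X]) :
    PowerSeries.coeff (M + 1) (a * invS e * aeval (chi e) (polD * g))
      = PowerSeries.coeff M (a * aeval (chi e) g) := by
  rw [← PowerSeries.coeff_succ_X_mul M (a * _), map_mul (aeval (chi e)), aeval_chi_polD he]
  refine congrArg (PowerSeries.coeff (M + 1)) ?_
  linear_combination PowerSeries.X * a * aeval (chi e) g * add_mul_invS he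

theorem lam_succ (n : ℚ[X]) (M : ℕ) (f : ℚ[X]) : lam n (M + 1) (polD * f) = lam n M f := by
  rw [lam_apply, lam_apply, lamAt_apply, lamAt_apply, lamAt_apply, lamAt_apply, pow_succ, pow_succ,
    ← mul_assoc, ← mul_assoc, coeff_succ_invS_mul sq_four, coeff_succ_invS_mul sq_neg_four]

theorem lam_add_pow (n : ℚ[X]) (M L : ℕ) (f : ℚ[X]) : lam n (M + L) (f * polD ^ L) = lam n M f := by
  induction L with
  | zero => simp
  | succ L ih =>
    have h : f * polD ^ (L + 1) = polD * (f * polD ^ L) := by ring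
    rw [← ih, h, ← add_assoc, lam_succ]

/-! ### The sum of the residues of a rational function -/

theorem coeff_derivative_invS_pow (he : e ^ 2 = 16) (L : ℕ) :
    PowerSeries.coeff (L + 1) (invS e ^ (L + 1)) + PowerSeries.coeff L (invS e ^ (L + 2)) = 0 := by
  have h := congrArg (PowerSeries.coeff L) (derivative_invS_pow he (L + 1))
  have h1 : -((L + 1 : ℕ) : PowerSeries ℚ) = PowerSeries.C (-((L : ℚ) + 1)) := by
    rw [map_neg, map_add, map_one, map_natCast]
    push_cast
    rfl
  rw [h1, PowerSeries.coeff_C_mul, PowerSeries.coeff_derivative] at h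
  have h2 : (L : ℚ) + 1 ≠ 0 := by exact_mod_cast L.succ_ne_zero
  apply mul_left_cancel₀ h2
  linear_combination h

theorem rescale_invS (e : ℚ) : PowerSeries.rescale (-1) (invS e) = -invS (-e) := by
  ext n
  rw [PowerSeries.coeff_rescale, map_neg, invS, invS, PowerSeries.coeff_mk, PowerSeries.coeff_mk,
    inv_neg, neg_neg, mul_left_comm, ← mul_pow]
  ring_nf

/-- The reflection s ↦ -s exchanges the two zeros of `polD`, and the residues of 1 / `polD` ^ (L +
1) there are opposite. -/
theorem coeff_invS_pow_add (L : ℕ) : PowerSeries.coeff L (invS 4 ^ (L + 1))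
    + PowerSeries.coeff L (invS (-4) ^ (L + 1)) = 0 := by
  have h : PowerSeries.coeff L (PowerSeries.rescale (-1) (invS 4 ^ (L + 1)))
      = PowerSeries.coeff L ((-invS (-4)) ^ (L + 1)) := by
    rw [map_pow (PowerSeries.rescale (-1 : ℚ)), rescale_invS]
  rw [PowerSeries.coeff_rescale] at h
  have h1 : (-invS (-4)) ^ (L + 1) = PowerSeries.C ((-1) ^ (L + 1)) * invS (-4) ^ (L + 1) := by
    rw [neg_pow, map_pow, map_neg, map_one]
  rw [h1, PowerSeries.coeff_C_mul, pow_succ (-1 : ℚ)] at h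
  have h2 : ((-1 : ℚ) ^ L) ≠ 0 := pow_ne_zero _ (by norm_num)
  apply mul_left_cancel₀ h2
  linear_combination h

theorem exists_eq_polD_mul_add {L : ℕ} {g : ℚ[X]} (hg : g.natDegree ≤ 2 * (L + 1)) :
    ∃ (q : ℚ[X]) (a b : ℚ), g = polD * q + C a + C b * (2 * X - 2) ∧ q.natDegree ≤ 2 * L := by
  obtain ⟨a, ha⟩ : ∃ a, a = (g.eval 3 + g.eval (-1)) / 2 := ⟨_, rfl⟩
  obtain ⟨b, hb⟩ : ∃ b, b = (g.eval 3 - g.eval (-1)) / 8 := ⟨_, rfl⟩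
  obtain ⟨q, hq⟩ := polD_dvd (f := g - (C a + C b * (2 * X - 2))) (by
      simp [ha, hb]; ring) (by simp [ha, hb]; ring)
  refine ⟨q, a, b, by rw [add_assoc, ← hq]; ring, ?_⟩
  by_cases hq0 : q = 0
  · simp [hq0]
  have h5 : (polD * q).natDegree ≤ 2 * (L + 1) := by
    rw [← hq]
    have h1 : (C a + C b * (2 * X - 2) : ℚ[X]).natDegree ≤ 1 := by compute_degree
    refine (natDegree_sub_le_of_le hg h1).trans ?_
    omega
  rw [natDegree_mul polD_ne_zero hq0, natDegree_polD] at h5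
  omega

/-- The residues of `g / polD ^ (L + 1)` at the zeros of `polD` add up to zero. -/
theorem sum_residues_eq_zero {L : ℕ} {g : ℚ[X]} (hg : g.natDegree ≤ 2 * L) :
    PowerSeries.coeff L (invS 4 ^ (L + 1) * aeval (chi 4) g)
      + PowerSeries.coeff L (invS (-4) ^ (L + 1) * aeval (chi (-4)) g) = 0 := by
  have hconst : ∀ (e a : ℚ) (n k : ℕ), PowerSeries.coeff n (invS e ^ k * aeval (chi e) (C a))
      = a * PowerSeries.coeff n (invS e ^ k) := by
    intro e a n k
    have : aeval (chi e) (C a) = PowerSeries.C a := by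
      rw [aeval_C]
      rfl
    rw [this, mul_comm, PowerSeries.coeff_C_mul]
  induction L generalizing g with
  | zero =>
    rw [eq_C_of_natDegree_le_zero hg, hconst, hconst]
    linear_combination g.coeff 0 * coeff_invS_pow_add 0
  | succ L ih =>
    obtain ⟨q, a, b, rfl, hq⟩ := exists_eq_polD_mul_add hg
    -- Here 2 X - 2 is the derivative of `polD`, so the quotient by `polD` ^ (L + 2) is itself a
    -- derivative and has no residue.
    have hder : ∀ e : ℚ, e ^ 2 = 16 →
        PowerSeries.coeff (L + 1) (invS e ^ (L + 2) * aeval (chi e) (C b * (2 * X - 2))) = 0 := by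
      intro e he
      have h1 : invS e ^ (L + 2) * aeval (chi e) (C b * (2 * X - 2))
          = PowerSeries.C b * (invS e ^ (L + 1) + PowerSeries.X * invS e ^ (L + 2)) := by
        rw [map_mul (aeval (chi e)), aeval_chi_derivative_polD, aeval_C]
        change _ * (PowerSeries.C b * _) = _
        linear_combination PowerSeries.C b * invS e ^ (L + 1) * add_mul_invS he
      rw [h1, PowerSeries.coeff_C_mul, map_add, PowerSeries.coeff_succ_X_mul,
        coeff_derivative_invS_pow he, mul_zero]
    simp only [map_add, mul_add]
    rw [hder _ sq_four, hder _ sq_neg_four, hconst, hconst, pow_succ, pow_succ (invS (-4)),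
      coeff_succ_invS_mul sq_four, coeff_succ_invS_mul sq_neg_four, ← pow_succ, ← pow_succ]
    linear_combination ih hq + a * coeff_invS_pow_add (L + 1)

/-! ### Vanishing on exact forms -/

/-- Integration by parts: the residue of a primitive of n δ^(-2) ω times an exact form dh is minus
the residue of h n δ^(-2) ω. -/
theorem lamAt_theta (he : e ^ 2 = 16) (n : ℚ[X]) (L : ℕ) (p : ℚ[X]) : lamAt e n L (theta L p)
    = -PowerSeries.coeff L (invS e ^ (L + 1) * aeval (chi e) (p * n)) := by
  -- The product of the two primitives is y s^(-L); `h0` says that its derivative has no residue.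
  obtain ⟨y, hy⟩ : ∃ y, y = serKappa e n * serC e * aeval (chi e) p * invS e ^ L := ⟨_, rfl⟩
  have h0 : PowerSeries.coeff L (PowerSeries.X * PowerSeries.derivative ℚ y - PowerSeries.C (L : ℚ) * y)
      = 0 := by
    rw [map_sub, PowerSeries.coeff_C_mul]
    cases L with
    | zero => simp
    | succ L =>
      rw [PowerSeries.coeff_succ_X_mul, PowerSeries.coeff_derivative]
      push_cast
      ring
  rw [lamAt_apply, ← sub_eq_zero, sub_neg_eq_add, ← map_add, ← h0]
  refine congrArg (PowerSeries.coeff L) ?_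
  rw [hy, derivative_mul', derivative_mul', derivative_mul', derivative_invS_pow he,
    derivative_aeval_chi, theta]
  simp only [map_add (aeval (chi e)), map_mul (aeval (chi e)), aeval_chi_polD he,
    aeval_chi_derivative_polD, aeval_X, aeval_polA_eq]
  have h1 : aeval (chi e) (C (1 / 2 - L : ℚ)) = PowerSeries.C (1 / 2) - PowerSeries.C (L : ℚ) := by
    rw [aeval_C, ← map_sub]
    rfl
  have h2 : (L : PowerSeries ℚ) = PowerSeries.C (L : ℚ) := (map_natCast _ _).symm
  have h3 := serKappa_ode he n
  have h4 : PowerSeries.C (1 / 2) * 2 = (1 : PowerSeries ℚ) := by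
    have : (2 : PowerSeries ℚ) = PowerSeries.C 2 := rfl
    rw [this, ← map_mul]
    norm_num
  have h5 : PowerSeries.derivative ℚ (serC e)
      = chi e ^ 2 - 4 + 2 * (PowerSeries.X + PowerSeries.C e) * chi e := by
    have h6 : PowerSeries.derivative ℚ (4 : PowerSeries ℚ) = 0 :=
      Derivation.map_natCast (PowerSeries.derivative ℚ) 4
    rw [serC, derivative_mul', map_add, map_sub, PowerSeries.derivative_X, PowerSeries.derivative_C,
      pow_two, derivative_mul', derivative_chi, h6]
    ring
  have h6 := add_mul_invS he
  rw [h1, h2]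
  rw [h5] at h3 ⊢
  rw [serC] at h3 ⊢
  generalize PowerSeries.C (1 / 2 : ℚ) = b at *
  generalize PowerSeries.derivative ℚ (serKappa e n) = k' at *
  generalize serKappa e n = k at *
  generalize aeval (chi e) p = P at *
  generalize aeval (chi e) (derivative p) = P' at *
  generalize aeval (chi e) n = N at *
  generalize PowerSeries.C (L : ℚ) = l at *
  generalize invS e = E at *
  generalize hh : PowerSeries.X + PowerSeries.C e = h at *
  generalize chi e = c at *
  linear_combination (-(P * E ^ L)) * h3
    + k * P * E ^ L * (c * PowerSeries.X * h + (c ^ 2 - 4) * PowerSeries.X) * h4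
    + k * P * E ^ L * l * (c ^ 2 - 4) * PowerSeries.X * h6

theorem lam_theta {n : ℚ[X]} (hn : n.natDegree ≤ 2) {L : ℕ} {p : ℚ[X]}
    (hp : p.natDegree + 2 ≤ 2 * L) : lam n L (theta L p) = 0 := by
  rw [lam_apply, lamAt_theta sq_four, lamAt_theta sq_neg_four, ← neg_add, sum_residues_eq_zero,
    neg_zero]
  exact natDegree_mul_le.trans (by omega)

/-- A primitive may be taken of the form measured by `theta`; the degree of f bounds the degree of
p, and then the residues at the two zeros of `polD` exhaust those of the rational function left by
integration by parts. -/
theorem lam_eq_zero_of_fracCls {n : ℚ[X]} (hn : n.natDegree ≤ 2) {M : ℕ} {f : ℚ[X]}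
    (hf : f.natDegree ≤ 2 * M) (h : fracCls M f = 0) : lam n M f = 0 := by
  obtain ⟨g, hg⟩ := (fracCls_eq_zero_iff M f).1 h
  obtain ⟨L, p, hp⟩ := exists_theta_of_dR_eq hg
  have h1 : lam n M f = lam n L (theta L p) := by
    rw [← lam_add_pow n M L f, hp, add_comm, lam_add_pow]
  rw [h1]
  by_cases hp0 : p = 0
  · rw [hp0]
    simp [theta]
  refine lam_theta hn (natDegree_add_two_le_of_theta hp0 ?_)
  by_cases ht : theta L p = 0
  · simp [ht]
  have h2 := congrArg natDegree hp
  rw [natDegree_mul ht (pow_ne_zero _ polD_ne_zero), natDegree_pow, natDegree_polD] at h2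
  have h3 : (f * polD ^ L).natDegree ≤ 2 * M + L * 2 := by
    refine natDegree_mul_le_of_le hf ?_
    rw [natDegree_pow, natDegree_polD]
  omega

end Functionals

end FigureEight

end

noncomputable section

namespace FigureEight

set_option linter.unusedSectionVars false

open Polynomial

/-! ### The matrix of the residue pairing and the formulas for the coefficients -/

section Values

variable {e : ℚ}

theorem coeff_one_X_mul (f : PowerSeries ℚ) :
    PowerSeries.coeff 1 (PowerSeries.X * f) = PowerSeries.constantCoeff f := by
  rw [← zero_add 1, PowerSeries.coeff_succ_X_mul, PowerSeries.coeff_zero_eq_constantCoeff_apply]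

theorem constantCoeff_serKappa (he : e ^ 2 = 16) (n : ℚ[X]) :
    (e + 16) * PowerSeries.constantCoeff (serKappa e n)
      = -2 * PowerSeries.constantCoeff (aeval (chi e) n * invS e) := by
  rw [← serKappa_ode he, map_add, map_mul, map_mul, PowerSeries.constantCoeff_X, map_mul, map_sub,
    map_mul, map_mul, map_mul, PowerSeries.constantCoeff_X, constantCoeff_serC he,
    PowerSeries.constantCoeff_C]
  ring

theorem coeff_one_serKappa (he : e ^ 2 = 16) (n : ℚ[X]) :
    (e + 16) * PowerSeries.coeff 1 (serKappa e n)
      = 2 * PowerSeries.coeff 1 (aeval (chi e) n * invS e) := by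
  have hd : ∀ f : PowerSeries ℚ, PowerSeries.constantCoeff (PowerSeries.derivative ℚ f)
      = PowerSeries.coeff 1 f := by
    intro f
    rw [← PowerSeries.coeff_zero_eq_constantCoeff_apply, PowerSeries.coeff_derivative]
    simp
  rw [← serKappa_ode he, map_add, PowerSeries.coeff_C_mul, map_sub, mul_assoc, mul_assoc,
    coeff_one_X_mul, coeff_one_X_mul, map_mul, map_mul, hd, hd, PowerSeries.coeff_one_mul,
    constantCoeff_serC he]
  ring

theorem constantCoeff_invS : PowerSeries.constantCoeff (invS e) = e⁻¹ := by
  rw [← PowerSeries.coeff_zero_eq_constantCoeff_apply, invS, PowerSeries.coeff_mk]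
  simp

theorem coeff_one_invS : PowerSeries.coeff 1 (invS e) = -(e⁻¹ * e⁻¹) := by
  rw [invS, PowerSeries.coeff_mk]
  ring

theorem coeff_one_chi : PowerSeries.coeff 1 (chi e) = 1 := by
  rw [chi, map_add, PowerSeries.coeff_one_X, PowerSeries.coeff_C]
  simp

theorem lamAt_one_apply (n f : ℚ[X]) : lamAt e n 1 f
    = (PowerSeries.coeff 1 (serKappa e n) * e⁻¹
        - e⁻¹ * e⁻¹ * PowerSeries.constantCoeff (serKappa e n))
        * PowerSeries.constantCoeff (aeval (chi e) f)
      + PowerSeries.constantCoeff (serKappa e n) * e⁻¹ * PowerSeries.coeff 1 (aeval (chi e) f) := by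
  rw [lamAt_apply, pow_one, PowerSeries.coeff_one_mul, PowerSeries.coeff_one_mul, map_mul,
    constantCoeff_invS, coeff_one_invS]
  ring

theorem serKappa_one_values (he : e ^ 2 = 16) :
    PowerSeries.constantCoeff (serKappa e 1) = -2 * e⁻¹ / (e + 16) ∧
    PowerSeries.coeff 1 (serKappa e 1) = -2 * (e⁻¹ * e⁻¹) / (e + 16) := by
  have h0 := add_sixteen_ne_zero he
  have h1 := constantCoeff_serKappa he 1
  have h2 := coeff_one_serKappa he 1
  rw [map_one, one_mul, constantCoeff_invS] at h1
  rw [map_one, one_mul, coeff_one_invS] at h2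
  constructor <;> rw [eq_div_iff h0]
  · linear_combination h1
  · linear_combination h2

theorem serKappa_X_values (he : e ^ 2 = 16) :
    PowerSeries.constantCoeff (serKappa e X) = -2 * ((1 + e / 2) * e⁻¹) / (e + 16) ∧
    PowerSeries.coeff 1 (serKappa e X) = 2 * (e⁻¹ - (1 + e / 2) * (e⁻¹ * e⁻¹)) / (e + 16) := by
  have h0 := add_sixteen_ne_zero he
  have h1 := constantCoeff_serKappa he X
  have h2 := coeff_one_serKappa he X
  rw [aeval_X, map_mul, constantCoeff_invS, constantCoeff_chi] at h1
  rw [aeval_X, PowerSeries.coeff_one_mul, coeff_one_invS, coeff_one_chi, constantCoeff_invS,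
    constantCoeff_chi] at h2
  constructor <;> rw [eq_div_iff h0]
  · linear_combination h1
  · linear_combination h2

/-- The pairing of δ^(-2) ω and ξ δ^(-2) ω is antisymmetric and nondegenerate, so n = 1 and n = X
suffice to separate the classes of ω and ω'. -/
theorem lam_values : lam 1 1 1 = 0 ∧ lam 1 1 X = -1 / 60 ∧ lam X 1 1 = 1 / 60 ∧ lam X 1 X = 0 := by
  obtain ⟨a1, a2⟩ := serKappa_one_values sq_four
  obtain ⟨b1, b2⟩ := serKappa_one_values sq_neg_four
  obtain ⟨c1, c2⟩ := serKappa_X_values sq_four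
  obtain ⟨d1, d2⟩ := serKappa_X_values sq_neg_four
  have o1 : PowerSeries.coeff 1 (1 : PowerSeries ℚ) = 0 := by
    rw [PowerSeries.coeff_one, if_neg one_ne_zero]
  refine ⟨?_, ?_, ?_, ?_⟩ <;>
  · simp only [lam_apply, lamAt_one_apply, a1, a2, b1, b2, c1, c2, d1, d2, aeval_X, map_one, o1,
      coeff_one_chi, constantCoeff_chi]
    norm_num

theorem lam_zero_one {n : ℚ[X]} (hn : n.natDegree ≤ 2) :
    lam n 0 1 = -7 * lam n 1 1 - lam n 1 X := by
  have h1 := lam_theta hn (L := 1) (p := 1) (by simp)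
  rw [theta_one_one] at h1
  have h2 : lam n 0 1 - (-7 * lam n 1 1 - lam n 1 X) = lam n 1 (- X ^ 2 + X - 4) * (-1) := by
    rw [← lam_succ, zero_add, mul_one, ← smul_eq_mul, ← smul_eq_mul _ (-1 : ℚ), ← map_smul,
      smul_eq_mul _ (-1 : ℚ), mul_neg_one, ← map_neg, ← map_sub, ← map_sub]
    have h : (C (-7) : ℚ[X]) = -7 := by rw [C_neg]; rfl
    refine congrArg (lam n 1) ?_
    rw [smul_eq_C_mul, h, polD]
    ring
  rw [h1, zero_mul] at h2
  linarith

theorem lam_three_polN {n : ℚ[X]} (hn : n.natDegree ≤ 2) :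
    675 * lam n 3 polN = 51 * lam n 1 1 - 19 * lam n 1 X := by
  have h1 := lam_theta hn (L := 1) (p := 1) (by simp)
  rw [theta_one_one] at h1
  have h2 := lam_theta hn (L := 3) (p := -396 + 75 * X + 13 * X ^ 2 - 8 * X ^ 3) (by
    have : (-396 + 75 * X + 13 * X ^ 2 - 8 * X ^ 3 : ℚ[X]).natDegree ≤ 3 := by compute_degree
    omega)
  have h3 : lam n 3 (1350 * polN) = lam n 1 (70 - 30 * X - 8 * X ^ 2) := by
    rw [theta_three_polN, map_add, h2, zero_add, lam_succ, lam_succ]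
  have h4 : (1350 * polN : ℚ[X]) = (1350 : ℚ) • polN := (smul_eq_C_mul _).symm
  have h5 : (70 - 30 * X - 8 * X ^ 2 : ℚ[X])
      = (102 : ℚ) • 1 - (38 : ℚ) • X + (8 : ℚ) • (- X ^ 2 + X - 4) := by
    have e1 : (C 102 : ℚ[X]) = 102 := rfl
    have e2 : (C 38 : ℚ[X]) = 38 := rfl
    have e3 : (C 8 : ℚ[X]) = 8 := rfl
    rw [smul_eq_C_mul, smul_eq_C_mul, smul_eq_C_mul, e1, e2, e3]
    ring
  rw [h4, h5, map_smul, map_add, map_sub, map_smul, map_smul, map_smul, h1] at h3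
  simp only [smul_eq_mul] at h3
  linarith

theorem fracCls_add_pow (M L : ℕ) (f : ℚ[X]) : fracCls (M + L) (f * polD ^ L) = fracCls M f := by
  induction L with
  | zero => simp
  | succ L ih =>
    have h : f * polD ^ (L + 1) = polD * (f * polD ^ L) := by ring
    rw [← ih, h, ← add_assoc, fracCls_succ]

theorem lam_eq_of_fracCls_eq {n : ℚ[X]} (hn : n.natDegree ≤ 2) {M : ℕ} {f : ℚ[X]}
    (hf : f.natDegree ≤ 2 * M) {a b : ℚ} (h : fracCls M f = a • cls ω + b • cls ω') :
    lam n M f = a * lam n 0 1 + b * lam n 3 polN := by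
  obtain ⟨F, hF⟩ : ∃ F, F = f * polD ^ 3 - a • (1 * polD ^ (M + 3)) - b • (polN * polD ^ M) :=
    ⟨_, rfl⟩
  have hD : ∀ n, (polD ^ n).natDegree ≤ 2 * n := fun n => by
    rw [natDegree_pow, natDegree_polD, mul_comm]
  have h1 : fracCls (M + 3) F = 0 := by
    have h2 : fracCls (M + 3) (1 * polD ^ (M + 3)) = cls ω := by
      have := fracCls_add_pow 0 (M + 3) 1
      rwa [zero_add, ← cls_ω] at this
    have h3 : fracCls (M + 3) (polN * polD ^ M) = cls ω' := by
      rw [add_comm, fracCls_add_pow, cls_ω']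
    rw [hF, map_sub, map_sub, map_smul, map_smul, fracCls_add_pow, h2, h3, h]
    abel
  have h2 : F.natDegree ≤ 2 * (M + 3) := by
    have hN : polN.natDegree ≤ 3 := by
      unfold polN
      compute_degree
    rw [hF]
    have e1 : (a • (1 * polD ^ (M + 3))).natDegree ≤ 2 * (M + 3) := by
      rw [one_mul]
      exact (natDegree_smul_le _ _).trans (hD _)
    have e2 : (b • (polN * polD ^ M)).natDegree ≤ 3 + 2 * M :=
      (natDegree_smul_le _ _).trans (natDegree_mul_le_of_le hN (hD M))
    refine (natDegree_sub_le_of_le (natDegree_sub_le_of_le (natDegree_mul_le_of_le hf (hD 3)) e1)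
      e2).trans ?_
    omega
  have h3 := lam_eq_zero_of_fracCls hn h2 h1
  have h4 : lam n (M + 3) (1 * polD ^ (M + 3)) = lam n 0 1 := by
    have := lam_add_pow n 0 (M + 3) 1
    rwa [zero_add] at this
  have h5 : lam n (M + 3) (polN * polD ^ M) = lam n 3 polN := by
    rw [add_comm, lam_add_pow]
  rw [hF, map_sub, map_sub, map_smul, map_smul, lam_add_pow, h4, h5, smul_eq_mul, smul_eq_mul] at h3
  linarith

/-- The functionals for n = 1 and n = X take the values 1/60 and -7/60 on ω, and 19/40500 and
51/40500 on ω'. The formulas invert this matrix, of determinant 184/2430000. -/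
theorem coefficients_eq {M : ℕ} {f : ℚ[X]} (hf : f.natDegree ≤ 2 * M) {a b : ℚ}
    (h : fracCls M f = a • cls ω + b • cls ω') :
    a = (3060 * lam 1 M f - 1140 * lam X M f) * (184 : ℚ)⁻¹ ∧
    b = (283500 * lam 1 M f + 40500 * lam X M f) * (184 : ℚ)⁻¹ := by
  obtain ⟨v1, v2, v3, v4⟩ := lam_values
  have hn1 : (1 : ℚ[X]).natDegree ≤ 2 := by simp
  have hnX : (X : ℚ[X]).natDegree ≤ 2 := by simp
  have h1 := lam_eq_of_fracCls_eq hn1 hf h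
  have h2 := lam_eq_of_fracCls_eq hnX hf h
  have k1 := lam_zero_one hn1
  have k2 := lam_zero_one hnX
  have k3 := lam_three_polN hn1
  have k4 := lam_three_polN hnX
  rw [v1, v2] at k1 k3
  rw [v3, v4] at k2 k4
  have k3' : lam 1 3 polN = 19 / 40500 := by linarith
  have k4' : lam X 3 polN = 17 / 13500 := by linarith
  rw [h1, h2, k1, k2, k3', k4']
  constructor
  · ring
  · ring

end Values

end FigureEight

end

noncomputable section

namespace FigureEight

set_option linter.unusedSectionVars false

open Polynomial

/-! ### Bounds at primes other than 2, 3 and 5 -/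

section Bounds

variable {p : ℕ} [hp : Fact p.Prime]

/-- The rational numbers that are integral at `p`. -/
def padicSubring (p : ℕ) [Fact p.Prime] : Subring ℚ where
  carrier := {r | padicNorm p r ≤ 1}
  mul_mem' {a b} ha hb := by
    simp only [Set.mem_ofPred_eq] at *
    rw [padicNorm.mul]
    exact mul_le_one₀ ha (padicNorm.nonneg _) hb
  one_mem' := by simp
  add_mem' {a b} ha hb := padicNorm.nonarchimedean.trans (max_le ha hb)
  zero_mem' := by simp
  neg_mem' {a} ha := by
    simp only [Set.mem_ofPred_eq] at *
    rwa [padicNorm.neg]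

theorem mem_padicSubring {r : ℚ} : r ∈ padicSubring p ↔ padicNorm p r ≤ 1 := Iff.rfl

theorem inv_natCast_mem {m : ℕ} (hm : ¬p ∣ m) : (m : ℚ)⁻¹ ∈ padicSubring p := by
  rw [mem_padicSubring, ← one_div, padicNorm.div, (padicNorm.nat_eq_one_iff m).2 hm]
  simp

theorem padicNorm_inv_natCast_le {m : ℕ} (hm : m ≠ 0) : padicNorm p (m : ℚ)⁻¹ ≤ m := by
  have h0 : (m : ℚ)⁻¹ ≠ 0 := inv_ne_zero (by exact_mod_cast hm)
  rw [padicNorm.eq_zpow_of_nonzero h0, padicValRat.inv, neg_neg, padicValRat.of_nat, zpow_natCast]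
  exact_mod_cast Nat.le_of_dvd (Nat.pos_of_ne_zero hm) pow_padicValNat_dvd

/-- The power series whose coefficients are integral at `p`. -/
def padicSeries (p : ℕ) [Fact p.Prime] : Subring (PowerSeries ℚ) where
  carrier := {f | ∀ n, PowerSeries.coeff n f ∈ padicSubring p}
  mul_mem' {a b} ha hb n := by
    rw [PowerSeries.coeff_mul]
    exact sum_mem fun i _ => mul_mem (ha _) (hb _)
  one_mem' n := by
    rw [PowerSeries.coeff_one]
    split_ifs
    · exact one_mem _
    · exact zero_mem _
  add_mem' {a b} ha hb n := by
    rw [map_add]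
    exact add_mem (ha n) (hb n)
  zero_mem' n := by
    rw [map_zero]
    exact zero_mem _
  neg_mem' {a} ha n := by
    rw [map_neg]
    exact neg_mem (ha n)

theorem C_mem_padicSeries {r : ℚ} (hr : r ∈ padicSubring p) : PowerSeries.C r ∈ padicSeries p := by
  intro n
  rw [PowerSeries.coeff_C]
  split_ifs
  · exact hr
  · exact zero_mem _

theorem X_mem_padicSeries : (PowerSeries.X : PowerSeries ℚ) ∈ padicSeries p := by
  intro n
  rw [PowerSeries.coeff_X]
  split_ifs
  · exact one_mem _
  · exact zero_mem _

theorem mem_padicSeries_of_mul_eq_one {f g : PowerSeries ℚ} (hg : g ∈ padicSeries p)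
    (hg0 : PowerSeries.constantCoeff g = 1) (h : f * g = 1) : f ∈ padicSeries p := by
  intro n
  induction n using Nat.strong_induction_on with
  | _ n ih =>
    have h1 := congrArg (PowerSeries.coeff n) h
    rw [PowerSeries.coeff_mul, Finset.Nat.sum_antidiagonal_eq_sum_range_succ_mk,
      Finset.sum_range_succ, Nat.sub_self, PowerSeries.coeff_zero_eq_constantCoeff_apply, hg0,
      mul_one] at h1
    rw [eq_sub_of_add_eq' h1]
    refine sub_mem ((one_mem (padicSeries p)) n) (sum_mem fun i hi => mul_mem (ih i ?_) (hg _))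
    exact Finset.mem_range.1 hi

/-- The recursion for the coefficients of a square root with constant term 1 divides only by 2. -/
theorem mem_padicSeries_of_sq {f : PowerSeries ℚ} (h2 : (2 : ℚ)⁻¹ ∈ padicSubring p)
    (hf : PowerSeries.constantCoeff f = 1) (hff : f ^ 2 ∈ padicSeries p) : f ∈ padicSeries p := by
  intro n
  induction n using Nat.strong_induction_on with
  | _ n ih =>
    rcases n with - | n
    · rw [PowerSeries.coeff_zero_eq_constantCoeff_apply, hf]
      exact one_mem _
    have h1 := hff (n + 1)
    rw [pow_two, PowerSeries.coeff_mul, Finset.Nat.sum_antidiagonal_eq_sum_range_succ_mk,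
      Finset.sum_range_succ, Finset.sum_range_succ', Nat.sub_self, Nat.sub_zero,
      PowerSeries.coeff_zero_eq_constantCoeff_apply, hf, mul_one, one_mul] at h1
    have h3 : ∑ i ∈ Finset.range n, PowerSeries.coeff (i + 1) f * PowerSeries.coeff (n + 1 - (i + 1)) f
        ∈ padicSubring p := by
      refine sum_mem fun i hi => ?_
      rw [Finset.mem_range] at hi
      exact mul_mem (ih _ (by omega)) (ih _ (by omega))
    have h4 := mul_mem h2 (sub_mem h1 h3)
    convert h4 using 1
    ring

variable {e : ℚ}

theorem chi_mem (h2 : (2 : ℚ)⁻¹ ∈ padicSubring p) (he : e ∈ padicSubring p) :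
    chi e ∈ padicSeries p :=
  add_mem X_mem_padicSeries (C_mem_padicSeries (add_mem (one_mem _) (mul_mem he h2)))

theorem aeval_chi_mem (h2 : (2 : ℚ)⁻¹ ∈ padicSubring p) (he : e ∈ padicSubring p) (f : ℤ[X]) :
    aeval (chi e) (f.map (Int.castRingHom ℚ)) ∈ padicSeries p := by
  rw [aeval_eq_sum_range]
  refine sum_mem fun i _ => ?_
  rw [coeff_map, PowerSeries.smul_eq_C_mul]
  exact mul_mem (C_mem_padicSeries (intCast_mem _ _)) (pow_mem (chi_mem h2 he) _)

theorem invS_mem (he : e⁻¹ ∈ padicSubring p) : invS e ∈ padicSeries p := by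
  intro n
  rw [invS, PowerSeries.coeff_mk]
  exact mul_mem he (pow_mem (neg_mem he) n)

theorem rootC_mem (h2 : (2 : ℚ)⁻¹ ∈ padicSubring p) (he16 : e ^ 2 = 16) (he : e ∈ padicSubring p)
    (hc : (e + 16)⁻¹ ∈ padicSubring p) : rootC e ∈ padicSeries p := by
  obtain ⟨h0, h1⟩ := rootC_spec he16
  refine mem_padicSeries_of_sq h2 h0 (mem_padicSeries_of_mul_eq_one (mul_mem (C_mem_padicSeries hc)
    (mul_mem (add_mem X_mem_padicSeries (C_mem_padicSeries he)) (sub_mem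
      (pow_mem (chi_mem h2 he) 2) ?_))) ?_ h1)
  · exact_mod_cast natCast_mem (padicSeries p) 4
  · have := congrArg PowerSeries.constantCoeff h1
    rwa [map_mul, map_pow, h0, one_pow, one_mul, map_one] at this

theorem padicNorm_inv_two_mul_sub_one_le (i : ℕ) :
    padicNorm p (2 * (i : ℚ) - 1)⁻¹ ≤ 2 * i + 1 := by
  rcases i with - | i
  · norm_num
  · have h := padicNorm_inv_natCast_le (p := p) (m := 2 * i + 1) (by omega)
    have h1 : 2 * ((i + 1 : ℕ) : ℚ) - 1 = ((2 * i + 1 : ℕ) : ℚ) := by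
      push_cast
      ring
    rw [h1]
    refine h.trans ?_
    push_cast
    linarith

/-- Every factor of the local functional is integral at p except `serK`, whose coefficient i has the
denominator 2 i - 1. Only i ≤ M occur, and the p-adic norm of the inverse of a positive integer is
at most that integer. -/
theorem padicNorm_lamAt_le (h2 : (2 : ℚ)⁻¹ ∈ padicSubring p) (he16 : e ^ 2 = 16)
    (he : e ∈ padicSubring p) (he' : e⁻¹ ∈ padicSubring p) (hc : (e + 16)⁻¹ ∈ padicSubring p)
    (n f : ℤ[X]) (M : ℕ) :
    padicNorm p (lamAt e (n.map (Int.castRingHom ℚ)) M (f.map (Int.castRingHom ℚ))) ≤ 2 * M + 1 := by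
  obtain ⟨z, hz⟩ : ∃ z, z = PowerSeries.C (e + 16)⁻¹ * rootC e * invS e ^ M
    * aeval (chi e) (f.map (Int.castRingHom ℚ)) := ⟨_, rfl⟩
  have hr := rootC_mem h2 he16 he hc
  have hzm : z ∈ padicSeries p := by
    rw [hz]
    exact mul_mem (mul_mem (mul_mem (C_mem_padicSeries hc) hr) (pow_mem (invS_mem he') M))
      (aeval_chi_mem h2 he f)
  have h1 : lamAt e (n.map (Int.castRingHom ℚ)) M (f.map (Int.castRingHom ℚ))
      = PowerSeries.coeff M (serK e (n.map (Int.castRingHom ℚ)) * z) := by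
    rw [lamAt_apply, serKappa, hz]
    refine congrArg (PowerSeries.coeff M) ?_
    ring
  rw [h1, PowerSeries.coeff_mul]
  refine padicNorm.sum_le' (fun ij hij => ?_) (by positivity)
  have hij' : ij.1 + ij.2 = M := Finset.HasAntidiagonal.mem_antidiagonal.1 hij
  have h3 := mem_padicSubring.1 (hzm ij.2)
  have h4 := mem_padicSubring.1 (mul_mem (natCast_mem (padicSubring p) 2) ((mul_mem hr
    (mul_mem (aeval_chi_mem h2 he n) (invS_mem he'))) ij.1))
  have h5 := padicNorm_inv_two_mul_sub_one_le (p := p) ij.1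
  rw [padicNorm.mul, serK, PowerSeries.coeff_mk, div_eq_mul_inv, mul_right_comm, padicNorm.mul]
  have h6 : ((ij.1 : ℕ) : ℚ) ≤ M := by exact_mod_cast (by omega : ij.1 ≤ M)
  push_cast at h4
  calc _ ≤ 1 * (2 * (ij.1 : ℚ) + 1) * 1 := by
        gcongr
        · exact padicNorm.nonneg _
        · exact padicNorm.nonneg _
    _ ≤ 2 * M + 1 := by linarith

/-- The numbers to be inverted are e = ±4 and e + 16, equal to 20 or 12, besides 2; this is where 2,
3 and 5 are excluded. -/
theorem padicNorm_lam_le (h2 : p ≠ 2) (h3 : p ≠ 3) (h5 : p ≠ 5) (n f : ℤ[X]) (M : ℕ) :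
    padicNorm p (lam (n.map (Int.castRingHom ℚ)) M (f.map (Int.castRingHom ℚ))) ≤ 2 * M + 1 := by
  have hinv : ∀ q : ℕ, q.Prime → p ≠ q → (q : ℚ)⁻¹ ∈ padicSubring p := fun q hq hpq =>
    inv_natCast_mem fun h => hpq ((Nat.prime_dvd_prime_iff_eq hp.out hq).1 h)
  have i2 := hinv 2 Nat.prime_two h2
  have i3 := hinv 3 Nat.prime_three h3
  have i5 := hinv 5 Nat.prime_five h5
  push_cast at i2 i3 i5
  have i4 : (4 : ℚ)⁻¹ ∈ padicSubring p := by
    rw [show (4 : ℚ)⁻¹ = 2⁻¹ * 2⁻¹ by norm_num]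
    exact mul_mem i2 i2
  rw [lam_apply]
  refine padicNorm.nonarchimedean.trans (max_le ?_ ?_)
  · refine padicNorm_lamAt_le i2 sq_four ?_ i4 ?_ n f M
    · exact_mod_cast natCast_mem (padicSubring p) 4
    · rw [show (4 + 16 : ℚ)⁻¹ = 4⁻¹ * 5⁻¹ by norm_num]
      exact mul_mem i4 i5
  · refine padicNorm_lamAt_le i2 sq_neg_four ?_ ?_ ?_ n f M
    · exact_mod_cast intCast_mem (padicSubring p) (-4)
    · rw [inv_neg]
      exact neg_mem i4
    · rw [show (-4 + 16 : ℚ)⁻¹ = 4⁻¹ * 3⁻¹ by norm_num]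
      exact mul_mem i4 i3

/-- As 184 = 8 · 23 and p = 23 is allowed, the inverse of 184 need not be integral; its norm is
absorbed into the constant. -/
theorem padicNorm_combination_le {B r s : ℚ} (hr : padicNorm p r ≤ B)
    (hs : padicNorm p s ≤ B) (m n : ℤ) : padicNorm p ((m * r + n * s) * (184 : ℚ)⁻¹) ≤ 184 * B := by
  have h1 : ∀ (m : ℤ) {r : ℚ}, padicNorm p r ≤ B → padicNorm p (m * r) ≤ B := by
    intro m r hr
    rw [padicNorm.mul]
    exact (mul_le_of_le_one_left (padicNorm.nonneg _) (padicNorm.of_int m)).trans hr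
  rw [padicNorm.mul, mul_comm]
  refine mul_le_mul ?_ (padicNorm.nonarchimedean.trans (max_le (h1 m hr) (h1 n hs)))
    (padicNorm.nonneg _) (by norm_num)
  exact_mod_cast padicNorm_inv_natCast_le (p := p) (m := 184) (by norm_num)

theorem neg_logb_le_padicValRat {a : ℚ} {m k : ℕ} (hm : 0 < m) (hk : 0 < k)
    (h : padicNorm p a ≤ m * k) :
    -Real.logb p m - Real.logb p k ≤ (padicValRat p a : ℝ) := by
  have hp1 : (1 : ℝ) < p := by exact_mod_cast hp.out.one_lt
  have hm' : (1 : ℝ) ≤ m := by exact_mod_cast hm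
  have hk' : (1 : ℝ) ≤ k := by exact_mod_cast hk
  by_cases ha : a = 0
  · rw [ha, padicValRat.zero]
    have := Real.logb_nonneg hp1 hm'
    have := Real.logb_nonneg hp1 hk'
    push_cast
    linarith
  · rw [padicNorm.eq_zpow_of_nonzero ha] at h
    have h1 : (p : ℝ) ^ (-(padicValRat p a : ℝ)) ≤ m * k := by
      have h2 : (((p : ℚ) ^ (-padicValRat p a) : ℚ) : ℝ) ≤ ((m * k : ℚ) : ℝ) := Rat.cast_le.2 h
      push_cast at h2
      rw [← Int.cast_neg, Real.rpow_intCast]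
      exact h2
    have h2 := (Real.le_logb_iff_rpow_le hp1 (by positivity)).2 h1
    rw [Real.logb_mul (by positivity) (by positivity)] at h2
    linarith

end Bounds

theorem existsUnique_isExpansion (k : ℕ) : ∃! c : ℚ × ℚ, IsExpansion k c.1 c.2 := by
  obtain ⟨f, hf, h⟩ := exists_cls_gCoeff_eq k
  have hf' : (f.map (Int.castRingHom ℚ)).natDegree ≤ 2 * (2 * k) :=
    natDegree_map_le.trans (hf.trans (by omega))
  obtain ⟨a, b, hab⟩ := exists_fracCls_eq_cls hf'
  refine ⟨(a, b), h.trans hab, ?_⟩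
  rintro ⟨a', b'⟩ h'
  obtain ⟨h1, h2⟩ := coefficients_eq hf' hab
  obtain ⟨h3, h4⟩ := coefficients_eq hf' (h.symm.trans h')
  rw [Prod.mk.injEq]
  exact ⟨h3.trans h1.symm, h4.trans h2.symm⟩

theorem padicNorm_le_of_isExpansion {k : ℕ} (hk : 1 ≤ k) {a b : ℚ} (h : IsExpansion k a b) {p : ℕ}
    [Fact p.Prime] (h2 : p ≠ 2) (h3 : p ≠ 3) (h5 : p ≠ 5) :
    padicNorm p a ≤ (920 : ℕ) * k ∧ padicNorm p b ≤ (920 : ℕ) * k := by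
  obtain ⟨f, hf, hcls⟩ := exists_cls_gCoeff_eq k
  have hf' : (f.map (Int.castRingHom ℚ)).natDegree ≤ 2 * (2 * k) :=
    natDegree_map_le.trans (hf.trans (by omega))
  obtain ⟨ha, hb⟩ := coefficients_eq hf' (hcls.symm.trans h)
  have b1 := padicNorm_lam_le h2 h3 h5 1 f (2 * k)
  have b2 := padicNorm_lam_le h2 h3 h5 X f (2 * k)
  rw [Polynomial.map_one] at b1
  rw [Polynomial.map_X] at b2
  have hk' : (1 : ℚ) ≤ k := by exact_mod_cast hk
  have c1 := padicNorm_combination_le b1 b2 3060 (-1140)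
  have c2 := padicNorm_combination_le b1 b2 283500 40500
  -- For k ≥ 1 one has 4 k + 1 ≤ 5 k, and 184 · 5 = 920.
  have hle : (184 : ℚ) * (2 * (2 * k : ℕ) + 1) ≤ (920 : ℕ) * k := by
    push_cast
    linarith
  constructor
  · rw [ha]
    refine le_trans (le_of_eq ?_) (c1.trans hle)
    push_cast
    ring_nf
  · rw [hb]
    refine le_trans (le_of_eq ?_) (c2.trans hle)
    push_cast
    ring_nf

end FigureEight

end

theorem proposition4p3 :
    (∀ k : ℕ, ∃! c : ℚ × ℚ, FigureEight.IsExpansion k c.1 c.2) ∧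
    ∃ M : ℕ, 0 < M ∧ ∀ k : ℕ, 1 ≤ k → ∀ a b : ℚ, FigureEight.IsExpansion k a b →
      ∀ p : ℕ, p.Prime → p ≠ 2 → p ≠ 3 → p ≠ 5 →
        -Real.logb p M - Real.logb p k ≤ (padicValRat p a : ℝ) ∧
        -Real.logb p M - Real.logb p k ≤ (padicValRat p b : ℝ) := by
  refine ⟨FigureEight.existsUnique_isExpansion, 920, by norm_num, ?_⟩
  intro k hk a b h p hp h2 h3 h5
  have : Fact p.Prime := ⟨hp⟩
  obtain ⟨ha, hb⟩ := FigureEight.padicNorm_le_of_isExpansion hk h h2 h3 h5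
  exact ⟨FigureEight.neg_logb_le_padicValRat (by norm_num) hk ha,
    FigureEight.neg_logb_le_padicValRat (by norm_num) hk hb⟩
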